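/- Let $\lambda\in\{1,-1\}$, $L>0$, $0<T<\infty$, and let $q(x,t)$ be a smooth solution of $$i q_t+q_{xx}-2\lambda q|q|^2=0,\qquad (x,t)\in\mathbb R\times[0,T],\qquad q(x+L,t)=q(x,t).$$ **Spectral functions.** Put $\sigma_3=\mathrm{diag}(1,-1)$, $Q=\begin{pmatrix}0&q\\ \lambda\bar q&0\end{pmatrix}$, $\tilde Q=2kQ-iQ_x\sigma_3-i\lambda|q|^2\sigma_3$. Let $\mu_1,\mu_3$ be the solutions on $[0,L]\times[0,T]$ of $$\mu_x+ik[\sigma_3,\mu]=Q\mu,\qquad \mu_t+2ik^2[\sigma_3,\mu]=\tilde Q\mu$$ which equal the identity matrix at $(0,T)$ and $(L,0)$, respectively. For $k\in\mathbb C$ set $a=(\mu_3(0,0,k))_{22}$, $b=(\mu_3(0,0,k))_{12}$, $A=(\mu_1(0,0,k))_{22}$, $B=(\mu_1(0,0,k))_{12}$, and $\Gamma=B/A$. For a function $f$ of $k$ write $\bar f(k)=\overline{f(\bar k)}$, and define the meromorphic functions $$\eta=\frac{\lambda(\bar b+a\bar\Gamma e^{-2ikL})}{(a+\lambda\bar b\Gamma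 e^{2ikL})(\lambda\Gamma\bar\Gamma-1)},\qquad \xi=\frac{\lambda(\bar a\bar\Gamma-\bar b)}{a-\lambda b\bar\Gamma}.$$ **Assumption.** Let $D_1,\dots,D_4$ be the open quadrants of $\mathbb C$ and $\Sigma=\mathbb R\cup i\mathbb R$. Assume: $\Gamma,\eta,\xi$ have no poles on $\Sigma$; in $D_1$, $\Gamma$ has at most finitely many poles $k_j$, all simple; in $D_1$, $\eta$ has at most finitely many poles $K_j$, all simple and disjoint from the poles of $\Gamma$; in $D_2$, $\xi$ has at most finitely many poles $\kappa_j$, all simple; and the set $P$ of all the points $k_j,\bar k_j,K_j,\bar K_j,\kappa_j,\bar\kappa_j$ contains no zero of $a$ and no zero of $b$. **Riemann--Hilbert problem.** Let $\theta=kx+2k^2t$. Orient the positive imaginary, positive real, negative imaginary and negative real half-axes down, right, up and left, respectively; $+$ and $-$ denote limits from the left and from the right, and $[m]_1,[m]_2$ are the columns of $m$. For given $(x,t)$ find a $2\times2$-matrix valued function $m(x,t,\cdot)$ on $\mathbb C\setminus(\Sigma\cup P)$ such that: 1. $m$ is analytic in $\mathbb C\setminus(\Sigma\cup P)$. 2.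 The limits $m_\pm$ on $\Sigma\setminus\{0\}$ exist, are continuous there, and satisfy $m_-=m_+v$, where $v=v_1,v_2,v_3,v_4$ for $\arg k=\frac\pi2,0,-\frac\pi2,\pi$, respectively, with $$v_1=\begin{pmatrix}\frac{a-\lambda b\bar\Gamma-\lambda\Gamma(\bar a\bar\Gamma-\bar b)e^{2ikL}}{a-\lambda b\bar\Gamma}&-\Gamma e^{2ikL}e^{-2i\theta}\\ \frac{\lambda\bar\Gamma e^{2i\theta}}{(a-\lambda b\bar\Gamma)(a+\lambda\bar b\Gamma e^{2ikL})}&\frac{a}{a+\lambda\bar b\Gamma e^{2ikL}}\end{pmatrix},$$ $$v_2=\begin{pmatrix}1-\lambda\Gamma\bar\Gamma&-\frac{(\bar a\Gamma e^{2ikL}+b)e^{-2i\theta}}{\bar a+\lambda b\bar\Gamma e^{-2ikL}}\\ \frac{\lambda(a\bar\Gamma e^{-2ikL}+\bar b)e^{2i\theta}}{a+\lambda\bar b\Gamma e^{2ikL}}&\frac{1}{(a+\lambda\bar b\Gamma e^{2ikL})(\bar a+\lambda b\bar\Gamma e^{-2ikL})}\end{pmatrix},$$ $$v_3=\begin{pmatrix}\frac{\bar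 a-\lambda\bar b\Gamma-\lambda\bar\Gamma(a\Gamma-b)e^{-2ikL}}{\bar a-\lambda\bar b\Gamma}&-\frac{\Gamma e^{-2i\theta}}{(\bar a-\lambda\bar b\Gamma)(\bar a+\lambda b\bar\Gamma e^{-2ikL})}\\ \lambda\bar\Gamma e^{-2ikL}e^{2i\theta}&\frac{\bar a}{\bar a+\lambda b\bar\Gamma e^{-2ikL}}\end{pmatrix},$$ $$v_4=\begin{pmatrix}\frac{1-\lambda\Gamma\bar\Gamma}{(a-\lambda b\bar\Gamma)(\bar a-\lambda\bar b\Gamma)}&-\frac{(a\Gamma-b)e^{-2i\theta}}{\bar a-\lambda\bar b\Gamma}\\ \frac{\lambda(\bar a\bar\Gamma-\bar b)e^{2i\theta}}{a-\lambda b\bar\Gamma}&1\end{pmatrix}.$$ 3. $m=I+O(k^{-1})$ as $k\to\infty$ and $m=O(1)$ as $k\to0$ (for $k \in \mathbb C\setminus\Sigma$). 4. $[m]_1=O(k-k_j)$ and $[m]_2=O((k-k_j)^{-1})$ as $k\to k_j$; $[m]_1=O((k-\bar k_j)^{-1})$ and $[m]_2=O(k-\bar k_j)$ as $k\to\bar k_j$.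 5. At $K_j$, $[m]_2$ is analytic and $[m]_1$ has at most a simple pole, with $\mathrm{Res}_{K_j}[m]_1=[m(x,t,K_j)]_2\,e^{2i\theta(x,t,K_j)}\,\mathrm{Res}_{K_j}\eta$; at $\bar K_j$, $[m]_1$ is analytic and $[m]_2$ has at most a simple pole, with $\mathrm{Res}_{\bar K_j}[m]_2=\lambda[m(x,t,\bar K_j)]_1\,e^{-2i\theta(x,t,\bar K_j)}\,\overline{\mathrm{Res}_{K_j}\eta}$. 6. The same conditions as in 5 hold with $K_j,\eta$ replaced by $\kappa_j,\xi$. **Claim.** For each $(x,t)\in[0,L]\times[0,T]$ this problem, whose data depend on the boundary values of $q$ only through $\Gamma$, has a unique solution $m(x,t,\cdot)$. The solution $q$ is recovered by $$q(x,t)=2i\lim_{k\to\infty}k\,m_{12}(x,t,k),$$ where $k\to\infty$ in any sector $\{k\in D_j:\ |\mathrm{Re}\,k|\ge\varepsilon|k|,\ |\mathrm{Im}\,k|\ge\varepsilon|k|\}$, $\varepsilon>0$, $j=1,\dots,4$ (in particular along any ray from the origin not contained in $\Sigma$), except that at the four corners $(x,t)=(L,T),(L,0),(0,T),(0,0)$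 the quadrant $D_1,D_2,D_3,D_4$, respectively, is excluded. Moreover, for all $k\in\mathbb C\setminus(\Sigma\cup P)$, $$\det m=1,\qquad m_{11}(x,t,k)=\overline{m_{22}(x,t,\bar k)},\qquad m_{21}(x,t,k)=\lambda\,\overline{m_{12}(x,t,\bar k)}.$$ -/

import Mathlib

open Filter Topology Asymptotics
open scoped ContDiff ComplexConjugate

namespace PeriodicNLS

/-- Complex `2 × 2` matrices; row and column indices are `0` and `1`. -/
abbrev Mat : Type := Matrix (Fin 2) (Fin 2) ℂ

/-! ### The NLS equation -/

/-- `q` is a smooth solution of `i q_t + q_xx - 2 lam q |q|² = 0` on `ℝ × [0,T]` which is periodic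
in `x` with period `L`. The `t`-derivative is one-sided at `t = 0` and `t = T`. -/
structure IsPeriodicSolution (lam L T : ℝ) (q : ℝ → ℝ → ℂ) : Prop where
  smooth : ContDiffOn ℝ ∞ (fun p : ℝ × ℝ => q p.1 p.2) (Set.univ ×ˢ Set.Icc 0 T)
  periodic : ∀ x : ℝ, ∀ t ∈ Set.Icc 0 T, q (x + L) t = q x t
  nls : ∀ x : ℝ, ∀ t ∈ Set.Icc 0 T,
    Complex.I * derivWithin (fun s => q x s) (Set.Icc 0 T) t
      + iteratedDeriv 2 (fun y => q y t) x
      - 2 * (lam : ℂ) * q x t * (‖q x t‖ : ℂ) ^ 2 = 0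

/-! ### The Lax pair and the spectral functions -/

/-- The third Pauli matrix. -/
def sigma3 : Mat := !![1, 0; 0, -1]

/-- The matrix `Q` built from a value of `q`. -/
noncomputable def matQ (lam : ℝ) (z : ℂ) : Mat := !![0, z; (lam : ℂ) * conj z, 0]

/-- `Q̃ = 2 k Q - i Q_x σ₃ - i lam |q|² σ₃`. -/
noncomputable def matQtilde (lam : ℝ) (q : ℝ → ℝ → ℂ) (x t : ℝ) (k : ℂ) : Mat :=
  (2 * k) • matQ lam (q x t)
    - Complex.I • (matQ lam (deriv (fun y => q y t) x) * sigma3)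
    - (Complex.I * (lam : ℂ) * (‖q x t‖ : ℂ) ^ 2) • sigma3

/-- `μ` solves both equations of the Lax pair
`μ_x + i k [σ₃, μ] = Q μ`, `μ_t + 2 i k² [σ₃, μ] = Q̃ μ` on `[0,L] × [0,T]`
and is the identity matrix at `(x₀, t₀)`. -/
structure IsEigenfunction (lam L T : ℝ) (q : ℝ → ℝ → ℂ) (x₀ t₀ : ℝ) (k : ℂ)
    (μ : ℝ → ℝ → Mat) : Prop where
  lax_x : ∀ x ∈ Set.Icc 0 L, ∀ t ∈ Set.Icc 0 T, ∀ i j : Fin 2,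
    HasDerivWithinAt (fun y => μ y t i j)
      ((matQ lam (q x t) * μ x t
        - (Complex.I * k) • (sigma3 * μ x t - μ x t * sigma3)) i j) (Set.Icc 0 L) x
  lax_t : ∀ x ∈ Set.Icc 0 L, ∀ t ∈ Set.Icc 0 T, ∀ i j : Fin 2,
    HasDerivWithinAt (fun s => μ x s i j)
      ((matQtilde lam q x t k * μ x t
        - (2 * Complex.I * k ^ 2) • (sigma3 * μ x t - μ x t * sigma3)) i j) (Set.Icc 0 T) t
  normalized : μ x₀ t₀ = 1

/-- The eigenfunction normalized at `(x₀, t₀)`. For a smooth solution `q` of the NLS equation and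
`(x₀, t₀)` in the rectangle `[0,L] × [0,T]` it exists and is unique on that rectangle. -/
noncomputable def eigenfunction (lam L T : ℝ) (q : ℝ → ℝ → ℂ) (x₀ t₀ : ℝ) (k : ℂ) :
    ℝ → ℝ → Mat :=
  Classical.epsilon (IsEigenfunction lam L T q x₀ t₀ k)

/-- `s(k) = μ₃(0,0,k)`, where `μ₃` is normalized at `(L, 0)`. -/
noncomputable def specs (lam L T : ℝ) (q : ℝ → ℝ → ℂ) (k : ℂ) : Mat :=
  eigenfunction lam L T q L 0 k 0 0

/-- `S(k) = μ₁(0,0,k)`, where `μ₁` is normalized at `(0, T)`. -/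
noncomputable def specS (lam L T : ℝ) (q : ℝ → ℝ → ℂ) (k : ℂ) : Mat :=
  eigenfunction lam L T q 0 T k 0 0

/-- `a(k)`, the `(22)` entry of `s(k)`. -/
noncomputable def speca (lam L T : ℝ) (q : ℝ → ℝ → ℂ) (k : ℂ) : ℂ := specs lam L T q k 1 1

/-- `b(k)`, the `(12)` entry of `s(k)`. -/
noncomputable def specb (lam L T : ℝ) (q : ℝ → ℝ → ℂ) (k : ℂ) : ℂ := specs lam L T q k 0 1

/-- `A(k)`, the `(22)` entry of `S(k)`. -/
noncomputable def specA (lam L T : ℝ) (q : ℝ → ℝ → ℂ) (k : ℂ) : ℂ := specS lam L T q k 1 1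

/-- `B(k)`, the `(12)` entry of `S(k)`. -/
noncomputable def specB (lam L T : ℝ) (q : ℝ → ℝ → ℂ) (k : ℂ) : ℂ := specS lam L T q k 0 1

/-- `Γ = B / A`. -/
noncomputable def specGamma (lam L T : ℝ) (q : ℝ → ℝ → ℂ) (k : ℂ) : ℂ :=
  specB lam L T q k / specA lam L T q k

/-! ### The functions `η` and `ξ` and the assumption on poles

From here on everything is expressed through three functions `a`, `b`, `Γ` of `k`. -/

/-- The Schwarz conjugate `k ↦ conj (f (conj k))`, denoted by a bar in the formulas below. -/
noncomputable def schwarz (f : ℂ → ℂ) (k : ℂ) : ℂ := conj (f (conj k))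

/-- `η = lam (b̄ + a Γ̄ e^{-2ikL}) / ((a + lam b̄ Γ e^{2ikL}) (lam Γ Γ̄ - 1))`. -/
noncomputable def eta (lam L : ℝ) (a b Γ : ℂ → ℂ) (k : ℂ) : ℂ :=
  (lam : ℂ) * (schwarz b k + a k * schwarz Γ k * Complex.exp (-(2 * Complex.I * k * L)))
    / ((a k + lam * schwarz b k * Γ k * Complex.exp (2 * Complex.I * k * L))
      * (lam * Γ k * schwarz Γ k - 1))

/-- `ξ = lam (ā Γ̄ - b̄) / (a - lam b Γ̄)`. -/
noncomputable def xi (lam : ℝ) (a b Γ : ℂ → ℂ) (k : ℂ) : ℂ :=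
  (lam : ℂ) * (schwarz a k * schwarz Γ k - schwarz b k) / (a k - lam * b k * schwarz Γ k)

/-- `f` has a pole at `k` (as a meromorphic function; the value of `f` at `k` is irrelevant). -/
def HasPole (f : ℂ → ℂ) (k : ℂ) : Prop := MeromorphicAt f k ∧ meromorphicOrderAt f k < 0

/-- `f` has a simple pole at `k`. -/
def HasSimplePole (f : ℂ → ℂ) (k : ℂ) : Prop := MeromorphicAt f k ∧ meromorphicOrderAt f k = -1

/-- The residue of `f` at a simple pole `z`: the limit of `(k - z) f(k)` as `k → z`. -/
noncomputable def residue (f : ℂ → ℂ) (z : ℂ) : ℂ := limUnder (𝓝[≠] z) fun k => (k - z) * f k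

/-- The open quadrants `D₁, D₂, D₃, D₄` (indexed by `0, 1, 2, 3`). -/
def quadrant : Fin 4 → Set ℂ :=
  ![{k | 0 < k.re ∧ 0 < k.im}, {k | k.re < 0 ∧ 0 < k.im},
    {k | k.re < 0 ∧ k.im < 0}, {k | 0 < k.re ∧ k.im < 0}]

/-- The contour `Σ = ℝ ∪ iℝ`. -/
def contour : Set ℂ := {k | k.im = 0 ∨ k.re = 0}

/-- The poles `k_j` of `Γ` in `D₁`. -/
def gammaPoles (Γ : ℂ → ℂ) : Set ℂ := {k | k ∈ quadrant 0 ∧ HasPole Γ k}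

/-- The poles `K_j` of `η` in `D₁`. -/
def etaPoles (lam L : ℝ) (a b Γ : ℂ → ℂ) : Set ℂ :=
  {k | k ∈ quadrant 0 ∧ HasPole (eta lam L a b Γ) k}

/-- The poles `κ_j` of `ξ` in `D₂`. -/
def xiPoles (lam : ℝ) (a b Γ : ℂ → ℂ) : Set ℂ :=
  {k | k ∈ quadrant 1 ∧ HasPole (xi lam a b Γ) k}

/-- The set `P` of all these poles and their complex conjugates. -/
def poleSet (lam L : ℝ) (a b Γ : ℂ → ℂ) : Set ℂ :=
  {k | k ∈ gammaPoles Γ ∪ etaPoles lam L a b Γ ∪ xiPoles lam a b Γ ∨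
    conj k ∈ gammaPoles Γ ∪ etaPoles lam L a b Γ ∪ xiPoles lam a b Γ}

/-- The genericity assumption on the poles of `Γ`, `η` and `ξ`. -/
structure PoleAssumption (lam L : ℝ) (a b Γ : ℂ → ℂ) : Prop where
  no_pole_on_contour : ∀ k ∈ contour,
    ¬ HasPole Γ k ∧ ¬ HasPole (eta lam L a b Γ) k ∧ ¬ HasPole (xi lam a b Γ) k
  gamma_finite : (gammaPoles Γ).Finite
  gamma_simple : ∀ k ∈ gammaPoles Γ, HasSimplePole Γ k
  eta_finite : (etaPoles lam L a b Γ).Finite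
  eta_simple : ∀ k ∈ etaPoles lam L a b Γ, HasSimplePole (eta lam L a b Γ) k
  eta_disjoint_gamma : Disjoint (etaPoles lam L a b Γ) (gammaPoles Γ)
  xi_finite : (xiPoles lam a b Γ).Finite
  xi_simple : ∀ k ∈ xiPoles lam a b Γ, HasSimplePole (xi lam a b Γ) k
  zeros_disjoint : ∀ k ∈ poleSet lam L a b Γ, a k ≠ 0 ∧ b k ≠ 0

/-! ### The Riemann-Hilbert problem for `m` -/

/-- `θ(x,t,k) = k x + 2 k² t`. -/
noncomputable def theta (x t : ℝ) (k : ℂ) : ℂ := k * x + 2 * k ^ 2 * t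

/-- The open rays of `Σ ∖ {0}`: `arg k = π/2, 0, -π/2, π` (indexed by `0, 1, 2, 3`). -/
def ray : Fin 4 → Set ℂ :=
  ![{k | k.re = 0 ∧ 0 < k.im}, {k | 0 < k.re ∧ k.im = 0},
    {k | k.re = 0 ∧ k.im < 0}, {k | k.re < 0 ∧ k.im = 0}]

/-- The quadrant to the left of each ray. The positive imaginary, positive real, negative
imaginary and negative real half-axes are oriented down, right, up and left, respectively. -/
def leftQuadrant : Fin 4 → Set ℂ := ![quadrant 0, quadrant 0, quadrant 2, quadrant 2]

/-- The quadrant to the right of each ray. -/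
def rightQuadrant : Fin 4 → Set ℂ := ![quadrant 1, quadrant 3, quadrant 3, quadrant 1]

/-- The jump matrices `v₁, v₂, v₃, v₄` on the four rays (indexed by `0, 1, 2, 3`). -/
noncomputable def jump (lam L : ℝ) (a b Γ : ℂ → ℂ) (x t : ℝ) (j : Fin 4) (k : ℂ) : Mat :=
  let l : ℂ := lam
  let ak := a k
  let bk := b k
  let Gk := Γ k
  let ac := schwarz a k
  let bc := schwarz b k
  let Gc := schwarz Γ k
  -- `E = e^{2ikL}`, `E' = e^{-2ikL}`, `e = e^{2iθ}`, `e' = e^{-2iθ}`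
  let E := Complex.exp (2 * Complex.I * k * L)
  let E' := Complex.exp (-(2 * Complex.I * k * L))
  let e := Complex.exp (2 * Complex.I * theta x t k)
  let e' := Complex.exp (-(2 * Complex.I * theta x t k))
  (![!![(ak - l * bk * Gc - l * Gk * (ac * Gc - bc) * E) / (ak - l * bk * Gc),
        -(Gk * E * e');
        l * Gc * e / ((ak - l * bk * Gc) * (ak + l * bc * Gk * E)),
        ak / (ak + l * bc * Gk * E)],
     !![1 - l * Gk * Gc,
        -((ac * Gk * E + bk) * e' / (ac + l * bk * Gc * E'));
        l * (ak * Gc * E' + bc) * e / (ak + l * bc * Gk * E),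
        1 / ((ak + l * bc * Gk * E) * (ac + l * bk * Gc * E'))],
     !![(ac - l * bc * Gk - l * Gc * (ak * Gk - bk) * E') / (ac - l * bc * Gk),
        -(Gk * e' / ((ac - l * bc * Gk) * (ac + l * bk * Gc * E')));
        l * Gc * E' * e,
        ac / (ac + l * bk * Gc * E')],
     !![(1 - l * Gk * Gc) / ((ak - l * bk * Gc) * (ac - l * bc * Gk)),
        -((ak * Gk - bk) * e' / (ac - l * bc * Gk));
        l * (ac * Gc - bc) * e / (ak - l * bk * Gc),
        1]] : Fin 4 → Mat) j

/-- At `z`, column `c'` of `m` is analytic (its limit at `z` exists) and column `c` has at most a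
simple pole, with residue `r` times the value of column `c'` at `z`. -/
def ResidueCondition (m : ℂ → Mat) (z : ℂ) (c c' : Fin 2) (r : ℂ) : Prop :=
  ∃ w : Fin 2 → ℂ, ∀ i : Fin 2,
    Tendsto (fun k => m k i c') (𝓝[≠] z) (𝓝 (w i)) ∧
    Tendsto (fun k => (k - z) * m k i c) (𝓝[≠] z) (𝓝 (w i * r))

/-- The function `m = m(x,t,·)` solves the Riemann-Hilbert problem determined by `a`, `b`, `Γ`.
Only the values of `m` on `ℂ ∖ (Σ ∪ P)` are relevant. -/
structure SolvesRHP (lam L : ℝ) (a b Γ : ℂ → ℂ) (x t : ℝ) (m : ℂ → Mat) : Prop where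
  analytic : ∀ i j : Fin 2,
    AnalyticOnNhd ℂ (fun k => m k i j) (contour ∪ poleSet lam L a b Γ)ᶜ
  /-- The boundary values `m₊` (from the left) and `m₋` (from the right) exist, are continuous on
  `Σ ∖ {0}`, and satisfy `m₋ = m₊ v`. -/
  jump_relation : ∃ mp mm : ℂ → Mat,
    (∀ i j : Fin 2, ContinuousOn (fun k => mp k i j) (contour \ {0})) ∧
    (∀ i j : Fin 2, ContinuousOn (fun k => mm k i j) (contour \ {0})) ∧
    ∀ n : Fin 4, ∀ z ∈ ray n,
      (∀ i j : Fin 2, Tendsto (fun k => m k i j) (𝓝[leftQuadrant n] z) (𝓝 (mp z i j))) ∧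
      (∀ i j : Fin 2, Tendsto (fun k => m k i j) (𝓝[rightQuadrant n] z) (𝓝 (mm z i j))) ∧
      mm z = mp z * jump lam L a b Γ x t n z
  at_infinity : ∀ i j : Fin 2,
    (fun k => m k i j - (1 : Mat) i j)
      =O[Bornology.cobounded ℂ ⊓ 𝓟 contourᶜ] fun k => k⁻¹
  at_zero : ∀ i j : Fin 2, (fun k => m k i j) =O[𝓝[contourᶜ] 0] fun _ => (1 : ℂ)
  at_gamma : ∀ z ∈ gammaPoles Γ, ∀ i : Fin 2,
    ((fun k => m k i 0) =O[𝓝[≠] z] fun k => k - z) ∧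
    ((fun k => m k i 1) =O[𝓝[≠] z] fun k => (k - z)⁻¹)
  at_gamma_conj : ∀ z ∈ gammaPoles Γ, ∀ i : Fin 2,
    ((fun k => m k i 0) =O[𝓝[≠] (conj z)] fun k => (k - conj z)⁻¹) ∧
    ((fun k => m k i 1) =O[𝓝[≠] (conj z)] fun k => k - conj z)
  at_eta : ∀ z ∈ etaPoles lam L a b Γ,
    ResidueCondition m z 0 1
      (Complex.exp (2 * Complex.I * theta x t z) * residue (eta lam L a b Γ) z)
  at_eta_conj : ∀ z ∈ etaPoles lam L a b Γ,
    ResidueCondition m (conj z) 1 0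
      (lam * Complex.exp (-(2 * Complex.I * theta x t (conj z)))
        * conj (residue (eta lam L a b Γ) z))
  at_xi : ∀ z ∈ xiPoles lam a b Γ,
    ResidueCondition m z 0 1
      (Complex.exp (2 * Complex.I * theta x t z) * residue (xi lam a b Γ) z)
  at_xi_conj : ∀ z ∈ xiPoles lam a b Γ,
    ResidueCondition m (conj z) 1 0
      (lam * Complex.exp (-(2 * Complex.I * theta x t (conj z)))
        * conj (residue (xi lam a b Γ) z))

/-! ### Recovery of `q` -/

/-- The closed sector `{k ∈ D_j : |Re k| ≥ ε |k|, |Im k| ≥ ε |k|}` inside the open quadrant. Every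
open ray from the origin in `D_j` lies in it for all small `ε > 0`. -/
def sector (ε : ℝ) (j : Fin 4) : Set ℂ :=
  {k | k ∈ quadrant j ∧ ε * ‖k‖ ≤ |k.re| ∧ ε * ‖k‖ ≤ |k.im|}

/-- The corners `(L,T), (L,0), (0,T), (0,0)` of `[0,L] × [0,T]`, associated with
`D₁, D₂, D₃, D₄`, respectively. -/
def corner (L T : ℝ) : Fin 4 → ℝ × ℝ := ![(L, T), (L, 0), (0, T), (0, 0)]

end PeriodicNLS

open PeriodicNLS

/-! ### Linear differential equations -/

/-! The NLS equation is the compatibility condition of the Lax pair ψ_x = Uψ, ψ_t = Vψ. Hence there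
is a solution ψ on the whole rectangle with ψ(0,0) = 1; it has determinant one and is entire in k
(`exists_fundamental`). The eigenfunction normalized at (x₀,t₀) is ψ(x,t) ψ(x₀,t₀)⁻¹ times a
diagonal exponential, so everything reduces to ψ.

Large k: the second column of that eigenfunction is governed by the exponentials of -2ik(x - x₀) and
-4ik²(t - t₀). For each quadrant exactly one corner (x₀,t₀) keeps both bounded on the rectangle. A
gauge transformation built from q and q_x leaves a system with coupling O(1/k). So the column of the
matching corner is (0,1) + O(1/k) in its quadrant, and its first entry is q/(2ik) + o(1/k) wherever
the exponentials decay, that is, in closed subsectors and away from the corner itself, where the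
column is exactly (0,1) (`IsFundamental.muCol_asymptotics`).

Existence: let u, v, y, z be the second columns for the corners (L,T), (L,0), (0,T), (0,0), and U,
V, Y, Z the first columns obtained from them by the symmetry k ↦ conj k. All are combinations of Z
and z with coefficients made of a, b, A, B (`IsFundamental.isScattering`). Periodicity enters
through ψ(L,t) = ψ(0,t) ψ(L,0): because of it u needs no further spectral function. With F = aA + λ
b̄ B e^{2ikL} and H = a Ā - λ b B̄ put m = (Z A/F, u/A) in D₁ and m = (Y/H, v) in D₂, and reflect
for D₄ and D₃. Since det(Z,u) = F and det(Y,v) = H, det m = 1. The factor A is distributed so that A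
and B occur only through Γ = B/A. The jumps are then rational identities (`IsRHPData.quadSol_jump`).
The functions Γ, η, ξ are quotients of entire functions with denominators A, F, H, so the pole
assumption controls the zeros of A, F and H; at a zero of F or H the two columns become
proportional, which is the residue condition.

Uniqueness: if m' is another solution, then m' m⁻¹ has no jump, its singularities at P and at 0 are
removable, and it tends to I at infinity. Morera's theorem across the two axes and Liouville's
theorem give m' m⁻¹ = I (`eq_of_removable_contour`, `SolvesRHP_unique`). -/

theorem gronwallBound_le_mul_exp {δ K ε s : ℝ} (hK : 0 ≤ K) (hε : 0 ≤ ε) :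
    gronwallBound δ K ε s ≤ (δ + ε * s) * Real.exp (K * s) := by
  rcases hK.eq_or_lt with rfl | hK
  · simp [gronwallBound_K0]
  · rw [gronwallBound_of_K_ne_0 hK.ne']
    -- The bound e^u - 1 ≤ u e^u cancels the division by K, so later estimates need no separate case
    -- K = 0.
    have h1 : (Real.exp (K * s) - 1) ≤ K * s * Real.exp (K * s) := by
      have := Real.add_one_le_exp (-(K * s))
      have h2 : Real.exp (-(K * s)) * Real.exp (K * s) = 1 := by rw [← Real.exp_add]; simp
      nlinarith [Real.exp_pos (K * s)]
    have h3 : ε / K * (Real.exp (K * s) - 1) ≤ ε / K * (K * s * Real.exp (K * s)) :=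
      mul_le_mul_of_nonneg_left h1 (by positivity)
    have h4 : ε / K * (K * s * Real.exp (K * s)) = ε * s * Real.exp (K * s) := by
      field_simp
    simp only
    linarith

theorem HasDerivWithinAt.Ici_of_Icc {E : Type*} [NormedAddCommGroup E] [NormedSpace ℝ E]
    {f : ℝ → E} {f' : E} {a b s : ℝ} (h : HasDerivWithinAt f f' (Set.Icc a b) s)
    (hs : s ∈ Set.Ico a b) : HasDerivWithinAt f f' (Set.Ici s) s :=
  h.mono_of_mem_nhdsWithin (Icc_mem_nhdsGE_of_mem hs)

theorem norm_le_of_norm_deriv_le_Icc {E : Type*} [NormedAddCommGroup E] [NormedSpace ℝ E]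
    {f f' : ℝ → E} {δ K ε ℓ : ℝ} (hK : 0 ≤ K) (hε : 0 ≤ ε)
    (hf : ∀ s ∈ Set.Icc 0 ℓ, HasDerivWithinAt f (f' s) (Set.Icc 0 ℓ) s)
    (h0 : ‖f 0‖ ≤ δ) (hb : ∀ s ∈ Set.Icc 0 ℓ, ‖f' s‖ ≤ K * ‖f s‖ + ε) :
    ∀ s ∈ Set.Icc 0 ℓ, ‖f s‖ ≤ (δ + ε * ℓ) * Real.exp (K * ℓ) := by
  intro s hs
  have hδ : 0 ≤ δ := (norm_nonneg _).trans h0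
  have h := norm_le_gronwallBound_of_norm_deriv_right_le (f := f) (f' := f') (a := 0) (b := ℓ)
    (fun s hs => (hf s hs).continuousWithinAt)
    (fun s hs => (hf s (Set.Ico_subset_Icc_self hs)).Ici_of_Icc hs) h0
    (fun s hs => hb s (Set.Ico_subset_Icc_self hs)) s hs
  rw [sub_zero] at h
  have hℓ : 0 ≤ ℓ := hs.1.trans hs.2
  refine h.trans ((gronwallBound_le_mul_exp hK hε).trans ?_)
  have := hs.2
  gcongr

section Algebra

variable {𝔸 : Type*} [NormedRing 𝔸] [NormedAlgebra ℝ 𝔸]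

theorem linearODE_unique {W : ℝ → 𝔸} {f g : ℝ → 𝔸} {ℓ : ℝ}
    (hW : ContinuousOn W (Set.Icc 0 ℓ))
    (hf : ∀ s ∈ Set.Icc 0 ℓ, HasDerivWithinAt f (W s * f s) (Set.Icc 0 ℓ) s)
    (hg : ∀ s ∈ Set.Icc 0 ℓ, HasDerivWithinAt g (W s * g s) (Set.Icc 0 ℓ) s)
    (h0 : f 0 = g 0) : ∀ s ∈ Set.Icc 0 ℓ, f s = g s := by
  obtain ⟨M, hM⟩ := isCompact_Icc.exists_bound_of_continuousOn hW
  intro s hs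
  have hM0 : 0 ≤ M := (norm_nonneg _).trans (hM s hs)
  have := norm_le_of_norm_deriv_le_Icc (f := fun s => f s - g s) (δ := 0) (ε := 0) hM0 le_rfl
    (fun s hs => (hf s hs).sub (hg s hs)) (by simp [h0]) (fun s hs => by
      rw [← mul_sub, add_zero]
      exact (norm_mul_le _ _).trans (mul_le_mul_of_nonneg_right (hM s hs) (norm_nonneg _))) s hs
  simp only [zero_mul, add_zero, norm_le_zero_iff, sub_eq_zero] at this
  exact this

/-- The Picard iterates of `y' = W y + f` written as a Neumann series. -/
noncomputable def neumannTerm (W F : ℝ → 𝔸) : ℕ → ℝ → 𝔸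
  | 0 => F
  | n + 1 => fun s => ∫ r in (0 : ℝ)..s, W r * neumannTerm W F n r

theorem continuous_neumannTerm [CompleteSpace 𝔸] {W F : ℝ → 𝔸} (hW : Continuous W)
    (hF : Continuous F) (n : ℕ) : Continuous (neumannTerm W F n) := by
  induction n with
  | zero => exact hF
  | succ n ih =>
    exact intervalIntegral.continuous_primitive
      (fun a b => (hW.mul ih).intervalIntegrable a b) 0

theorem norm_neumannTerm_le [CompleteSpace 𝔸] {W F : ℝ → 𝔸} (hW : Continuous W)
    (hF : Continuous F) {M C ℓ : ℝ} (hM : ∀ s ∈ Set.Icc 0 ℓ, ‖W s‖ ≤ M)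
    (hC : ∀ s ∈ Set.Icc 0 ℓ, ‖F s‖ ≤ C) (n : ℕ) :
    ∀ s ∈ Set.Icc 0 ℓ, ‖neumannTerm W F n s‖ ≤ C * ((M * s) ^ n / n.factorial) := by
  induction n with
  | zero => simpa [neumannTerm] using hC
  | succ n ih =>
    intro s hs
    have hM0 : 0 ≤ M := (norm_nonneg _).trans (hM s hs)
    have hd : ∀ r : ℝ, HasDerivAt (fun r => C * ((M * r) ^ (n + 1) / (n + 1).factorial))
        (M * (C * ((M * r) ^ n / n.factorial))) r := by
      intro r
      have h1 : HasDerivAt (fun r : ℝ => (M * r) ^ (n + 1))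
          ((n + 1 : ℕ) * (M * r) ^ n * M) r := by
        simpa using ((hasDerivAt_id r).const_mul M).fun_pow (n + 1)
      convert! (h1.div_const ((n + 1).factorial : ℝ)).const_mul C using 1
      rw [Nat.factorial_succ]
      push_cast
      have : (n.factorial : ℝ) ≠ 0 := by positivity
      field_simp
    have hcont := hW.mul (continuous_neumannTerm hW hF n)
    -- The bound of order n + 1 has derivative M times the bound of order n, so a mean value
    -- inequality with variable bound replaces estimating the integral.
    refine image_norm_le_of_norm_deriv_right_le_deriv_boundary
      (f := neumannTerm W F (n + 1)) (a := 0) (b := ℓ)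
      (f' := fun r => W r * neumannTerm W F n r)
      (continuous_neumannTerm hW hF (n + 1)).continuousOn (fun r _ => ?_) ?_ hd (fun r hr => ?_) hs
    · exact (intervalIntegral.integral_hasDerivAt_right (hcont.intervalIntegrable _ _)
        (hcont.stronglyMeasurableAtFilter _ _) hcont.continuousAt).hasDerivWithinAt
    · simp [neumannTerm]
    · have hr' := Set.Ico_subset_Icc_self hr
      exact (norm_mul_le _ _).trans
        (mul_le_mul (hM r hr') (ih r hr') (norm_nonneg _) hM0)

/-- The factorials make the Neumann series converge uniformly on all of [0,ℓ], whatever the size of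
W, so the solution is global. The source term f is needed for the linearized equations satisfied by
derivatives in a parameter. -/
theorem exists_linearODE [CompleteSpace 𝔸] {W f : ℝ → 𝔸} {ℓ : ℝ} (hℓ : 0 ≤ ℓ)
    (hW : ContinuousOn W (Set.Icc 0 ℓ)) (hf : ContinuousOn f (Set.Icc 0 ℓ)) (y₀ : 𝔸) :
    ∃ y : ℝ → 𝔸, y 0 = y₀ ∧
      ∀ s ∈ Set.Icc 0 ℓ, HasDerivWithinAt y (W s * y s + f s) (Set.Icc 0 ℓ) s := by
  -- Constant extension beyond the end points makes W and f continuous on the line; the equation is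
  -- only claimed on [0,ℓ].
  wlog hc : Continuous W ∧ Continuous f generalizing W f
  · have e : ∀ g : ℝ → 𝔸, ∀ s ∈ Set.Icc 0 ℓ,
        Set.IccExtend hℓ (Set.domRestrict (Set.Icc 0 ℓ) g) s = g s := fun g s hs => by
      rw [Set.IccExtend_of_mem _ _ hs]; rfl
    have hW' : Continuous (Set.IccExtend hℓ (Set.domRestrict (Set.Icc 0 ℓ) W)) :=
      (continuousOn_iff_continuous_domRestrict.1 hW).Icc_extend'
    have hf' : Continuous (Set.IccExtend hℓ (Set.domRestrict (Set.Icc 0 ℓ) f)) :=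
      (continuousOn_iff_continuous_domRestrict.1 hf).Icc_extend'
    obtain ⟨y, h0, hy⟩ := this hW'.continuousOn hf'.continuousOn ⟨hW', hf'⟩
    refine ⟨y, h0, fun s hs => ?_⟩
    have := hy s hs
    rwa [e W s hs, e f s hs] at this
  obtain ⟨hW', hf'⟩ := hc
  set F : ℝ → 𝔸 := fun s => y₀ + ∫ r in (0 : ℝ)..s, f r with hFdef
  have hF : Continuous F := continuous_const.add
    (intervalIntegral.continuous_primitive (fun a b => hf'.intervalIntegrable a b) 0)
  obtain ⟨M, hM⟩ := isCompact_Icc.exists_bound_of_continuousOn hW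
  obtain ⟨C, hC⟩ := isCompact_Icc.exists_bound_of_continuousOn (hF.continuousOn (s := Set.Icc 0 ℓ))
  have hM0 : 0 ≤ M := (norm_nonneg _).trans (hM 0 ⟨le_rfl, hℓ⟩)
  have hC0 : 0 ≤ C := (norm_nonneg _).trans (hC 0 ⟨le_rfl, hℓ⟩)
  have hb : ∀ n, ∀ s ∈ Set.Icc 0 ℓ,
      ‖neumannTerm W F n s‖ ≤ C * ((M * ℓ) ^ n / n.factorial) := fun n s hs =>
    (norm_neumannTerm_le hW' hF hM hC n s hs).trans (by
      have := hs.1; have := hs.2; gcongr)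
  have hsum : Summable fun n : ℕ => C * ((M * ℓ) ^ n / n.factorial) :=
    (Real.summable_pow_div_factorial (M * ℓ)).mul_left C
  set y : ℝ → 𝔸 := fun s => ∑' n, neumannTerm W F n s with hy
  have hyc : ContinuousOn y (Set.Icc 0 ℓ) :=
    continuousOn_tsum (fun n => (continuous_neumannTerm hW' hF n).continuousOn) hsum hb
  have hint : ∀ s ∈ Set.Icc 0 ℓ, y s = F s + ∫ r in (0 : ℝ)..s, W r * y r := by
    intro s hs
    have hsub : ∀ r ∈ Set.uIoc 0 s, r ∈ Set.Icc 0 ℓ := fun r hr => by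
      rw [Set.uIoc_of_le hs.1] at hr
      exact ⟨hr.1.le, hr.2.trans hs.2⟩
    have h1 : HasSum (fun n => ∫ r in (0 : ℝ)..s, W r * neumannTerm W F n r)
        (∫ r in (0 : ℝ)..s, W r * y r) := by
      refine intervalIntegral.hasSum_integral_of_dominated_convergence
        (fun n _ => M * (C * ((M * ℓ) ^ n / n.factorial))) (fun n =>
          (hW'.mul (continuous_neumannTerm hW' hF n)).aestronglyMeasurable) (fun n => ?_) ?_ ?_ ?_
      · filter_upwards with r hr
        exact (norm_mul_le _ _).trans
          (mul_le_mul (hM r (hsub r hr)) (hb n r (hsub r hr)) (norm_nonneg _) hM0)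
      · filter_upwards with r _ using hsum.mul_left M
      · exact intervalIntegrable_const
      · filter_upwards with r hr
        have : Summable fun n => neumannTerm W F n r :=
          Summable.of_norm_bounded hsum (fun n => hb n r (hsub r hr))
        exact this.hasSum.mul_left (W r)
    have h2 : Summable fun n => neumannTerm W F n s :=
      Summable.of_norm_bounded hsum (fun n => hb n s hs)
    rw [hy]
    simp only
    rw [h2.tsum_eq_zero_add, ← h1.tsum_eq]
    rfl
  refine ⟨y, ?_, fun s hs => ?_⟩
  · rw [hint 0 ⟨le_rfl, hℓ⟩]; simp [hFdef]
  · have h1 : HasDerivWithinAt F (f s) (Set.Icc 0 ℓ) s :=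
      ((intervalIntegral.integral_hasDerivAt_right (hf'.intervalIntegrable _ _)
        (hf'.stronglyMeasurableAtFilter _ _) hf'.continuousAt).const_add y₀).hasDerivWithinAt
    have hcont : ContinuousOn (fun r => W r * y r) (Set.Icc 0 ℓ) := hW.mul hyc
    have h2 : HasDerivWithinAt (fun u => ∫ r in (0 : ℝ)..u, W r * y r) (W s * y s)
        (Set.Icc 0 ℓ) s := by
      have : Fact (s ∈ Set.Icc 0 ℓ) := ⟨hs⟩
      refine intervalIntegral.integral_hasDerivWithinAt_right ?_ ?_ (hcont s hs)
      · refine (hcont.mono ?_).intervalIntegrable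
        rw [Set.uIcc_of_le hs.1]; exact Set.Icc_subset_Icc_right hs.2
      · exact hcont.stronglyMeasurableAtFilter_nhdsWithin measurableSet_Icc s
    have := (h1.add h2).congr hint (hint s hs)
    rwa [add_comm] at this

/-- First order dependence of solutions of linear equations on the coefficients. -/
theorem linearODE_variation {M B ℓ : ℝ} (hM : 0 ≤ M) (hB : 0 ≤ B) (hℓ : 0 ≤ ℓ) :
    ∃ C : ℝ, 0 ≤ C ∧ ∀ (W W₀ w y y₀ h : ℝ → 𝔸) (ε r : ℝ), 0 ≤ ε → ε ≤ 1 →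
      (∀ s ∈ Set.Icc 0 ℓ, HasDerivWithinAt y (W s * y s) (Set.Icc 0 ℓ) s) →
      (∀ s ∈ Set.Icc 0 ℓ, HasDerivWithinAt y₀ (W₀ s * y₀ s) (Set.Icc 0 ℓ) s) →
      (∀ s ∈ Set.Icc 0 ℓ, HasDerivWithinAt h (W₀ s * h s + w s * y₀ s) (Set.Icc 0 ℓ) s) →
      (∀ s ∈ Set.Icc 0 ℓ, ‖W₀ s‖ ≤ M ∧ ‖y₀ s‖ ≤ B ∧ ‖W s - W₀ s‖ ≤ M * ε ∧
        ‖W s - W₀ s - w s‖ ≤ M * ε ^ 2) →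
      ‖y 0 - y₀ 0‖ ≤ B * ε → ‖y 0 - y₀ 0 - h 0‖ ≤ r →
      ∀ s ∈ Set.Icc 0 ℓ, ‖y s - y₀ s - h s‖ ≤ C * (r + ε ^ 2) := by
  -- The constant is fixed before the equations are, so the estimate is uniform while the parameter
  -- p tends to p₀ in the application.
  set C₁ := (B + M * B * ℓ) * Real.exp ((M + M) * ℓ) with hC₁
  have hC₁0 : 0 ≤ C₁ := by positivity
  refine ⟨(1 + (M * C₁ + M * B) * ℓ) * Real.exp (M * ℓ), by positivity, ?_⟩
  intro W W₀ w y y₀ h ε r hε hε1 hy hy₀ hh hb h0 hr s hs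
  have h1 : ∀ s ∈ Set.Icc 0 ℓ, ‖y s - y₀ s‖ ≤ C₁ * ε := by
    intro s hs
    have := norm_le_of_norm_deriv_le_Icc (f := fun s => y s - y₀ s) (ε := M * ε * B)
      (K := M + M) (by positivity) (by positivity)
      (fun s hs => (hy s hs).sub (hy₀ s hs)) h0 (fun s hs => by
        obtain ⟨b1, b2, b3, -⟩ := hb s hs
        have e : W s * y s - W₀ s * y₀ s = (W₀ s + (W s - W₀ s)) * (y s - y₀ s)
          + (W s - W₀ s) * y₀ s := by noncomm_ring
        rw [e]
        refine (norm_add_le _ _).trans (add_le_add ((norm_mul_le _ _).trans ?_)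
          ((norm_mul_le _ _).trans (by gcongr)))
        refine mul_le_mul_of_nonneg_right ?_ (norm_nonneg _)
        exact (norm_add_le _ _).trans (add_le_add b1 (b3.trans (mul_le_of_le_one_right hM hε1)))) s hs
    refine this.trans (le_of_eq ?_)
    rw [hC₁]; ring
  -- The remainder solves the equation of W₀ with source (W - W₀)(y - y₀) + (W - W₀ - w) y₀, which
  -- is quadratic in ε by the first Gronwall estimate `h1`.
  have h2 := norm_le_of_norm_deriv_le_Icc (f := fun s => y s - y₀ s - h s)
    (ε := (M * C₁ + M * B) * ε ^ 2) hM (by positivity)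
      (fun s hs => ((hy s hs).sub (hy₀ s hs)).sub (hh s hs)) hr (fun s hs => by
        obtain ⟨b1, b2, b3, b4⟩ := hb s hs
        have e : W s * y s - W₀ s * y₀ s - (W₀ s * h s + w s * y₀ s)
          = W₀ s * (y s - y₀ s - h s) + ((W s - W₀ s) * (y s - y₀ s)
            + (W s - W₀ s - w s) * y₀ s) := by noncomm_ring
        rw [e]
        refine (norm_add_le _ _).trans (add_le_add ((norm_mul_le _ _).trans (by gcongr)) ?_)
        refine (norm_add_le _ _).trans ?_
        have e1 : ‖(W s - W₀ s) * (y s - y₀ s)‖ ≤ (M * ε) * (C₁ * ε) :=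
          (norm_mul_le _ _).trans (mul_le_mul b3 (h1 s hs) (norm_nonneg _) (by positivity))
        have e2 : ‖(W s - W₀ s - w s) * y₀ s‖ ≤ (M * ε ^ 2) * B :=
          (norm_mul_le _ _).trans (mul_le_mul b4 b2 (norm_nonneg _) (by positivity))
        linarith) s hs
  have hr0 : 0 ≤ r := (norm_nonneg _).trans hr
  refine h2.trans ?_
  have : (r + (M * C₁ + M * B) * ε ^ 2 * ℓ) ≤ (1 + (M * C₁ + M * B) * ℓ) * (r + ε ^ 2) := by
    have : 0 ≤ (M * C₁ + M * B) * ℓ * r := by positivity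
    nlinarith [sq_nonneg ε]
  calc _ ≤ (1 + (M * C₁ + M * B) * ℓ) * (r + ε ^ 2) * Real.exp (M * ℓ) := by gcongr
    _ = _ := by ring

end Algebra

/-! ### Derivatives of a smooth function on a strip -/

section Strip

/-- The strip `ℝ × [0,T]`. -/
def strip (T : ℝ) : Set (ℝ × ℝ) := Set.univ ×ˢ Set.Icc 0 T

/-- The directional derivative within the strip. -/
noncomputable def stripDeriv (T : ℝ) (v : ℝ × ℝ) (f : ℝ × ℝ → ℂ) (p : ℝ × ℝ) : ℂ :=
  fderivWithin ℝ f (strip T) p v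

theorem uniqueDiffOn_strip {T : ℝ} (hT : 0 < T) : UniqueDiffOn ℝ (strip T) :=
  uniqueDiffOn_univ.prod (uniqueDiffOn_Icc hT)

variable {T : ℝ} {f : ℝ × ℝ → ℂ}

theorem contDiffOn_stripDeriv (hT : 0 < T) (hf : ContDiffOn ℝ ∞ f (strip T)) (v : ℝ × ℝ) :
    ContDiffOn ℝ ∞ (stripDeriv T v f) (strip T) :=
  (hf.fderivWithin (m := ∞) (uniqueDiffOn_strip hT) (by simp)).clm_apply contDiffOn_const

theorem hasDerivAt_strip_fst (hf : ContDiffOn ℝ ∞ f (strip T)) (x : ℝ) {t : ℝ}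
    (ht : t ∈ Set.Icc 0 T) :
    HasDerivAt (fun y => f (y, t)) (stripDeriv T (1, 0) f (x, t)) x := by
  have h1 : HasFDerivWithinAt f (fderivWithin ℝ f (strip T) (x, t)) (strip T) (x, t) :=
    ((hf.differentiableOn (by simp)) (x, t) ⟨trivial, ht⟩).hasFDerivWithinAt
  have h2 : HasDerivWithinAt (fun y : ℝ => (y, t)) ((1 : ℝ), (0 : ℝ)) Set.univ x :=
    ((hasDerivAt_id x).prodMk (hasDerivAt_const x t)).hasDerivWithinAt
  have : HasDerivWithinAt (fun y => f (y, t)) (stripDeriv T (1, 0) f (x, t)) Set.univ x :=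
    h1.comp_hasDerivWithinAt x h2 (fun y _ => Set.mk_mem_prod trivial ht)
  rwa [hasDerivWithinAt_univ] at this

theorem hasDerivWithinAt_strip_snd (hf : ContDiffOn ℝ ∞ f (strip T)) (x : ℝ) {t : ℝ}
    (ht : t ∈ Set.Icc 0 T) :
    HasDerivWithinAt (fun s => f (x, s)) (stripDeriv T (0, 1) f (x, t)) (Set.Icc 0 T) t := by
  have h1 : HasFDerivWithinAt f (fderivWithin ℝ f (strip T) (x, t)) (strip T) (x, t) :=
    ((hf.differentiableOn (by simp)) (x, t) ⟨trivial, ht⟩).hasFDerivWithinAt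
  have h2 : HasDerivWithinAt (fun s : ℝ => (x, s)) ((0 : ℝ), (1 : ℝ)) (Set.Icc 0 T) t :=
    ((hasDerivAt_const t x).prodMk (hasDerivAt_id t)).hasDerivWithinAt
  exact h1.comp_hasDerivWithinAt t h2 (fun s hs => Set.mk_mem_prod trivial hs)

theorem exists_bound_strip (hf : ContDiffOn ℝ ∞ f (strip T)) (L : ℝ) :
    ∃ M : ℝ, ∀ x ∈ Set.Icc 0 L, ∀ t ∈ Set.Icc 0 T, ‖f (x, t)‖ ≤ M := by
  have hsub : Set.Icc 0 L ×ˢ Set.Icc 0 T ⊆ strip T :=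
    Set.prod_mono (Set.subset_univ _) subset_rfl
  obtain ⟨M, hM⟩ := (isCompact_Icc.prod isCompact_Icc).exists_bound_of_continuousOn
    (hf.continuousOn.mono hsub)
  exact ⟨M, fun x hx t ht => hM (x, t) ⟨hx, ht⟩⟩

end Strip

/-- The derivatives of a solution `q` of the NLS equation which enter the Lax pair and its gauge
transformation, with uniform bounds on `[0,L] × [0,T]`. -/
structure IsJet (lam L T M : ℝ) (q qx qxx qt qxt : ℝ → ℝ → ℂ) : Prop where
  hasDerivAt_x : ∀ x, ∀ t ∈ Set.Icc 0 T, HasDerivAt (fun y => q y t) (qx x t) x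
  hasDerivAt_xx : ∀ x, ∀ t ∈ Set.Icc 0 T, HasDerivAt (fun y => qx y t) (qxx x t) x
  hasDerivWithinAt_t : ∀ x, ∀ t ∈ Set.Icc 0 T,
    HasDerivWithinAt (fun s => q x s) (qt x t) (Set.Icc 0 T) t
  hasDerivWithinAt_xt : ∀ x, ∀ t ∈ Set.Icc 0 T,
    HasDerivWithinAt (fun s => qx x s) (qxt x t) (Set.Icc 0 T) t
  bound : ∀ x ∈ Set.Icc 0 L, ∀ t ∈ Set.Icc 0 T,
    ‖q x t‖ ≤ M ∧ ‖qx x t‖ ≤ M ∧ ‖qxx x t‖ ≤ M ∧ ‖qt x t‖ ≤ M ∧ ‖qxt x t‖ ≤ M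
  taylor : ∀ x ∈ Set.Icc 0 L, ∀ t ∈ Set.Icc 0 T, ∀ s ∈ Set.Icc 0 T,
    ‖q x s - q x t - ((s - t : ℝ) : ℂ) * qt x t‖ ≤ M * |s - t| ^ 2
  nls : ∀ x, ∀ t ∈ Set.Icc 0 T,
    Complex.I * qt x t + qxx x t - 2 * lam * q x t * (q x t * conj (q x t)) = 0
  periodic : ∀ t ∈ Set.Icc 0 T, q L t = q 0 t ∧ qx L t = qx 0 t

/-- From here on only these five functions, their bounds on the compact rectangle and the Taylor
estimate in t are used. The Taylor estimate comes from the bound on q_tt by two applications of the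
mean value inequality. -/
theorem exists_isJet {lam L T : ℝ} (hT : 0 < T) {q : ℝ → ℝ → ℂ}
    (hq : IsPeriodicSolution lam L T q) :
    ∃ (M : ℝ) (qx qxx qt qxt : ℝ → ℝ → ℂ), 0 ≤ M ∧ IsJet lam L T M q qx qxx qt qxt := by
  set f : ℝ × ℝ → ℂ := fun p => q p.1 p.2 with hf
  have h : ContDiffOn ℝ ∞ f (strip T) := hq.smooth
  have hX := contDiffOn_stripDeriv hT h (1, 0)
  have hXX := contDiffOn_stripDeriv hT hX (1, 0)
  have hD := contDiffOn_stripDeriv hT h (0, 1)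
  have hXD := contDiffOn_stripDeriv hT hX (0, 1)
  have hDD := contDiffOn_stripDeriv hT hD (0, 1)
  obtain ⟨M₀, b₀⟩ := exists_bound_strip h L
  obtain ⟨M₁, b₁⟩ := exists_bound_strip hX L
  obtain ⟨M₂, b₂⟩ := exists_bound_strip hXX L
  obtain ⟨M₃, b₃⟩ := exists_bound_strip hD L
  obtain ⟨M₄, b₄⟩ := exists_bound_strip hXD L
  obtain ⟨M₅, b₅⟩ := exists_bound_strip hDD L
  have hx := fun x t ht => hasDerivAt_strip_fst (T := T) h x (t := t) ht
  have hxx := fun x t ht => hasDerivAt_strip_fst (T := T) hX x (t := t) ht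
  have ht' := fun x t ht => hasDerivWithinAt_strip_snd (T := T) h x (t := t) ht
  have htt := fun x t ht => hasDerivWithinAt_strip_snd (T := T) hD x (t := t) ht
  set M := |M₀| + |M₁| + |M₂| + |M₃| + |M₄| + |M₅| with hM
  have p₀ := abs_nonneg M₀
  have p₁ := abs_nonneg M₁
  have p₂ := abs_nonneg M₂
  have p₃ := abs_nonneg M₃
  have p₄ := abs_nonneg M₄
  have p₅ := abs_nonneg M₅
  refine ⟨M, fun x t => stripDeriv T (1, 0) f (x, t),
    fun x t => stripDeriv T (1, 0) (stripDeriv T (1, 0) f) (x, t),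
    fun x t => stripDeriv T (0, 1) f (x, t),
    fun x t => stripDeriv T (0, 1) (stripDeriv T (1, 0) f) (x, t), by positivity,
    hx, hxx, ht',
    fun x t ht => hasDerivWithinAt_strip_snd hX x ht, ?_, ?_, ?_, ?_⟩
  · intro x hx t ht
    have := b₀ x hx t ht
    have := b₁ x hx t ht
    have := b₂ x hx t ht
    have := b₃ x hx t ht
    have := b₄ x hx t ht
    have := le_abs_self M₀
    have := le_abs_self M₁
    have := le_abs_self M₂
    have := le_abs_self M₃
    have := le_abs_self M₄
    refine ⟨?_, ?_, ?_, ?_, ?_⟩ <;> linarith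
  · intro x hx t ht s hs
    have hsub : Set.uIcc t s ⊆ Set.Icc 0 T := Set.uIcc_subset_Icc ht hs
    have hconv : Convex ℝ (Set.uIcc t s) := convex_uIcc t s
    have hlip : ∀ r ∈ Set.uIcc t s,
        ‖stripDeriv T (0, 1) f (x, r) - stripDeriv T (0, 1) f (x, t)‖ ≤ M * |s - t| := by
      intro r hr
      have h1 := hconv.norm_image_sub_le_of_norm_hasDerivWithin_le
        (fun r hr => (htt x r (hsub hr)).mono hsub)
        (fun r hr => b₅ x hx r (hsub hr)) Set.left_mem_uIcc hr
      refine h1.trans ?_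
      have h2 : ‖r - t‖ ≤ |s - t| := by
        have := Set.abs_sub_left_of_mem_uIcc hr
        simpa using this
      refine mul_le_mul ?_ h2 (norm_nonneg _) (by positivity)
      have := le_abs_self M₅
      linarith
    have hd : ∀ r ∈ Set.uIcc t s, HasDerivWithinAt
        (fun r => q x r - ((r - t : ℝ) : ℂ) * stripDeriv T (0, 1) f (x, t))
        (stripDeriv T (0, 1) f (x, r) - stripDeriv T (0, 1) f (x, t)) (Set.uIcc t s) r := by
      intro r hr
      have h1 : HasDerivAt (fun r : ℝ => ((r - t : ℝ) : ℂ)) 1 r := by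
        simpa using ((hasDerivAt_id r).sub_const t).ofReal_comp
      have := ((ht' x r (hsub hr)).mono hsub).fun_sub
        (h1.mul_const (stripDeriv T (0, 1) f (x, t))).hasDerivWithinAt
      simpa using this
    have := hconv.norm_image_sub_le_of_norm_hasDerivWithin_le hd hlip
      Set.left_mem_uIcc Set.right_mem_uIcc
    simp only [sub_self, Complex.ofReal_zero, zero_mul, sub_zero] at this
    calc _ = ‖q x s - ((s - t : ℝ) : ℂ) * stripDeriv T (0, 1) f (x, t) - q x t‖ := by
            congr 1; ring
      _ ≤ _ := this
      _ = _ := by rw [Real.norm_eq_abs]; ring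
  · intro x t ht
    have h1 := hq.nls x t ht
    have h2 : derivWithin (fun s => q x s) (Set.Icc 0 T) t = stripDeriv T (0, 1) f (x, t) :=
      (ht' x t ht).derivWithin (uniqueDiffOn_Icc hT t ht)
    have h3 : iteratedDeriv 2 (fun y => q y t) x
        = stripDeriv T (1, 0) (stripDeriv T (1, 0) f) (x, t) := by
      rw [iteratedDeriv_succ, iteratedDeriv_one]
      have : deriv (fun y => q y t) = fun y => stripDeriv T (1, 0) f (y, t) :=
        funext fun y => (hx y t ht).deriv
      rw [this]
      exact (hxx x t ht).deriv
    rw [h2, h3] at h1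
    rw [Complex.mul_conj, Complex.normSq_eq_norm_sq]
    push_cast
    exact h1
  · intro t ht
    have h0 := hq.periodic 0 t ht
    rw [zero_add] at h0
    refine ⟨h0, ?_⟩
    have h1 : HasDerivAt (fun y => q (y + L) t) (stripDeriv T (1, 0) f (0 + L, t)) 0 :=
      (hx (0 + L) t ht).comp_add_const 0 L
    have h2 : (fun y => q (y + L) t) = fun y => q y t := funext fun y => hq.periodic y t ht
    rw [h2, zero_add] at h1
    exact h1.unique (hx 0 t ht)

/-! ### Differentiability of linear equations in a parameter -/

section

attribute [local instance] Matrix.linftyOpNormedRing Matrix.linftyOpNormedAlgebra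

section Parameter

variable {𝔸 : Type*} [NormedRing 𝔸] [NormedAlgebra ℝ 𝔸]

/-- Solutions of linear equations are differentiable with respect to a parameter. -/
theorem linearODE_hasDerivWithinAt_param {𝕜 : Type*} [NontriviallyNormedField 𝕜]
    [NormedAlgebra 𝕜 𝔸] [SMulCommClass ℝ 𝕜 𝔸] {S : Set 𝕜} {p₀ : 𝕜} (hp₀ : p₀ ∈ S) {ℓ M : ℝ}
    (hℓ : 0 ≤ ℓ) {W : 𝕜 → ℝ → 𝔸} {W' z : ℝ → 𝔸} {Y : 𝕜 → ℝ → 𝔸}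
    (hY : ∀ p ∈ S, ∀ s ∈ Set.Icc 0 ℓ, HasDerivWithinAt (Y p) (W p s * Y p s) (Set.Icc 0 ℓ) s)
    (hz : ∀ s ∈ Set.Icc 0 ℓ,
      HasDerivWithinAt z (W p₀ s * z s + W' s * Y p₀ s) (Set.Icc 0 ℓ) s)
    (hW : ∀ p ∈ S, ‖p - p₀‖ ≤ 1 → ∀ s ∈ Set.Icc 0 ℓ, ‖W p₀ s‖ ≤ M ∧
      ‖W p s - W p₀ s‖ ≤ M * ‖p - p₀‖ ∧ ‖W p s - W p₀ s - (p - p₀) • W' s‖ ≤ M * ‖p - p₀‖ ^ 2)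
    (h0 : HasDerivWithinAt (fun p => Y p 0) (z 0) S p₀) :
    ∀ s ∈ Set.Icc 0 ℓ, HasDerivWithinAt (fun p => Y p s) (z s) S p₀ := by
  intro s hs
  have hM : 0 ≤ M := (norm_nonneg _).trans (hW p₀ hp₀ (by simp) s hs).1
  obtain ⟨B₁, hB₁⟩ := isCompact_Icc.exists_bound_of_continuousOn
    (f := Y p₀) (s := Set.Icc 0 ℓ) (fun s hs => (hY p₀ hp₀ s hs).continuousWithinAt)
  have hB₁0 : 0 ≤ B₁ := (norm_nonneg _).trans (hB₁ s hs)
  obtain ⟨B₂, hB₂0, hB₂⟩ := h0.hasFDerivWithinAt.isBigO_sub.exists_pos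
  obtain ⟨C, hC0, hC⟩ := linearODE_variation (𝔸 := 𝔸) (B := B₁ + B₂) hM (by positivity) hℓ
  rw [hasDerivWithinAt_iff_isLittleO] at h0 ⊢
  have hlin : (fun p => p - p₀) =O[𝓝[S] p₀] fun p => p - p₀ := isBigO_refl _ _
  have hball : ∀ᶠ p in 𝓝[S] p₀, ‖p - p₀‖ ≤ 1 := by
    have : ∀ᶠ p in 𝓝 p₀, p ∈ Metric.closedBall p₀ 1 := Metric.closedBall_mem_nhds p₀ one_pos
    filter_upwards [mem_nhdsWithin_of_mem_nhds this] with p hp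
    simpa [dist_eq_norm] using hp
  have hsq : (fun p => ‖p - p₀‖ ^ 2) =o[𝓝[S] p₀] fun p => p - p₀ := by
    have h1 : (fun p => p - p₀) =o[𝓝[S] p₀] fun _ => (1 : ℝ) := by
      rw [isLittleO_one_iff]
      have : Tendsto (fun p => p - p₀) (𝓝 p₀) (𝓝 (p₀ - p₀)) :=
        (continuous_id.sub continuous_const).tendsto p₀
      rw [sub_self] at this
      exact this.mono_left nhdsWithin_le_nhds
    have h2 := h1.norm_left.mul_isBigO hlin.norm_norm
    simp only [one_mul] at h2
    exact (h2.congr_left fun p => (pow_two _).symm).of_norm_right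
  -- The variation estimate with ε = |p - p₀| and first order term (p - p₀) z. The initial remainder
  -- is o(p - p₀) by `h0`, and ε² is too. The field 𝕜 is ℂ for holomorphy in k and ℝ for the
  -- t-equation of the Lax pair.
  have hfinal : (fun p => Y p s - Y p₀ s - (p - p₀) • z s) =O[𝓝[S] p₀]
      fun p => ‖Y p 0 - Y p₀ 0 - (p - p₀) • z 0‖ + ‖p - p₀‖ ^ 2 := by
    refine IsBigO.of_bound C ?_
    filter_upwards [hball, hB₂.bound, self_mem_nhdsWithin] with p hp1 hp2 hpS
    rw [Real.norm_of_nonneg (by positivity)]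
    refine hC (W p) (W p₀) (fun s => (p - p₀) • W' s) (Y p) (Y p₀) (fun s => (p - p₀) • z s)
      ‖p - p₀‖ _ (norm_nonneg _) hp1 (hY p hpS) (hY p₀ hp₀) (fun s hs => ?_) (fun s hs => ?_)
      (hp2.trans (by gcongr; linarith)) le_rfl s hs
    · have := (hz s hs).const_smul (p - p₀)
      rwa [smul_add, ← mul_smul_comm, ← smul_mul_assoc] at this
    · obtain ⟨h1, h2, h3⟩ := hW p hpS hp1 s hs
      exact ⟨h1, (hB₁ s hs).trans (by linarith), h2, h3⟩
  exact hfinal.trans_isLittleO (h0.norm_left.add hsq)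

end Parameter

/-- Solutions of linear equations whose coefficients are polynomials in `k` are entire in `k`. -/
theorem linearODE_entire {𝔸 : Type*} [NormedRing 𝔸] [NormedAlgebra ℂ 𝔸] [CompleteSpace 𝔸]
    {ℓ : ℝ} (hℓ : 0 ≤ ℓ) {W₀ W₁ W₂ : ℝ → 𝔸} (h₀ : ContinuousOn W₀ (Set.Icc 0 ℓ))
    (h₁ : ContinuousOn W₁ (Set.Icc 0 ℓ)) (h₂ : ContinuousOn W₂ (Set.Icc 0 ℓ)) {Y : ℂ → ℝ → 𝔸}
    (hY : ∀ k, ∀ s ∈ Set.Icc 0 ℓ,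
      HasDerivWithinAt (Y k) ((W₀ s + k • W₁ s + k ^ 2 • W₂ s) * Y k s) (Set.Icc 0 ℓ) s)
    (hinit : Differentiable ℂ fun k => Y k 0) :
    ∀ s ∈ Set.Icc 0 ℓ, Differentiable ℂ fun k => Y k s := by
  intro s hs k₀
  have hYc : ContinuousOn (Y k₀) (Set.Icc 0 ℓ) := fun s hs => (hY k₀ s hs).continuousWithinAt
  have hWc : ContinuousOn (fun s => W₀ s + k₀ • W₁ s + k₀ ^ 2 • W₂ s) (Set.Icc 0 ℓ) :=
    (h₀.add (h₁.const_smul k₀)).add (h₂.const_smul _)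
  have hW'c : ContinuousOn (fun s => W₁ s + (2 * k₀) • W₂ s) (Set.Icc 0 ℓ) :=
    h₁.add (h₂.const_smul _)
  -- The candidate for ∂_k Y solves the linearized equation, with source (∂_k W) Y.
  obtain ⟨z, hz0, hz⟩ := exists_linearODE hℓ hWc (hW'c.mul hYc) (deriv (fun k => Y k 0) k₀)
  obtain ⟨M₀, b₀⟩ := isCompact_Icc.exists_bound_of_continuousOn hWc
  obtain ⟨M₁, b₁⟩ := isCompact_Icc.exists_bound_of_continuousOn hW'c
  obtain ⟨M₂, b₂⟩ := isCompact_Icc.exists_bound_of_continuousOn h₂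
  have p₀ : 0 ≤ M₀ := (norm_nonneg _).trans (b₀ s hs)
  have p₁ : 0 ≤ M₁ := (norm_nonneg _).trans (b₁ s hs)
  have p₂ : 0 ≤ M₂ := (norm_nonneg _).trans (b₂ s hs)
  have h := linearODE_hasDerivWithinAt_param (S := Set.univ) (p₀ := k₀) (Set.mem_univ _) hℓ
    (M := M₀ + M₁ + M₂) (W := fun k s => W₀ s + k • W₁ s + k ^ 2 • W₂ s)
    (W' := fun s => W₁ s + (2 * k₀) • W₂ s) (z := z) (Y := Y) (fun k _ => hY k) hz ?_ ?_ s hs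
  · rw [hasDerivWithinAt_univ] at h
    exact h.differentiableAt
  · intro k _ hk s hs
    have q₀ := b₀ s hs
    have q₁ := b₁ s hs
    have q₂ := b₂ s hs
    have e1 : (W₀ s + k • W₁ s + k ^ 2 • W₂ s) - (W₀ s + k₀ • W₁ s + k₀ ^ 2 • W₂ s)
        - (k - k₀) • (W₁ s + (2 * k₀) • W₂ s) = (k - k₀) ^ 2 • W₂ s := by
      module
    have n1 : ‖(k - k₀) ^ 2 • W₂ s‖ ≤ M₂ * ‖k - k₀‖ ^ 2 := by
      rw [norm_smul, norm_pow, mul_comm]; gcongr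
    have n2 : ‖(k - k₀) • (W₁ s + (2 * k₀) • W₂ s)‖ ≤ M₁ * ‖k - k₀‖ := by
      rw [norm_smul, mul_comm]; gcongr
    refine ⟨by linarith, ?_, ?_⟩
    · have e2 : (W₀ s + k • W₁ s + k ^ 2 • W₂ s) - (W₀ s + k₀ • W₁ s + k₀ ^ 2 • W₂ s)
        = (k - k₀) • (W₁ s + (2 * k₀) • W₂ s) + (k - k₀) ^ 2 • W₂ s := by
        rw [← e1]; abel
      rw [e2]
      refine (norm_add_le _ _).trans ?_
      have : ‖k - k₀‖ ^ 2 ≤ ‖k - k₀‖ := by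
        rw [pow_two]; exact mul_le_of_le_one_left (norm_nonneg _) hk
      nlinarith [norm_nonneg (k - k₀)]
    · rw [e1]
      nlinarith [sq_nonneg ‖k - k₀‖]
  · rw [hz0, hasDerivWithinAt_univ]
    exact (hinit k₀).hasDerivAt

theorem continuousOn_mat {f : ℝ → Mat} {S : Set ℝ}
    (h : ∀ i j, ContinuousOn (fun s => f s i j) S) : ContinuousOn f S :=
  continuousOn_pi.2 fun i => continuousOn_pi.2 fun j => h i j

theorem hasDerivWithinAt_mat {f : ℝ → Mat} {f' : Mat} {S : Set ℝ} {s : ℝ} :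
    HasDerivWithinAt f f' S s ↔
      ∀ i j, HasDerivWithinAt (fun s => f s i j) (f' i j) S s :=
  hasDerivWithinAt_pi.trans (forall_congr' fun _ => hasDerivWithinAt_pi)

theorem differentiable_mat {f : ℂ → Mat} :
    Differentiable ℂ f ↔ ∀ i j, Differentiable ℂ (fun s => f s i j) :=
  differentiable_pi.trans (forall_congr' fun _ => differentiable_pi)

end

section

attribute [local instance] Matrix.linftyOpNormedRing Matrix.linftyOpNormedAlgebra

/-! ### The fundamental solution of the Lax pair -/

/-- Coefficient matrix of the `x`-part `ψ_x = U ψ` of the Lax pair, for the value `q`. -/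
noncomputable def laxU (lam : ℝ) (q k : ℂ) : Mat :=
  !![-(Complex.I * k), q; lam * conj q, Complex.I * k]

/-- Coefficient matrix of the `t`-part `ψ_t = V ψ` of the Lax pair, for the values `q` and `q_x`. -/
noncomputable def laxV (lam : ℝ) (q qx k : ℂ) : Mat :=
  !![-(2 * Complex.I * k ^ 2) - Complex.I * lam * (q * conj q), 2 * k * q + Complex.I * qx;
    lam * (2 * k * conj q - Complex.I * conj qx),
    2 * Complex.I * k ^ 2 + Complex.I * lam * (q * conj q)]

theorem laxU_eq (lam : ℝ) (q k : ℂ) :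
    laxU lam q k = laxU lam q 0 + k • !![-Complex.I, 0; 0, Complex.I] + k ^ 2 • (0 : Mat) := by
  ext i j
  fin_cases i <;> fin_cases j <;> simp [laxU] <;> ring

theorem laxV_eq (lam : ℝ) (q qx k : ℂ) :
    laxV lam q qx k = laxV lam q qx 0 + k • !![0, 2 * q; 2 * lam * conj q, 0]
      + k ^ 2 • !![-(2 * Complex.I), 0; 0, 2 * Complex.I] := by
  ext i j
  fin_cases i <;> fin_cases j <;> simp [laxV] <;> ring

theorem continuousOn_conj {f : ℝ → ℂ} {S : Set ℝ} (h : ContinuousOn f S) :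
    ContinuousOn (fun s => conj (f s)) S :=
  Complex.continuous_conj.comp_continuousOn h

theorem HasDerivWithinAt.conj {f : ℝ → ℂ} {f' : ℂ} {S : Set ℝ} {s : ℝ}
    (h : HasDerivWithinAt f f' S s) :
    HasDerivWithinAt (fun s => conj (f s)) (conj f') S s := h.star

section

variable {S : Set ℝ} {q qx : ℝ → ℂ}

theorem continuousOn_laxU (lam : ℝ) (k : ℂ) (hq : ContinuousOn q S) :
    ContinuousOn (fun s => laxU lam (q s) k) S := by
  have := continuousOn_conj hq
  refine continuousOn_mat fun i j => ?_
  fin_cases i <;> fin_cases j <;> simp [laxU] <;> fun_prop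

theorem continuousOn_laxV (lam : ℝ) (k : ℂ) (hq : ContinuousOn q S) (hqx : ContinuousOn qx S) :
    ContinuousOn (fun s => laxV lam (q s) (qx s) k) S := by
  have := continuousOn_conj hq
  have := continuousOn_conj hqx
  refine continuousOn_mat fun i j => ?_
  fin_cases i <;> fin_cases j <;> simp [laxV] <;> fun_prop

end

theorem exists_laxX_solution {lam ℓ : ℝ} (hℓ : 0 ≤ ℓ) {q : ℝ → ℂ}
    (hq : ContinuousOn q (Set.Icc 0 ℓ)) {Y₀ : ℂ → Mat} (hY₀ : Differentiable ℂ Y₀) :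
    ∃ Y : ℂ → ℝ → Mat, (∀ k, Y k 0 = Y₀ k) ∧
      (∀ k, ∀ s ∈ Set.Icc 0 ℓ,
        HasDerivWithinAt (Y k) (laxU lam (q s) k * Y k s) (Set.Icc 0 ℓ) s) ∧
      ∀ s ∈ Set.Icc 0 ℓ, Differentiable ℂ fun k => Y k s := by
  have h : ∀ k, ∃ y : ℝ → Mat, y 0 = Y₀ k ∧ ∀ s ∈ Set.Icc 0 ℓ,
      HasDerivWithinAt y (laxU lam (q s) k * y s + 0) (Set.Icc 0 ℓ) s := fun k =>
    exists_linearODE hℓ (continuousOn_laxU lam k hq) continuousOn_const _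
  choose Y h0 hY using h
  simp only [add_zero] at hY
  refine ⟨Y, h0, hY, ?_⟩
  refine linearODE_entire hℓ (W₀ := fun s => laxU lam (q s) 0) (continuousOn_laxU lam 0 hq)
    (continuousOn_const (c := !![-Complex.I, 0; 0, Complex.I]))
    (continuousOn_const (c := 0)) (fun k s hs => ?_) (by rw [funext h0]; exact hY₀)
  have := hY k s hs
  rwa [laxU_eq] at this

theorem exists_laxT_solution {lam ℓ : ℝ} (hℓ : 0 ≤ ℓ) {q qx : ℝ → ℂ}
    (hq : ContinuousOn q (Set.Icc 0 ℓ)) (hqx : ContinuousOn qx (Set.Icc 0 ℓ)) :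
    ∃ Y : ℂ → ℝ → Mat, (∀ k, Y k 0 = 1) ∧
      (∀ k, ∀ s ∈ Set.Icc 0 ℓ,
        HasDerivWithinAt (Y k) (laxV lam (q s) (qx s) k * Y k s) (Set.Icc 0 ℓ) s) ∧
      ∀ s ∈ Set.Icc 0 ℓ, Differentiable ℂ fun k => Y k s := by
  have h : ∀ k, ∃ y : ℝ → Mat, y 0 = 1 ∧ ∀ s ∈ Set.Icc 0 ℓ,
      HasDerivWithinAt y (laxV lam (q s) (qx s) k * y s + 0) (Set.Icc 0 ℓ) s := fun k =>
    exists_linearODE hℓ (continuousOn_laxV lam k hq hqx) continuousOn_const _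
  choose Y h0 hY using h
  simp only [add_zero] at hY
  refine ⟨Y, h0, hY, ?_⟩
  have hqc := continuousOn_conj hq
  refine linearODE_entire hℓ (W₀ := fun s => laxV lam (q s) (qx s) 0)
    (W₁ := fun s => !![0, 2 * q s; 2 * lam * conj (q s), 0])
    (continuousOn_laxV lam 0 hq hqx) (continuousOn_mat fun i j => ?_)
    (continuousOn_const (c := !![-(2 * Complex.I), 0; 0, 2 * Complex.I])) (fun k s hs => ?_)
    (by simp only [h0]; fun_prop)
  · fin_cases i <;> fin_cases j <;> simp <;> fun_prop
  · have := hY k s hs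
    rwa [laxV_eq] at this

/-- `ψ` solves both equations of the Lax pair on `[0,L] × [0,T]`. -/
structure IsLaxSolution (lam L T : ℝ) (q qx : ℝ → ℝ → ℂ) (k : ℂ) (ψ : ℝ → ℝ → Mat) : Prop where
  lax_x : ∀ x ∈ Set.Icc 0 L, ∀ t ∈ Set.Icc 0 T,
    HasDerivWithinAt (fun y => ψ y t) (laxU lam (q x t) k * ψ x t) (Set.Icc 0 L) x
  lax_t : ∀ x ∈ Set.Icc 0 L, ∀ t ∈ Set.Icc 0 T,
    HasDerivWithinAt (fun s => ψ x s) (laxV lam (q x t) (qx x t) k * ψ x t) (Set.Icc 0 T) t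

section

variable {lam L T M : ℝ} {q qx qxx qt qxt : ℝ → ℝ → ℂ}

theorem IsJet.continuousOn_x (h : IsJet lam L T M q qx qxx qt qxt) {t : ℝ}
    (ht : t ∈ Set.Icc 0 T) (S : Set ℝ) :
    ContinuousOn (fun y => q y t) S ∧ ContinuousOn (fun y => qx y t) S :=
  ⟨fun x _ => (h.hasDerivAt_x x t ht).continuousAt.continuousWithinAt,
    fun x _ => (h.hasDerivAt_xx x t ht).continuousAt.continuousWithinAt⟩

theorem IsJet.continuousOn_t (h : IsJet lam L T M q qx qxx qt qxt) (x : ℝ) :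
    ContinuousOn (fun s => q x s) (Set.Icc 0 T) ∧ ContinuousOn (fun s => qx x s) (Set.Icc 0 T) :=
  ⟨fun t ht => (h.hasDerivWithinAt_t x t ht).continuousWithinAt,
    fun t ht => (h.hasDerivWithinAt_xt x t ht).continuousWithinAt⟩

theorem laxV_hasDerivWithinAt (lam : ℝ) (k : ℂ) {f g : ℝ → ℂ} {f' g' : ℂ} {S : Set ℝ} {x : ℝ}
    (hf : HasDerivWithinAt f f' S x) (hg : HasDerivWithinAt g g' S x) :
    HasDerivWithinAt (fun y => laxV lam (f y) (g y) k)
      !![-(Complex.I * lam * (f' * conj (f x) + f x * conj f')), 2 * k * f' + Complex.I * g';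
        lam * (2 * k * conj f' - Complex.I * conj g'),
        Complex.I * lam * (f' * conj (f x) + f x * conj f')] S x := by
  refine hasDerivWithinAt_mat.2 fun i j => ?_
  have hn := (hf.fun_mul hf.conj).const_mul (Complex.I * lam)
  fin_cases i <;> fin_cases j <;> simp [laxV]
  · exact hn.const_sub _
  · exact (hf.const_mul _).add (hg.const_mul _)
  · exact ((hf.conj.const_mul _).sub (hg.conj.const_mul _)).const_mul _
  · exact hn

/-- Zero curvature: NLS says U_t - V_x + [U,V] = 0. Therefore V Y satisfies the x-equation with
source U_t Y, which is exactly the equation that the t-derivative of Y has to satisfy. -/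
theorem laxV_mul_solution (h : IsJet lam L T M q qx qxx qt qxt) (k : ℂ) {t : ℝ}
    (ht : t ∈ Set.Icc 0 T) {Y : ℝ → Mat}
    (hY : ∀ x ∈ Set.Icc 0 L,
      HasDerivWithinAt Y (laxU lam (q x t) k * Y x) (Set.Icc 0 L) x) :
    ∀ x ∈ Set.Icc 0 L, HasDerivWithinAt (fun y => laxV lam (q y t) (qx y t) k * Y y)
      (laxU lam (q x t) k * (laxV lam (q x t) (qx x t) k * Y x)
        + !![0, qt x t; lam * conj (qt x t), 0] * Y x) (Set.Icc 0 L) x := by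
  intro x hx
  have h1 := (laxV_hasDerivWithinAt lam k (h.hasDerivAt_x x t ht).hasDerivWithinAt
    (h.hasDerivAt_xx x t ht).hasDerivWithinAt).mul (hY x hx)
  refine h1.congr_deriv ?_
  rw [← Matrix.mul_assoc, ← Matrix.mul_assoc, ← add_mul, ← add_mul]
  congr 1
  have e := h.nls x t ht
  have e' := congrArg conj e
  simp only [map_add, map_sub, map_mul, Complex.conj_I, Complex.conj_ofReal, Complex.conj_conj,
    map_ofNat, map_zero] at e'
  have hI := Complex.I_sq
  ext i j
  fin_cases i <;> fin_cases j <;>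
    simp [laxU, laxV]
  · ring
  · linear_combination Complex.I * e - (qt x t - 2 * k * qx x t) * hI
  · linear_combination (-Complex.I * lam) * e' - (lam * conj (qt x t) - 2 * lam * k * conj (qx x t)) * hI
  · ring

/-- Solve the t-equation on x = 0, then for each t the x-equation from that initial value. The
t-equation for other x holds because V ψ solves the linearized x-equation with the right value at x
= 0, hence is the derivative of ψ in the parameter t. -/
theorem exists_fundamental (hL : 0 ≤ L) (hT : 0 ≤ T) (hM : 0 ≤ M)
    (h : IsJet lam L T M q qx qxx qt qxt) :
    ∃ ψ : ℂ → ℝ → ℝ → Mat, (∀ k, IsLaxSolution lam L T q qx k (ψ k)) ∧ (∀ k, ψ k 0 0 = 1) ∧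
      ∀ x ∈ Set.Icc 0 L, ∀ t ∈ Set.Icc 0 T, Differentiable ℂ fun k => ψ k x t := by
  have h0L : (0 : ℝ) ∈ Set.Icc 0 L := ⟨le_rfl, hL⟩
  have h0T : (0 : ℝ) ∈ Set.Icc 0 T := ⟨le_rfl, hT⟩
  obtain ⟨Z, hZ0, hZ, hZd⟩ := exists_laxT_solution (lam := lam) hT (h.continuousOn_t 0).1
    (h.continuousOn_t 0).2
  have hY : ∀ t : ℝ, ∃ Y : ℂ → ℝ → Mat, t ∈ Set.Icc 0 T → (∀ k, Y k 0 = Z k t) ∧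
      (∀ k, ∀ s ∈ Set.Icc 0 L,
        HasDerivWithinAt (Y k) (laxU lam (q s t) k * Y k s) (Set.Icc 0 L) s) ∧
      ∀ s ∈ Set.Icc 0 L, Differentiable ℂ fun k => Y k s := by
    intro t
    by_cases ht : t ∈ Set.Icc 0 T
    · obtain ⟨Y, hY⟩ := exists_laxX_solution (lam := lam) hL
        (h.continuousOn_x ht (Set.Icc 0 L)).1 (hZd t ht)
      exact ⟨Y, fun _ => hY⟩
    · exact ⟨fun _ _ => 0, fun h => absurd h ht⟩
  choose Y hY using hY
  refine ⟨fun k x t => Y t k x, fun k => ⟨fun x hx t ht => (hY t ht).2.1 k x hx,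
    fun x hx t ht => ?_⟩, fun k => ((hY 0 h0T).1 k).trans (hZ0 k),
    fun x hx t ht => (hY t ht).2.2 x hx⟩
  have hVz := laxV_mul_solution h k ht ((hY t ht).2.1 k)
  obtain ⟨B, hB⟩ := isCompact_Icc.exists_bound_of_continuousOn
    (continuousOn_laxU lam k (h.continuousOn_x ht (Set.Icc 0 L)).1)
  have hB0 : 0 ≤ B := (norm_nonneg _).trans (hB x hx)
  obtain ⟨C, hC0, hC⟩ : ∃ C : ℝ, 0 ≤ C ∧ ∀ z : ℂ, ‖(!![0, z; lam * conj z, 0] : Mat)‖ ≤ C * ‖z‖ := by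
    refine ⟨1 + |lam|, by positivity, fun z => ?_⟩
    have e : (!![0, z; lam * conj z, 0] : Mat)
        = z • !![0, 1; 0, 0] + (lam * conj z) • !![0, 0; 1, 0] := by
      ext i j; fin_cases i <;> fin_cases j <;> simp
    have n1 : ‖(!![0, 1; 0, 0] : Mat)‖ ≤ 1 := by
      rw [Matrix.linfty_opNorm_def]; norm_cast; simp [Finset.sup_le_iff, Fin.forall_fin_two]
    have n2 : ‖(!![0, 0; 1, 0] : Mat)‖ ≤ 1 := by
      rw [Matrix.linfty_opNorm_def]; norm_cast; simp [Finset.sup_le_iff, Fin.forall_fin_two]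
    rw [e]
    refine (norm_add_le _ _).trans ?_
    rw [norm_smul, norm_smul, norm_mul, RCLike.norm_conj, Complex.norm_real, Real.norm_eq_abs]
    have := mul_le_mul_of_nonneg_left n1 (norm_nonneg z)
    have := mul_le_mul_of_nonneg_left n2 (mul_nonneg (abs_nonneg lam) (norm_nonneg z))
    nlinarith
  -- In the constant, B bounds U, the summand C (M + M) bounds the first difference of U (using |s -
  -- t| ≤ 1), and C M bounds its Taylor remainder.
  refine linearODE_hasDerivWithinAt_param (S := Set.Icc 0 T) ht hL
    (M := B + C * M + C * (M + M))
    (W := fun t x => laxU lam (q x t) k) (W' := fun x => !![0, qt x t; lam * conj (qt x t), 0])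
    (Y := fun t x => Y t k x) (z := fun x => laxV lam (q x t) (qx x t) k * Y t k x)
    (fun t ht => (hY t ht).2.1 k) hVz (fun s hs hst x hx => ?_) ?_ x hx
  · have b1 := hB x hx
    have b2 := h.taylor x hx t ht s hs
    have b3 := (h.bound x hx t ht).2.2.2.1
    rw [Real.norm_eq_abs] at hst ⊢
    have e1 : laxU lam (q x s) k - laxU lam (q x t) k
        = !![0, q x s - q x t; lam * conj (q x s - q x t), 0] := by
      ext i j; fin_cases i <;> fin_cases j <;> simp [laxU]
      ring
    have e2 : laxU lam (q x s) k - laxU lam (q x t) k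
        - (s - t) • (!![0, qt x t; lam * conj (qt x t), 0] : Mat)
        = !![0, q x s - q x t - ((s - t : ℝ) : ℂ) * qt x t;
          lam * conj (q x s - q x t - ((s - t : ℝ) : ℂ) * qt x t), 0] := by
      rw [e1]
      ext i j; fin_cases i <;> fin_cases j <;> simp [Complex.real_smul]
      ring
    have hq1 : ‖q x s - q x t‖ ≤ (M + M) * |s - t| := by
      have e3 : q x s - q x t = (q x s - q x t - ((s - t : ℝ) : ℂ) * qt x t)
        + ((s - t : ℝ) : ℂ) * qt x t := by ring
      rw [e3]
      refine (norm_add_le _ _).trans ?_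
      rw [norm_mul, Complex.norm_real, Real.norm_eq_abs]
      have : |s - t| ^ 2 ≤ |s - t| := by
        rw [pow_two]; exact mul_le_of_le_one_left (abs_nonneg _) hst
      nlinarith [abs_nonneg (s - t)]
    have hp := abs_nonneg (s - t)
    have hCM : 0 ≤ C * M := by positivity
    refine ⟨by nlinarith, ?_, ?_⟩
    · rw [e1]
      refine (hC _).trans ((mul_le_mul_of_nonneg_left hq1 hC0).trans ?_)
      nlinarith [mul_nonneg (add_nonneg hB0 hCM) hp]
    · rw [e2]
      refine (hC _).trans ((mul_le_mul_of_nonneg_left b2 hC0).trans ?_)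
      nlinarith [mul_nonneg (add_nonneg hB0 hCM) (sq_nonneg |s - t|),
        mul_nonneg hCM (sq_nonneg |s - t|)]
  · have := hZ k t ht
    rw [(hY t ht).1 k]
    exact this.congr (fun s hs => (hY s hs).1 k) ((hY t ht).1 k)

end

end

section

attribute [local instance] Matrix.linftyOpNormedRing Matrix.linftyOpNormedAlgebra

/-! ### Eigenfunctions in terms of the fundamental solution -/

/-- `e^{-i z σ₃}`. -/
noncomputable def expSigma (z : ℂ) : Mat :=
  !![Complex.exp (-(Complex.I * z)), 0; 0, Complex.exp (Complex.I * z)]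

theorem expSigma_mul (z w : ℂ) : expSigma z * expSigma w = expSigma (z + w) := by
  ext i j
  fin_cases i <;> fin_cases j <;> simp [expSigma, ← Complex.exp_add] <;> ring_nf

theorem expSigma_zero : expSigma 0 = 1 := by
  ext i j
  fin_cases i <;> fin_cases j <;> simp [expSigma]

theorem expSigma_hasDerivWithinAt {f : ℝ → ℂ} {f' : ℂ} {S : Set ℝ} {s : ℝ}
    (h : HasDerivWithinAt f f' S s) :
    HasDerivWithinAt (fun s => expSigma (f s))
      (expSigma (f s) * !![-(Complex.I * f'), 0; 0, Complex.I * f']) S s := by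
  refine hasDerivWithinAt_mat.2 fun i j => ?_
  have h1 := (h.const_mul Complex.I).cexp
  have h2 := (h.const_mul Complex.I).neg.cexp
  fin_cases i <;> fin_cases j <;> simp [expSigma]
  · simpa using h2
  · exact hasDerivWithinAt_const ..
  · exact hasDerivWithinAt_const ..
  · exact h1

theorem theta_hasDerivWithinAt_x (x t : ℝ) (k : ℂ) (S : Set ℝ) :
    HasDerivWithinAt (fun y : ℝ => theta y t k) k S x := by
  have h := (((hasDerivAt_id x).ofReal_comp.const_mul k).add_const (2 * k ^ 2 * t))
  simpa [theta] using h.hasDerivWithinAt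

theorem theta_hasDerivWithinAt_t (x t : ℝ) (k : ℂ) (S : Set ℝ) :
    HasDerivWithinAt (fun s : ℝ => theta x s k) (2 * k ^ 2) S t := by
  have h := (((hasDerivAt_id t).ofReal_comp.const_mul (2 * k ^ 2)).const_add (k * x))
  simpa [theta] using h.hasDerivWithinAt

section

variable {lam L T : ℝ} {q qx : ℝ → ℝ → ℂ} {k : ℂ}

theorem matQtilde_eq {x t : ℝ} (h : deriv (fun y => q y t) x = qx x t) :
    matQtilde lam q x t k = laxV lam (q x t) (qx x t) k
      + (2 * Complex.I * k ^ 2) • sigma3 := by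
  have h1 : (‖q x t‖ : ℂ) ^ 2 = q x t * conj (q x t) := by
    rw [Complex.mul_conj, Complex.normSq_eq_norm_sq]; norm_cast
  ext i j
  fin_cases i <;> fin_cases j <;> simp [matQtilde, laxV, sigma3, matQ, h, h1] <;> ring

theorem matQ_eq (z : ℂ) : matQ lam z = laxU lam z k + (Complex.I * k) • sigma3 := by
  ext i j
  fin_cases i <;> fin_cases j <;> simp [matQ, laxU, sigma3]

/-- Right multiplication by e^{-iθσ₃} removes the commutator: its derivative cancels the part of
[σ₃, μ] in which σ₃ stands on the right. -/
theorem IsEigenfunction.isLaxSolution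
    (hqx : ∀ x, ∀ t ∈ Set.Icc 0 T, deriv (fun y => q y t) x = qx x t) {x₀ t₀ : ℝ}
    {μ : ℝ → ℝ → Mat} (h : IsEigenfunction lam L T q x₀ t₀ k μ) :
    IsLaxSolution lam L T q qx k (fun x t => μ x t * expSigma (theta x t k)) := by
  refine ⟨fun x hx t ht => ?_, fun x hx t ht => ?_⟩
  · refine ((hasDerivWithinAt_mat.2 (h.lax_x x hx t ht)).mul
      (expSigma_hasDerivWithinAt (theta_hasDerivWithinAt_x x t k (Set.Icc 0 L)))).congr_deriv ?_
    rw [matQ_eq (k := k)]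
    ext i j
    simp only [Matrix.mul_apply, Fin.sum_univ_two, Matrix.sub_apply, Matrix.add_apply,
      Matrix.smul_apply, smul_eq_mul]
    fin_cases i <;> fin_cases j <;> simp [sigma3, expSigma] <;> ring
  · refine ((hasDerivWithinAt_mat.2 (h.lax_t x hx t ht)).mul
      (expSigma_hasDerivWithinAt (theta_hasDerivWithinAt_t x t k (Set.Icc 0 T)))).congr_deriv ?_
    rw [matQtilde_eq (hqx x t ht)]
    ext i j
    simp only [Matrix.mul_apply, Fin.sum_univ_two, Matrix.sub_apply, Matrix.add_apply,
      Matrix.smul_apply, smul_eq_mul]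
    fin_cases i <;> fin_cases j <;> simp [sigma3, expSigma] <;> ring

theorem IsLaxSolution.isEigenfunction
    (hqx : ∀ x, ∀ t ∈ Set.Icc 0 T, deriv (fun y => q y t) x = qx x t) {x₀ t₀ : ℝ}
    {ψ : ℝ → ℝ → Mat} (h : IsLaxSolution lam L T q qx k ψ)
    (h0 : ψ x₀ t₀ = expSigma (theta x₀ t₀ k)) :
    IsEigenfunction lam L T q x₀ t₀ k (fun x t => ψ x t * expSigma (-theta x t k)) := by
  refine ⟨fun x hx t ht => hasDerivWithinAt_mat.1 ?_, fun x hx t ht => hasDerivWithinAt_mat.1 ?_, ?_⟩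
  · refine ((h.lax_x x hx t ht).mul
      (expSigma_hasDerivWithinAt (theta_hasDerivWithinAt_x x t k (Set.Icc 0 L)).neg)).congr_deriv ?_
    rw [matQ_eq (k := k)]
    ext i j
    simp only [Matrix.mul_apply, Fin.sum_univ_two, Matrix.sub_apply, Matrix.add_apply,
      Matrix.smul_apply, smul_eq_mul]
    fin_cases i <;> fin_cases j <;> simp [sigma3, expSigma] <;> ring
  · refine ((h.lax_t x hx t ht).mul
      (expSigma_hasDerivWithinAt (theta_hasDerivWithinAt_t x t k (Set.Icc 0 T)).neg)).congr_deriv ?_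
    rw [matQtilde_eq (hqx x t ht)]
    ext i j
    simp only [Matrix.mul_apply, Fin.sum_univ_two, Matrix.sub_apply, Matrix.add_apply,
      Matrix.smul_apply, smul_eq_mul]
    fin_cases i <;> fin_cases j <;> simp [sigma3, expSigma] <;> ring
  · simp only [h0, expSigma_mul, add_neg_cancel, expSigma_zero]

theorem IsLaxSolution.mul_right {ψ : ℝ → ℝ → Mat} (h : IsLaxSolution lam L T q qx k ψ) (C : Mat) :
    IsLaxSolution lam L T q qx k (fun x t => ψ x t * C) :=
  ⟨fun x hx t ht => ((h.lax_x x hx t ht).mul_const C).congr_deriv (Matrix.mul_assoc _ _ _),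
  fun x hx t ht => ((h.lax_t x hx t ht).mul_const C).congr_deriv (Matrix.mul_assoc _ _ _)⟩

/-- Jacobi's formula: the derivative of the determinant is the trace of W times the determinant, and
the trace vanishes. -/
theorem det_eq_of_hasDerivWithinAt {Y : ℝ → Mat} {W : ℝ → Mat} {ℓ : ℝ}
    (hY : ∀ s ∈ Set.Icc 0 ℓ, HasDerivWithinAt Y (W s * Y s) (Set.Icc 0 ℓ) s)
    (hW : ∀ s, W s 0 0 + W s 1 1 = 0) : ∀ s ∈ Set.Icc 0 ℓ, (Y s).det = (Y 0).det := by
  intro s hs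
  have hd : ∀ s ∈ Set.Icc 0 ℓ, HasDerivWithinAt (fun s => (Y s).det - (Y 0).det) 0
      (Set.Icc 0 ℓ) s := by
    intro s hs
    have h := hasDerivWithinAt_mat.1 (hY s hs)
    simp only [Matrix.det_fin_two]
    refine ((((h 0 0).fun_mul (h 1 1)).fun_sub ((h 0 1).fun_mul (h 1 0))).sub_const _).congr_deriv ?_
    simp only [Matrix.mul_apply, Fin.sum_univ_two]
    linear_combination (Y s 0 0 * Y s 1 1 - Y s 0 1 * Y s 1 0) * hW s
  have := norm_le_of_norm_deriv_le_Icc (K := 0) (ε := 0) (δ := 0) le_rfl le_rfl hd (by simp)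
    (fun s _ => by simp) s hs
  simpa [sub_eq_zero] using this

section Jet

variable {M : ℝ} {qxx qt qxt : ℝ → ℝ → ℂ}

theorem IsLaxSolution.eqOn (hT : 0 ≤ T) (h : IsJet lam L T M q qx qxx qt qxt)
    {ψ φ : ℝ → ℝ → Mat} (hψ : IsLaxSolution lam L T q qx k ψ)
    (hφ : IsLaxSolution lam L T q qx k φ) (h0 : ψ 0 0 = φ 0 0) :
    ∀ x ∈ Set.Icc 0 L, ∀ t ∈ Set.Icc 0 T, ψ x t = φ x t := by
  have h0T : (0 : ℝ) ∈ Set.Icc 0 T := ⟨le_rfl, hT⟩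
  have h1 : ∀ x ∈ Set.Icc 0 L, ψ x 0 = φ x 0 :=
    linearODE_unique (continuousOn_laxU lam k (h.continuousOn_x h0T (Set.Icc 0 L)).1)
      (fun x hx => hψ.lax_x x hx 0 h0T) (fun x hx => hφ.lax_x x hx 0 h0T) h0
  intro x hx
  exact linearODE_unique (continuousOn_laxV lam k (h.continuousOn_t x).1 (h.continuousOn_t x).2)
    (hψ.lax_t x hx) (hφ.lax_t x hx) (h1 x hx)

theorem IsLaxSolution.det_eq_one (hT : 0 ≤ T) {ψ : ℝ → ℝ → Mat} (hψ : IsLaxSolution lam L T q qx k ψ)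
    (h0 : ψ 0 0 = 1) : ∀ x ∈ Set.Icc 0 L, ∀ t ∈ Set.Icc 0 T, (ψ x t).det = 1 := by
  have h0T : (0 : ℝ) ∈ Set.Icc 0 T := ⟨le_rfl, hT⟩
  intro x hx t ht
  rw [det_eq_of_hasDerivWithinAt (hψ.lax_t x hx) (fun s => by simp [laxV]) t ht,
    det_eq_of_hasDerivWithinAt (fun x hx => hψ.lax_x x hx 0 h0T) (fun s => by simp [laxU]) x hx, h0]
  simp

theorem IsLaxSolution.eq_mul (hT : 0 ≤ T) (h : IsJet lam L T M q qx qxx qt qxt)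
    {ψ φ : ℝ → ℝ → Mat} (hψ : IsLaxSolution lam L T q qx k ψ)
    (h0 : ψ 0 0 = 1) (hφ : IsLaxSolution lam L T q qx k φ) :
    ∀ x ∈ Set.Icc 0 L, ∀ t ∈ Set.Icc 0 T, φ x t = ψ x t * φ 0 0 :=
  hφ.eqOn hT h (hψ.mul_right (φ 0 0)) (by rw [h0, one_mul])

/-- The transfer matrix over one period commutes past the time evolution at the end point. -/
theorem IsLaxSolution.period (hL : 0 ≤ L) (h : IsJet lam L T M q qx qxx qt qxt)
    {ψ : ℝ → ℝ → Mat} (hψ : IsLaxSolution lam L T q qx k ψ)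
    (h0 : ψ 0 0 = 1) : ∀ t ∈ Set.Icc 0 T, ψ L t = ψ 0 t * ψ L 0 := by
  have h0L : (0 : ℝ) ∈ Set.Icc 0 L := ⟨le_rfl, hL⟩
  have hLL : L ∈ Set.Icc 0 L := ⟨hL, le_rfl⟩
  -- By periodicity of q and q_x the matrix V at x = L is the one at x = 0, so both sides solve the
  -- same equation in t.
  refine linearODE_unique
    (continuousOn_laxV lam k (h.continuousOn_t 0).1 (h.continuousOn_t 0).2)
    (fun t ht => ?_) (fun t ht => (hψ.mul_right (ψ L 0)).lax_t 0 h0L t ht) (by rw [h0, one_mul])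
  have := hψ.lax_t L hLL t ht
  rwa [(h.periodic t ht).1, (h.periodic t ht).2] at this

end Jet

/-- The symmetry `M ↦ ((conj M₂₂, lam conj M₂₁), (lam conj M₁₂, conj M₁₁))`. -/
noncomputable def symMat (lam : ℝ) (M : Mat) : Mat :=
  !![conj (M 1 1), lam * conj (M 1 0); lam * conj (M 0 1), conj (M 0 0)]

theorem HasDerivWithinAt.symMat {Y : ℝ → Mat} {Y' : Mat} {S : Set ℝ} {s : ℝ}
    (h : HasDerivWithinAt Y Y' S s) :
    HasDerivWithinAt (fun s => symMat lam (Y s)) (symMat lam Y') S s := by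
  have h' := fun i j => (hasDerivWithinAt_mat.1 h i j).conj
  refine hasDerivWithinAt_mat.2 fun i j => ?_
  fin_cases i <;> fin_cases j <;> simp [_root_.symMat]
  · exact h' 1 1
  · exact (h' 1 0).const_mul _
  · exact (h' 0 1).const_mul _
  · exact h' 0 0

/-- Since lam² = 1, `symMat` is M ↦ σ M̄ σ⁻¹ with σ = ((0, 1), (lam, 0)), hence multiplicative;
together with k ↦ conj k it fixes both U and V. -/
theorem IsLaxSolution.symMat (hlam : lam = 1 ∨ lam = -1) {ψ : ℝ → ℝ → Mat}
    (hψ : IsLaxSolution lam L T q qx (conj k) ψ) :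
    IsLaxSolution lam L T q qx k (fun x t => symMat lam (ψ x t)) := by
  have hl : (lam : ℂ) * lam = 1 := by rcases hlam with rfl | rfl <;> simp
  refine ⟨fun x hx t ht => (hψ.lax_x x hx t ht).symMat.congr_deriv ?_,
    fun x hx t ht => (hψ.lax_t x hx t ht).symMat.congr_deriv ?_⟩
  · ext i j
    fin_cases i <;> fin_cases j <;>
      simp [_root_.symMat, laxU, Matrix.mul_apply, Fin.sum_univ_two]
    · ring
    · linear_combination q x t * conj (ψ x t 0 0) * hl
    · ring
    · linear_combination (-(conj (q x t)) * conj (ψ x t 1 0)) * hl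
  · have h2 : conj (2 : ℂ) = 2 := Complex.conj_ofNat 2
    ext i j
    fin_cases i <;> fin_cases j <;>
      simp [_root_.symMat, laxV, Matrix.mul_apply, Fin.sum_univ_two, h2]
    · ring
    · linear_combination (2 * k * q x t + Complex.I * qx x t) * conj (ψ x t 0 0) * hl
    · ring
    · linear_combination (-(2 * k * conj (q x t) - Complex.I * conj (qx x t)))
        * conj (ψ x t 1 0) * hl
end

end

/-! ### Columns normalized at a point of the rectangle, and the scattering relations -/

section

attribute [local instance] Matrix.linftyOpNormedRing Matrix.linftyOpNormedAlgebra

section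

variable {lam L T M : ℝ} {q qx qxx qt qxt : ℝ → ℝ → ℂ} {k : ℂ}

/-- This makes the choice in `eigenfunction` harmless: ψ(x,t) ψ(x₀,t₀)⁻¹ provides a solution (the
inverse is the adjugate, since the determinant is one), and uniqueness for the Lax pair identifies
the chosen one with it on the rectangle. -/
theorem eigenfunction_eq (hT : 0 ≤ T) (h : IsJet lam L T M q qx qxx qt qxt)
    {ψ : ℝ → ℝ → Mat} (hψ : IsLaxSolution lam L T q qx k ψ) (h0 : ψ 0 0 = 1)
    {x₀ t₀ : ℝ} (hx₀ : x₀ ∈ Set.Icc 0 L) (ht₀ : t₀ ∈ Set.Icc 0 T) {x t : ℝ}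
    (hx : x ∈ Set.Icc 0 L) (ht : t ∈ Set.Icc 0 T) :
    eigenfunction lam L T q x₀ t₀ k x t
      = ψ x t * ((ψ x₀ t₀).adjugate * expSigma (theta x₀ t₀ k)) * expSigma (-theta x t k) := by
  have hqx : ∀ x, ∀ t ∈ Set.Icc 0 T, deriv (fun y => q y t) x = qx x t := fun x t ht =>
    (h.hasDerivAt_x x t ht).deriv
  have hdet : (ψ x₀ t₀).det = 1 := hψ.det_eq_one hT h0 x₀ hx₀ t₀ ht₀
  have hex : ∃ μ, IsEigenfunction lam L T q x₀ t₀ k μ := by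
    refine ⟨_, (hψ.mul_right ((ψ x₀ t₀).adjugate * expSigma (theta x₀ t₀ k))).isEigenfunction
      hqx ?_⟩
    rw [← Matrix.mul_assoc, Matrix.mul_adjugate, hdet, one_smul, one_mul]
  have hμ : IsEigenfunction lam L T q x₀ t₀ k (eigenfunction lam L T q x₀ t₀ k) :=
    Classical.epsilon_spec hex
  have hφ := hψ.eq_mul hT h h0 (IsEigenfunction.isLaxSolution hqx hμ)
  have h1 := hφ x₀ hx₀ t₀ ht₀
  simp only [hμ.normalized, one_mul] at h1
  have h2 := hφ x hx t ht
  rw [h1, ← Matrix.mul_assoc ((ψ x₀ t₀).adjugate), Matrix.adjugate_mul, hdet, one_smul, one_mul,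
    ← h2, Matrix.mul_assoc, expSigma_mul, add_neg_cancel, expSigma_zero, Matrix.mul_one]

end

/-- Entry `i` of the second column of the eigenfunction normalized at `(x₀,t₀)`. -/
noncomputable def muCol (ψ : ℂ → ℝ → ℝ → Mat) (x₀ t₀ x t : ℝ) (i : Fin 2) (k : ℂ) : ℂ :=
  (ψ k x t i 1 * ψ k x₀ t₀ 0 0 - ψ k x t i 0 * ψ k x₀ t₀ 0 1)
    * Complex.exp (-(Complex.I * (theta x t k - theta x₀ t₀ k)))

/-- `F = a A + lam b̄ B e^{2ikL}`. -/
noncomputable def specF (lam L : ℝ) (a b A B : ℂ → ℂ) (k : ℂ) : ℂ :=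
  a k * A k + lam * schwarz b k * B k * Complex.exp (2 * Complex.I * k * L)

/-- `H = a Ā - lam b B̄`. -/
noncomputable def specH (lam : ℝ) (a b A B : ℂ → ℂ) (k : ℂ) : ℂ :=
  a k * schwarz A k - lam * b k * schwarz B k

section

variable {lam L T M : ℝ} {q qx qxx qt qxt : ℝ → ℝ → ℂ}

/-- A fundamental solution of the Lax pair, for all `k`. -/
structure IsFundamental (lam L T : ℝ) (q qx : ℝ → ℝ → ℂ) (ψ : ℂ → ℝ → ℝ → Mat) : Prop where
  lax : ∀ k, IsLaxSolution lam L T q qx k (ψ k)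
  init : ∀ k, ψ k 0 0 = 1
  entire : ∀ x ∈ Set.Icc 0 L, ∀ t ∈ Set.Icc 0 T, Differentiable ℂ fun k => ψ k x t

variable {ψ : ℂ → ℝ → ℝ → Mat}

/-- The reflected solution takes the same value 1 at the origin, so uniqueness applies. -/
theorem IsFundamental.symm (hlam : lam = 1 ∨ lam = -1) (hT : 0 ≤ T)
    (h : IsJet lam L T M q qx qxx qt qxt) (hψ : IsFundamental lam L T q qx ψ) {x t : ℝ}
    (hx : x ∈ Set.Icc 0 L) (ht : t ∈ Set.Icc 0 T) (k : ℂ) :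
    conj (ψ (conj k) x t 0 0) = ψ k x t 1 1 ∧ conj (ψ (conj k) x t 1 1) = ψ k x t 0 0 ∧
    conj (ψ (conj k) x t 0 1) = lam * ψ k x t 1 0 ∧
    conj (ψ (conj k) x t 1 0) = lam * ψ k x t 0 1 := by
  have hl : (lam : ℂ) * lam = 1 := by rcases hlam with rfl | rfl <;> simp
  have h1 := (hψ.lax k).eqOn hT h (IsLaxSolution.symMat hlam (hψ.lax (conj k))) (by
    rw [hψ.init, hψ.init]
    ext i j; fin_cases i <;> fin_cases j <;> simp [symMat]) x hx t ht
  rw [h1]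
  simp only [symMat, Matrix.of_apply, Matrix.cons_val', Matrix.cons_val_zero,
    Matrix.cons_val_one, Matrix.cons_val_fin_one, ← mul_assoc, hl, one_mul, and_self]

theorem IsFundamental.det (hT : 0 ≤ T) (hψ : IsFundamental lam L T q qx ψ) {x t : ℝ}
    (hx : x ∈ Set.Icc 0 L) (ht : t ∈ Set.Icc 0 T) (k : ℂ) :
    ψ k x t 0 0 * ψ k x t 1 1 - ψ k x t 0 1 * ψ k x t 1 0 = 1 := by
  rw [← Matrix.det_fin_two, (hψ.lax k).det_eq_one hT (hψ.init k) x hx t ht]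

theorem IsFundamental.eigenfunction_eq_muCol (hT : 0 ≤ T) (h : IsJet lam L T M q qx qxx qt qxt)
    (hψ : IsFundamental lam L T q qx ψ) {x₀ t₀ : ℝ} (hx₀ : x₀ ∈ Set.Icc 0 L)
    (ht₀ : t₀ ∈ Set.Icc 0 T) {x t : ℝ} (hx : x ∈ Set.Icc 0 L) (ht : t ∈ Set.Icc 0 T) (i : Fin 2)
    (k : ℂ) : eigenfunction lam L T q x₀ t₀ k x t i 1 = muCol ψ x₀ t₀ x t i k := by
  rw [eigenfunction_eq hT h (hψ.lax k) (hψ.init k) hx₀ ht₀ hx ht]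
  have e : Complex.exp (Complex.I * theta x₀ t₀ k) * Complex.exp (-(Complex.I * theta x t k))
      = Complex.exp (-(Complex.I * (theta x t k - theta x₀ t₀ k))) := by
    rw [← Complex.exp_add]; ring_nf
  simp only [Matrix.mul_apply, Fin.sum_univ_two, Matrix.adjugate_fin_two, muCol, ← e]
  simp [expSigma]
  ring

theorem IsFundamental.differentiable_muCol (hψ : IsFundamental lam L T q qx ψ) {x₀ t₀ : ℝ}
    (hx₀ : x₀ ∈ Set.Icc 0 L) (ht₀ : t₀ ∈ Set.Icc 0 T) {x t : ℝ} (hx : x ∈ Set.Icc 0 L)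
    (ht : t ∈ Set.Icc 0 T) (i : Fin 2) : Differentiable ℂ (muCol ψ x₀ t₀ x t i) := by
  have h1 := differentiable_mat.1 (hψ.entire x hx t ht)
  have h2 := differentiable_mat.1 (hψ.entire x₀ hx₀ t₀ ht₀)
  unfold muCol theta
  exact (((h1 i 1).mul (h2 0 0)).sub ((h1 i 0).mul (h2 0 1))).mul (by fun_prop)

/-- The symmetry of ψ turns conjugated entries of the second column into entries of the first column
of the same eigenfunction. This removes all conjugates from the verification of the scattering
relations. -/
theorem schwarz_muCol (hlam : lam = 1 ∨ lam = -1) (hT : 0 ≤ T)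
    (h : IsJet lam L T M q qx qxx qt qxt) (hψ : IsFundamental lam L T q qx ψ) {x₀ t₀ : ℝ}
    (hx₀ : x₀ ∈ Set.Icc 0 L) (ht₀ : t₀ ∈ Set.Icc 0 T) {x t : ℝ} (hx : x ∈ Set.Icc 0 L)
    (ht : t ∈ Set.Icc 0 T) (k : ℂ) :
    schwarz (muCol ψ x₀ t₀ x t 1) k
      = (ψ k x t 0 0 * ψ k x₀ t₀ 1 1 - ψ k x t 0 1 * ψ k x₀ t₀ 1 0)
        * Complex.exp (Complex.I * (theta x t k - theta x₀ t₀ k)) ∧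
    lam * schwarz (muCol ψ x₀ t₀ x t 0) k
      = (ψ k x t 1 0 * ψ k x₀ t₀ 1 1 - ψ k x t 1 1 * ψ k x₀ t₀ 1 0)
        * Complex.exp (Complex.I * (theta x t k - theta x₀ t₀ k)) := by
  have hl : (lam : ℂ) * lam = 1 := by rcases hlam with rfl | rfl <;> simp
  obtain ⟨a1, a2, a3, a4⟩ := hψ.symm hlam hT h hx ht k
  obtain ⟨b1, b2, b3, b4⟩ := hψ.symm hlam hT h hx₀ ht₀ k
  have e : conj (Complex.exp (-(Complex.I * (theta x t (conj k) - theta x₀ t₀ (conj k)))))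
      = Complex.exp (Complex.I * (theta x t k - theta x₀ t₀ k)) := by
    rw [← Complex.exp_conj]
    simp [theta, show conj (2 : ℂ) = 2 from Complex.conj_ofNat 2]
  simp only [schwarz, muCol, map_mul, map_sub, a1, a2, a3, a4, b1, b3, e]
  constructor
  · linear_combination (-(ψ k x t 0 1 * ψ k x₀ t₀ 1 0)
      * Complex.exp (Complex.I * (theta x t k - theta x₀ t₀ k))) * hl
  · linear_combination ((ψ k x t 1 0 * ψ k x₀ t₀ 1 1 - ψ k x t 1 1 * ψ k x₀ t₀ 1 0)
      * Complex.exp (Complex.I * (theta x t k - theta x₀ t₀ k))) * hl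

/-- The algebraic relations between the eigenfunctions and the spectral functions. -/
structure IsScattering (lam L x t : ℝ) (a b A B : ℂ → ℂ) (u v y z : Fin 2 → ℂ → ℂ) : Prop where
  det_s : ∀ k, a k * schwarz a k - lam * b k * schwarz b k = 1
  det_S : ∀ k, A k * schwarz A k - lam * B k * schwarz B k = 1
  det_z : ∀ k, z 1 k * schwarz (z 1) k - lam * z 0 k * schwarz (z 0) k = 1
  u_eq : ∀ k, ∀ i, u i k = Complex.exp (-(2 * Complex.I * theta x t k))
      * (schwarz a k * B k * Complex.exp (2 * Complex.I * k * L) + b k * A k)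
      * (![schwarz (z 1) k, lam * schwarz (z 0) k] : Fin 2 → ℂ) i + specF lam L a b A B k * z i k
  v_eq : ∀ k, ∀ i, v i k = Complex.exp (-(2 * Complex.I * theta x t k)) * b k
      * (![schwarz (z 1) k, lam * schwarz (z 0) k] : Fin 2 → ℂ) i + a k * z i k
  y_eq : ∀ k, ∀ i, y i k = Complex.exp (-(2 * Complex.I * theta x t k)) * B k
      * (![schwarz (z 1) k, lam * schwarz (z 0) k] : Fin 2 → ℂ) i + A k * z i k

/-- All eigenfunctions are ψ times matrices constant in (x,t), up to exponentials, so every column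
is a combination of the two columns normalized at (0,0). For the corner (L,T) the factorization of
ψ(L,T) by `IsLaxSolution.period` leaves only a, b, A, B in the coefficients. The last clause makes F
itself an eigenfunction entry, whence its asymptotics. -/
theorem IsFundamental.isScattering (hlam : lam = 1 ∨ lam = -1) (hL : 0 ≤ L) (hT : 0 ≤ T)
    (h : IsJet lam L T M q qx qxx qt qxt) (hψ : IsFundamental lam L T q qx ψ) {x t : ℝ}
    (hx : x ∈ Set.Icc 0 L) (ht : t ∈ Set.Icc 0 T) :
    IsScattering lam L x t (muCol ψ L 0 0 0 1) (muCol ψ L 0 0 0 0) (muCol ψ 0 T 0 0 1)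
      (muCol ψ 0 T 0 0 0) (muCol ψ L T x t) (muCol ψ L 0 x t) (muCol ψ 0 T x t)
      (muCol ψ 0 0 x t) ∧
    ∀ k, specF lam L (muCol ψ L 0 0 0 1) (muCol ψ L 0 0 0 0) (muCol ψ 0 T 0 0 1)
      (muCol ψ 0 T 0 0 0) k = muCol ψ L T 0 0 1 k := by
  have hl : (lam : ℂ) * lam = 1 := by rcases hlam with rfl | rfl <;> simp
  have h0L : (0 : ℝ) ∈ Set.Icc 0 L := ⟨le_rfl, hL⟩
  have h0T : (0 : ℝ) ∈ Set.Icc 0 T := ⟨le_rfl, hT⟩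
  have hLL : L ∈ Set.Icc 0 L := ⟨hL, le_rfl⟩
  have hTT : T ∈ Set.Icc 0 T := ⟨hT, le_rfl⟩
  have s1 := fun k => schwarz_muCol hlam hT h hψ hLL h0T h0L h0T k
  have s2 := fun k => schwarz_muCol hlam hT h hψ h0L hTT h0L h0T k
  have s3 := fun k => schwarz_muCol hlam hT h hψ h0L h0T hx ht k
  have hper := fun k => (hψ.lax k).period hL h (hψ.init k) T hTT
  have w00 : ∀ k, ψ k L T 0 0 = ψ k 0 T 0 0 * ψ k L 0 0 0 + ψ k 0 T 0 1 * ψ k L 0 1 0 := fun k => by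
    rw [hper, Matrix.mul_apply, Fin.sum_univ_two]
  have w01 : ∀ k, ψ k L T 0 1 = ψ k 0 T 0 0 * ψ k L 0 0 1 + ψ k 0 T 0 1 * ψ k L 0 1 1 := fun k => by
    rw [hper, Matrix.mul_apply, Fin.sum_univ_two]
  have t0 : ∀ k, theta 0 0 k = 0 := fun k => by simp [theta]
  have tLT : ∀ k, theta L T k = theta L 0 k + theta 0 T k := fun k => by simp [theta]
  have expnn : ∀ z : ℂ, Complex.exp z * Complex.exp (-z) = 1 := fun z => by
    rw [← Complex.exp_add]; simp
  have eL : ∀ k : ℂ, Complex.exp (2 * Complex.I * k * L)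
      = Complex.exp (Complex.I * theta L 0 k) * Complex.exp (Complex.I * theta L 0 k) := fun k => by
    rw [← Complex.exp_add]; congr 1; simp [theta]; ring
  have eth : ∀ k : ℂ, Complex.exp (-(2 * Complex.I * theta x t k))
      = Complex.exp (-(Complex.I * theta x t k)) * Complex.exp (-(Complex.I * theta x t k)) :=
    fun k => by rw [← Complex.exp_add]; congr 1; ring
  have d1 := hψ.det hT hLL h0T
  have d2 := hψ.det hT h0L hTT
  have d3 := hψ.det hT hx ht
  have eX := fun k => expnn (Complex.I * theta L 0 k)
  have eY := fun k => expnn (Complex.I * theta 0 T k)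
  have eZ := fun k => expnn (Complex.I * theta x t k)
  have S1 : ∀ k, lam * schwarz (muCol ψ L 0 0 0 0) k = _ := fun k => (s1 k).2
  have S1' : ∀ k, schwarz (muCol ψ L 0 0 0 1) k = _ := fun k => (s1 k).1
  have S2 : ∀ k, lam * schwarz (muCol ψ 0 T 0 0 0) k = _ := fun k => (s2 k).2
  have S2' : ∀ k, schwarz (muCol ψ 0 T 0 0 1) k = _ := fun k => (s2 k).1
  have S3 : ∀ k, lam * schwarz (muCol ψ 0 0 x t 0) k = _ := fun k => (s3 k).2
  have S3' : ∀ k, schwarz (muCol ψ 0 0 x t 1) k = _ := fun k => (s3 k).1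
  have assoc1 : ∀ α β : ℂ, lam * α * β = α * (lam * β) := fun α β => by ring
  have hF : ∀ k, specF lam L (muCol ψ L 0 0 0 1) (muCol ψ L 0 0 0 0) (muCol ψ 0 T 0 0 1)
      (muCol ψ 0 T 0 0 0) k
      = ψ k L T 0 0 * (Complex.exp (Complex.I * theta L 0 k)
        * Complex.exp (Complex.I * theta 0 T k)) := by
    intro k
    rw [specF, S1, eL, w00]
    simp only [muCol, hψ.init, t0, zero_sub, mul_neg, neg_neg]
    simp
    linear_combination (ψ k 0 T 0 1 * ψ k L 0 1 0 * Complex.exp (Complex.I * theta L 0 k)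
      * Complex.exp (Complex.I * theta 0 T k)) * eX k
  refine ⟨⟨fun k => ?_, fun k => ?_, fun k => ?_, fun k i => ?_, fun k i => ?_, fun k i => ?_⟩,
    fun k => ?_⟩
  · rw [assoc1, S1, S1']
    simp only [muCol, hψ.init, t0, zero_sub, mul_neg, neg_neg]
    simp
    linear_combination d1 k * (Complex.exp (Complex.I * theta L 0 k)
      * Complex.exp (-(Complex.I * theta L 0 k))) + eX k
  · rw [assoc1, S2, S2']
    simp only [muCol, hψ.init, t0, zero_sub, mul_neg, neg_neg]
    simp
    linear_combination d2 k * (Complex.exp (Complex.I * theta 0 T k)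
      * Complex.exp (-(Complex.I * theta 0 T k))) + eY k
  · rw [assoc1, S3, S3']
    simp only [muCol, hψ.init, t0, sub_zero]
    simp
    linear_combination d3 k * (Complex.exp (Complex.I * theta x t k)
      * Complex.exp (-(Complex.I * theta x t k))) + eZ k
  · rw [hF, S1', S3, S3', eL, eth]
    simp only [muCol, hψ.init, t0, tLT, w00, w01, sub_zero, zero_sub, mul_neg, neg_neg, mul_sub,
      mul_add, neg_sub, Complex.exp_add, Complex.exp_sub, Complex.exp_neg]
    have n1 := Complex.exp_ne_zero (Complex.I * theta L 0 k)
    have n2 := Complex.exp_ne_zero (Complex.I * theta 0 T k)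
    have n3 := Complex.exp_ne_zero (Complex.I * theta x t k)
    fin_cases i <;> simp <;> field_simp <;> ring
  · rw [S3, S3', eth]
    simp only [muCol, hψ.init, t0, sub_zero, zero_sub, mul_neg, neg_neg, mul_sub,
      neg_sub, Complex.exp_sub, Complex.exp_neg]
    have n1 := Complex.exp_ne_zero (Complex.I * theta L 0 k)
    have n3 := Complex.exp_ne_zero (Complex.I * theta x t k)
    fin_cases i <;> simp <;> field_simp <;> ring
  · rw [S3, S3', eth]
    simp only [muCol, hψ.init, t0, sub_zero, zero_sub, mul_neg, neg_neg, mul_sub,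
      neg_sub, Complex.exp_sub, Complex.exp_neg]
    have n2 := Complex.exp_ne_zero (Complex.I * theta 0 T k)
    have n3 := Complex.exp_ne_zero (Complex.I * theta x t k)
    fin_cases i <;> simp <;> field_simp <;> ring
  · rw [hF]
    simp only [muCol, hψ.init, t0, tLT, zero_sub, mul_neg, neg_neg, mul_add, Complex.exp_add]
    simp
end

end

section

attribute [local instance] Matrix.linftyOpNormedRing Matrix.linftyOpNormedAlgebra

/-! ### Asymptotics of the eigenfunctions for large `k` -/

theorem exp_four_le : Real.exp 4 ≤ 64 := by
  have h : Real.exp 4 = Real.exp 1 ^ 4 := by rw [← Real.exp_nat_mul]; norm_num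
  rw [h]
  have h1 := Real.exp_one_lt_d9.le
  calc Real.exp 1 ^ 4 ≤ 2.7182818286 ^ 4 := by gcongr
    _ ≤ 64 := by norm_num

/-- A dissipative equation for `y₀` weakly coupled to `y₁`: growth bound. -/
theorem weaklyCoupled_bound {y₀ y₁ f₀ f₁ : ℝ → ℂ} {κ : ℂ} {ε : ℝ} (hκ : 0 ≤ κ.re)
    (hε1 : ε ≤ 1)
    (h₀ : ∀ s ∈ Set.Icc (0 : ℝ) 1, HasDerivWithinAt y₀ (-κ * y₀ s + f₀ s) (Set.Icc 0 1) s)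
    (h₁ : ∀ s ∈ Set.Icc (0 : ℝ) 1, HasDerivWithinAt y₁ (f₁ s) (Set.Icc 0 1) s)
    (hf : ∀ s ∈ Set.Icc (0 : ℝ) 1, ‖f₀ s‖ ≤ ε * (‖y₀ s‖ + ‖y₁ s‖) ∧
      ‖f₁ s‖ ≤ ε * (‖y₀ s‖ + ‖y₁ s‖)) :
    ∀ s ∈ Set.Icc (0 : ℝ) 1, ‖y₀ s‖ + ‖y₁ s‖ ≤ 12 * (‖y₀ 0‖ + ‖y₁ 0‖) := by
  -- Energy estimate: the κ term only decreases E, so E' ≤ 4E however large κ is. The final 12 comes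
  -- from 2 · 64 ≤ 12², with e⁴ ≤ 64.
  set E : ℝ → ℝ := fun s => ‖y₀ s‖ ^ 2 + ‖y₁ s‖ ^ 2 with hE
  set E' : ℝ → ℝ := fun s => 2 * inner ℝ (y₀ s) (-κ * y₀ s + f₀ s) + 2 * inner ℝ (y₁ s) (f₁ s)
  have hd : ∀ s ∈ Set.Icc (0 : ℝ) 1, HasDerivWithinAt E (E' s) (Set.Icc 0 1) s := fun s hs =>
    (h₀ s hs).norm_sq.add (h₁ s hs).norm_sq
  have hE' : ∀ s ∈ Set.Icc (0 : ℝ) 1, E' s ≤ 4 * E s := by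
    intro s hs
    obtain ⟨b0, b1⟩ := hf s hs
    have i0 : inner ℝ (y₀ s) (-κ * y₀ s) ≤ 0 := by
      rw [Complex.inner, neg_mul, neg_mul, Complex.neg_re]
      have : κ * y₀ s * conj (y₀ s) = κ * ((‖y₀ s‖ ^ 2 : ℝ) : ℂ) := by
        rw [mul_assoc, Complex.mul_conj, Complex.normSq_eq_norm_sq]
      rw [this, Complex.re_mul_ofReal]
      have := mul_nonneg hκ (sq_nonneg ‖y₀ s‖)
      linarith
    have i1 : inner ℝ (y₀ s) (f₀ s) ≤ ‖y₀ s‖ * ‖f₀ s‖ := real_inner_le_norm _ _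
    have i2 : inner ℝ (y₁ s) (f₁ s) ≤ ‖y₁ s‖ * ‖f₁ s‖ := real_inner_le_norm _ _
    have p0 := norm_nonneg (y₀ s)
    have p1 := norm_nonneg (y₁ s)
    have c0 : ‖f₀ s‖ ≤ ‖y₀ s‖ + ‖y₁ s‖ := b0.trans (mul_le_of_le_one_left (by positivity) hε1)
    have c1 : ‖f₁ s‖ ≤ ‖y₀ s‖ + ‖y₁ s‖ := b1.trans (mul_le_of_le_one_left (by positivity) hε1)
    have j1 := i1.trans (mul_le_mul_of_nonneg_left c0 p0)
    have j2 := i2.trans (mul_le_mul_of_nonneg_left c1 p1)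
    simp only [E', E, inner_add_right]
    nlinarith [sq_nonneg (‖y₀ s‖ - ‖y₁ s‖)]
  intro s hs
  have hg := le_gronwallBound_of_liminf_deriv_right_le (f := E) (f' := E') (δ := E 0) (K := 4)
    (ε := 0) (a := 0) (b := 1) (fun s hs => (hd s hs).continuousWithinAt)
    (fun s hs r hr => ((hd s (Set.Ico_subset_Icc_self hs)).Ici_of_Icc hs).liminf_right_slope_le hr)
    le_rfl (fun s hs => by simpa using hE' s (Set.Ico_subset_Icc_self hs)) s hs
  rw [gronwallBound_ε0, sub_zero] at hg
  have hE0 : 0 ≤ E 0 := by positivity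
  have h4 : Real.exp (4 * s) ≤ 64 :=
    (Real.exp_le_exp.2 (by linarith [hs.2])).trans exp_four_le
  have h5 : E s ≤ E 0 * 64 := hg.trans (by gcongr)
  refine abs_le_of_sq_le_sq' ?_ (by positivity) |>.2
  have p0 := norm_nonneg (y₀ 0)
  have p1 := norm_nonneg (y₁ 0)
  have : E 0 ≤ (‖y₀ 0‖ + ‖y₁ 0‖) ^ 2 := by simp only [E]; nlinarith
  have h6 : (‖y₀ s‖ + ‖y₁ s‖) ^ 2 ≤ 2 * E s := by
    simp only [E]; nlinarith [sq_nonneg (‖y₀ s‖ - ‖y₁ s‖)]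
  nlinarith [sq_nonneg (‖y₀ 0‖ + ‖y₁ 0‖)]

/-- Duhamel: y₀(1) - e^{-κ} y₀(0) is the integral of e^{-κ(1-s)} f₀(s). The kernel is at most 1 in
modulus and its modulus has integral at most 1/Re κ, which gives the first two bounds. The second
one yields decay as Re κ grows. -/
theorem weaklyCoupled_unit {y₀ y₁ f₀ f₁ : ℝ → ℂ} {κ : ℂ} {ε : ℝ} (hκ : 0 ≤ κ.re) (hε : 0 ≤ ε)
    (hε1 : ε ≤ 1)
    (h₀ : ∀ s ∈ Set.Icc (0 : ℝ) 1, HasDerivWithinAt y₀ (-κ * y₀ s + f₀ s) (Set.Icc 0 1) s)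
    (h₁ : ∀ s ∈ Set.Icc (0 : ℝ) 1, HasDerivWithinAt y₁ (f₁ s) (Set.Icc 0 1) s)
    (hf : ∀ s ∈ Set.Icc (0 : ℝ) 1, ‖f₀ s‖ ≤ ε * (‖y₀ s‖ + ‖y₁ s‖) ∧
      ‖f₁ s‖ ≤ ε * (‖y₀ s‖ + ‖y₁ s‖)) :
    ‖y₀ 1 - Complex.exp (-κ) * y₀ 0‖ ≤ 12 * ε * (‖y₀ 0‖ + ‖y₁ 0‖) ∧
    κ.re * ‖y₀ 1 - Complex.exp (-κ) * y₀ 0‖ ≤ 12 * ε * (‖y₀ 0‖ + ‖y₁ 0‖) ∧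
    ‖y₁ 1 - y₁ 0‖ ≤ 12 * ε * (‖y₀ 0‖ + ‖y₁ 0‖) := by
  have hb := weaklyCoupled_bound hκ hε1 h₀ h₁ hf
  set N := ‖y₀ 0‖ + ‖y₁ 0‖
  have hN : 0 ≤ N := by positivity
  have hf0 : ∀ s ∈ Set.Icc (0 : ℝ) 1, ‖f₀ s‖ ≤ 12 * ε * N ∧ ‖f₁ s‖ ≤ 12 * ε * N := fun s hs => by
    have := mul_le_mul_of_nonneg_left (hb s hs) hε
    obtain ⟨c0, c1⟩ := hf s hs
    constructor <;> linarith
  have h01 : (0 : ℝ) ∈ Set.Icc (0 : ℝ) 1 := ⟨le_rfl, zero_le_one⟩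
  have h11 : (1 : ℝ) ∈ Set.Icc (0 : ℝ) 1 := ⟨zero_le_one, le_rfl⟩
  have hlin : ∀ s : ℝ, HasDerivAt (fun s : ℝ => -(κ * (1 - s))) κ s := fun s => by
    have := ((((hasDerivAt_id s).ofReal_comp).const_sub (1 : ℂ)).const_mul κ).fun_neg
    simpa using this
  set h : ℝ → ℂ := fun s => Complex.exp (-(κ * (1 - s))) * y₀ s
  have hh : ∀ s ∈ Set.Icc (0 : ℝ) 1,
      HasDerivWithinAt h (Complex.exp (-(κ * (1 - s))) * f₀ s) (Set.Icc 0 1) s := by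
    intro s hs
    have := (hlin s).cexp.hasDerivWithinAt.fun_mul (h₀ s hs)
    refine this.congr_deriv ?_
    ring
  have hexp : ∀ s : ℝ, ‖Complex.exp (-(κ * (1 - s)))‖ = Real.exp (-(κ.re * (1 - s))) := fun s => by
    rw [Complex.norm_exp]
    congr 1
    have : κ * (1 - s) = κ * ((1 - s : ℝ) : ℂ) := by push_cast; ring
    rw [this, Complex.neg_re, Complex.re_mul_ofReal]
  have hh' : ∀ s ∈ Set.Icc (0 : ℝ) 1, ‖Complex.exp (-(κ * (1 - s))) * f₀ s‖
      ≤ 12 * ε * N * Real.exp (-(κ.re * (1 - s))) := fun s hs => by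
    rw [norm_mul, hexp, mul_comm]
    exact mul_le_mul_of_nonneg_right (hf0 s hs).1 (Real.exp_pos _).le
  have he : h 1 - h 0 = y₀ 1 - Complex.exp (-κ) * y₀ 0 := by simp [h]
  rw [← he]
  refine ⟨?_, ?_, ?_⟩
  · have := (convex_Icc (0 : ℝ) 1).norm_image_sub_le_of_norm_hasDerivWithin_le hh
      (C := 12 * ε * N) (fun s hs => (hh' s hs).trans ?_) h01 h11
    · simpa using this
    · refine mul_le_of_le_one_right (by positivity) (Real.exp_le_one_iff.2 ?_)
      have := mul_nonneg hκ (sub_nonneg.2 hs.2)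
      linarith
  -- The comparison function is Re κ times the integral of the kernel, so no division by Re κ occurs
  -- and Re κ = 0 is allowed.
  · have hg := image_norm_le_of_norm_deriv_right_le_deriv_boundary
      (f := fun s => (κ.re : ℂ) * (h s - h 0))
      (f' := fun s => (κ.re : ℂ) * (Complex.exp (-(κ * (1 - s))) * f₀ s)) (a := 0) (b := 1)
      (B := fun s => 12 * ε * N * (Real.exp (-(κ.re * (1 - s))) - Real.exp (-κ.re)))
      (B' := fun s => κ.re * (12 * ε * N * Real.exp (-(κ.re * (1 - s)))))
      (fun s hs => (((hh s hs).sub_const _).const_mul _).continuousWithinAt)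
      (fun s hs => (((hh s (Set.Ico_subset_Icc_self hs)).Ici_of_Icc hs).sub_const _).const_mul _)
      (by simp) (fun s => ?_) (fun s hs => ?_) h11
    · rw [norm_mul, Complex.norm_real, Real.norm_of_nonneg hκ] at hg
      refine hg.trans (mul_le_of_le_one_right (by positivity) ?_)
      simp [Real.exp_nonneg]
    · have h1 : HasDerivAt (fun s : ℝ => -(κ.re * (1 - s))) κ.re s := by
        simpa using (((hasDerivAt_id s).const_sub 1).const_mul κ.re).fun_neg
      refine ((h1.exp.sub_const _).const_mul (12 * ε * N)).congr_deriv ?_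
      ring
    · rw [norm_mul, Complex.norm_real, Real.norm_of_nonneg hκ]
      exact mul_le_mul_of_nonneg_left (hh' s (Set.Ico_subset_Icc_self hs)) hκ
  · have := (convex_Icc (0 : ℝ) 1).norm_image_sub_le_of_norm_hasDerivWithin_le h₁
      (fun s hs => (hf0 s hs).2) h01 h11
    simpa using this

/-- Transport of a weakly coupled pair from `r₀` to `r₁` in `[0,ℓ]`. -/
theorem weaklyCoupled_transport {y₀ y₁ f₀ f₁ : ℝ → ℂ} {κ : ℂ} {ε ℓ r₀ r₁ : ℝ}
    (hr₀ : r₀ ∈ Set.Icc 0 ℓ) (hr₁ : r₁ ∈ Set.Icc 0 ℓ) (hκ : 0 ≤ (κ * (r₁ - r₀ : ℝ)).re)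
    (hε : 0 ≤ ε) (hε1 : ε * ℓ ≤ 1)
    (h₀ : ∀ s ∈ Set.Icc 0 ℓ, HasDerivWithinAt y₀ (-κ * y₀ s + f₀ s) (Set.Icc 0 ℓ) s)
    (h₁ : ∀ s ∈ Set.Icc 0 ℓ, HasDerivWithinAt y₁ (f₁ s) (Set.Icc 0 ℓ) s)
    (hf : ∀ s ∈ Set.Icc 0 ℓ, ‖f₀ s‖ ≤ ε * (‖y₀ s‖ + ‖y₁ s‖) ∧
      ‖f₁ s‖ ≤ ε * (‖y₀ s‖ + ‖y₁ s‖)) :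
    ‖y₀ r₁ - Complex.exp (-(κ * (r₁ - r₀ : ℝ))) * y₀ r₀‖
      ≤ 12 * (ε * ℓ) * (‖y₀ r₀‖ + ‖y₁ r₀‖) ∧
    (κ * (r₁ - r₀ : ℝ)).re * ‖y₀ r₁ - Complex.exp (-(κ * (r₁ - r₀ : ℝ))) * y₀ r₀‖
      ≤ 12 * (ε * ℓ) * (‖y₀ r₀‖ + ‖y₁ r₀‖) ∧
    ‖y₁ r₁ - y₁ r₀‖ ≤ 12 * (ε * ℓ) * (‖y₀ r₀‖ + ‖y₁ r₀‖) := by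
  have hℓ : 0 ≤ ℓ := hr₀.1.trans hr₀.2
  -- The affine substitution also covers r₁ < r₀: only the sign of Re(κ(r₁ - r₀)) matters, not the
  -- direction of transport.
  set g : ℝ → ℝ := fun s => r₀ + s * (r₁ - r₀) with hg
  have hmaps : Set.MapsTo g (Set.Icc 0 1) (Set.Icc 0 ℓ) := by
    intro s hs
    have h1 := hs.1
    have h2 := hs.2
    obtain ⟨a1, a2⟩ := hr₀
    obtain ⟨b1, b2⟩ := hr₁
    have e : g s = (1 - s) * r₀ + s * r₁ := by simp only [hg]; ring
    rw [e]
    constructor <;> nlinarith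
  have hgd : ∀ s : ℝ, HasDerivWithinAt g (r₁ - r₀) (Set.Icc 0 1) s := fun s =>
    (((hasDerivAt_id s).mul_const (r₁ - r₀)).const_add r₀).hasDerivWithinAt.congr_deriv (one_mul _)
  have hr : |r₁ - r₀| ≤ ℓ := by
    rw [abs_le]; constructor <;> linarith [hr₀.1, hr₀.2, hr₁.1, hr₁.2]
  have := weaklyCoupled_unit (y₀ := y₀ ∘ g) (y₁ := y₁ ∘ g)
    (f₀ := fun s => ((r₁ - r₀ : ℝ) : ℂ) * f₀ (g s)) (f₁ := fun s => ((r₁ - r₀ : ℝ) : ℂ) * f₁ (g s))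
    hκ (mul_nonneg hε hℓ) hε1 (fun s hs => ?_) (fun s hs => ?_) (fun s hs => ?_)
  · simpa [hg] using this
  · refine ((h₀ (g s) (hmaps hs)).scomp s (hgd s) hmaps).congr_deriv ?_
    rw [Complex.real_smul, Function.comp]
    ring
  · refine ((h₁ (g s) (hmaps hs)).scomp s (hgd s) hmaps).congr_deriv ?_
    rw [Complex.real_smul]
  · obtain ⟨b0, b1⟩ := hf (g s) (hmaps hs)
    simp only [Function.comp, norm_mul, Complex.norm_real, Real.norm_eq_abs]
    have p : 0 ≤ ‖y₀ (g s)‖ + ‖y₁ (g s)‖ := by positivity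
    constructor
    · calc _ ≤ ℓ * (ε * (‖y₀ (g s)‖ + ‖y₁ (g s)‖)) := by gcongr
        _ = _ := by ring
    · calc _ ≤ ℓ * (ε * (‖y₀ (g s)‖ + ‖y₁ (g s)‖)) := by gcongr
        _ = _ := by ring

end

/-! ### The gauge transformed Lax pair -/

section

attribute [local instance] Matrix.linftyOpNormedRing Matrix.linftyOpNormedAlgebra

/-- The upper right entry of the gauge transformation which removes the leading terms of the Lax
pair as `k → ∞`. -/
noncomputable def gaugeN (q qx k : ℂ) : ℂ := q / (2 * Complex.I * k) + qx / (4 * k ^ 2)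

/-- The lower left entry of the gauge transformation. -/
noncomputable def gaugeP (lam : ℝ) (q qx k : ℂ) : ℂ := lam * conj (gaugeN q qx (conj k))

theorem gaugeP_eq (lam : ℝ) (q qx k : ℂ) :
    gaugeP lam q qx k
      = lam * (-(conj q / (2 * Complex.I * k)) + conj qx / (4 * k ^ 2)) := by
  simp [gaugeP, gaugeN, show conj (2 : ℂ) = 2 from Complex.conj_ofNat 2,
    show conj (4 : ℂ) = 4 from Complex.conj_ofNat 4, div_neg]

theorem norm_gaugeN_le {q qx k : ℂ} {M : ℝ} (hq : ‖q‖ ≤ M) (hqx : ‖qx‖ ≤ M) (hk : 1 ≤ ‖k‖) :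
    ‖gaugeN q qx k‖ ≤ M * ‖k‖⁻¹ := by
  have hM : 0 ≤ M := (norm_nonneg _).trans hq
  have hk0 : 0 < ‖k‖ := by linarith
  have hδ : ‖k‖⁻¹ ≤ 1 := inv_le_one_of_one_le₀ hk
  have hδ0 : 0 ≤ ‖k‖⁻¹ := by positivity
  refine (norm_add_le _ _).trans ?_
  have h1 : ‖q / (2 * Complex.I * k)‖ ≤ M / 2 * ‖k‖⁻¹ := by
    rw [norm_div, norm_mul, norm_mul, Complex.norm_I, div_eq_mul_inv, mul_inv]
    norm_num
    nlinarith [mul_le_mul_of_nonneg_right hq hδ0]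
  have h2 : ‖qx / (4 * k ^ 2)‖ ≤ M / 4 * ‖k‖⁻¹ := by
    rw [norm_div, norm_mul, norm_pow, div_eq_mul_inv, mul_inv, ← inv_pow]
    norm_num
    have : ‖qx‖ * (‖k‖⁻¹) ^ 2 ≤ M * ‖k‖⁻¹ := by
      have : (‖k‖⁻¹) ^ 2 ≤ ‖k‖⁻¹ := by rw [pow_two]; exact mul_le_of_le_one_left hδ0 hδ
      gcongr
    rw [inv_pow] at this
    linarith
  nlinarith [mul_nonneg hM hδ0]

theorem norm_gaugeP_le {lam : ℝ} (hlam : |lam| = 1) {q qx k : ℂ} {M : ℝ} (hq : ‖q‖ ≤ M)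
    (hqx : ‖qx‖ ≤ M) (hk : 1 ≤ ‖k‖) : ‖gaugeP lam q qx k‖ ≤ M * ‖k‖⁻¹ := by
  rw [gaugeP, norm_mul, Complex.norm_real, Real.norm_eq_abs, hlam, one_mul, RCLike.norm_conj]
  have := norm_gaugeN_le (k := conj k) hq hqx (by simpa using hk)
  simpa using this

section

variable {S : Set ℝ} {s : ℝ} {f g : ℝ → ℂ} {f' g' : ℂ}

theorem gaugeN_hasDerivWithinAt (k : ℂ) (hf : HasDerivWithinAt f f' S s)
    (hg : HasDerivWithinAt g g' S s) :
    HasDerivWithinAt (fun s => gaugeN (f s) (g s) k) (gaugeN f' g' k) S s :=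
  (hf.div_const _).add (hg.div_const _)

theorem gaugeP_hasDerivWithinAt (lam : ℝ) (k : ℂ) (hf : HasDerivWithinAt f f' S s)
    (hg : HasDerivWithinAt g g' S s) :
    HasDerivWithinAt (fun s => gaugeP lam (f s) (g s) k) (gaugeP lam f' g' k) S s :=
  (gaugeN_hasDerivWithinAt (conj k) hf hg).conj.const_mul _

end

/-- The gauge matrix is I minus an off-diagonal matrix of norm at most 1/2, so its inverse has norm
at most 2. This is the outer factor 2 in `gaugeBound`. -/
theorem sum_norm_le_of_gauge {u v n p : ℂ} (hn : ‖n‖ ≤ 1 / 2) (hp : ‖p‖ ≤ 1 / 2) :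
    ‖u‖ + ‖v‖ ≤ 2 * (‖u - n * v‖ + ‖v - p * u‖) := by
  have h1 : ‖u‖ ≤ ‖u - n * v‖ + ‖n * v‖ := norm_le_norm_sub_add u (n * v)
  have h2 : ‖v‖ ≤ ‖v - p * u‖ + ‖p * u‖ := norm_le_norm_sub_add v (p * u)
  rw [norm_mul] at h1 h2
  nlinarith [norm_nonneg u, norm_nonneg v]

theorem norm_lin_comb_le {c d u v : ℂ} {K : ℝ} (hc : ‖c‖ ≤ K) (hd : ‖d‖ ≤ K) :
    ‖c * u + d * v‖ ≤ K * (‖u‖ + ‖v‖) := by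
  refine (norm_add_le _ _).trans ?_
  rw [norm_mul, norm_mul]
  nlinarith [mul_le_mul_of_nonneg_right hc (norm_nonneg u),
    mul_le_mul_of_nonneg_right hd (norm_nonneg v)]

/-- The constant controlling the gauge transformed Lax pair. -/
noncomputable def gaugeBound (M : ℝ) : ℝ := 2 * (2 * M + 2 * M ^ 2 + M ^ 3)

theorem gaugeBound_nonneg {M : ℝ} (hM : 0 ≤ M) : 0 ≤ gaugeBound M := by
  unfold gaugeBound; positivity

section

variable {lam L T M : ℝ} {q qx qxx qt qxt : ℝ → ℝ → ℂ} {ψ : ℂ → ℝ → ℝ → Mat}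

theorem IsFundamental.muCol_hasDerivWithinAt_x (hψ : IsFundamental lam L T q qx ψ) (x₀ t₀ : ℝ)
    {x t : ℝ} (hx : x ∈ Set.Icc 0 L) (ht : t ∈ Set.Icc 0 T) (k : ℂ) :
    HasDerivWithinAt (fun y => muCol ψ x₀ t₀ y t 0 k)
      (-(2 * Complex.I * k) * muCol ψ x₀ t₀ x t 0 k + q x t * muCol ψ x₀ t₀ x t 1 k)
      (Set.Icc 0 L) x ∧
    HasDerivWithinAt (fun y => muCol ψ x₀ t₀ y t 1 k)
      (lam * conj (q x t) * muCol ψ x₀ t₀ x t 0 k) (Set.Icc 0 L) x := by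
  have h := hasDerivWithinAt_mat.1 ((hψ.lax k).lax_x x hx t ht)
  have hθ : HasDerivWithinAt
      (fun y : ℝ => Complex.exp (-(Complex.I * (theta y t k - theta x₀ t₀ k))))
      (Complex.exp (-(Complex.I * (theta x t k - theta x₀ t₀ k))) * (-(Complex.I * k)))
      (Set.Icc 0 L) x :=
    (((theta_hasDerivWithinAt_x x t k _).sub_const _).const_mul Complex.I).neg.cexp
  have hi := fun i => ((((h i 1).mul_const (ψ k x₀ t₀ 0 0)).fun_sub
    ((h i 0).mul_const (ψ k x₀ t₀ 0 1))).fun_mul hθ)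
  constructor
  · refine (hi 0).congr_deriv ?_
    simp [muCol, laxU, Matrix.mul_apply, Fin.sum_univ_two]
    ring
  · refine (hi 1).congr_deriv ?_
    simp [muCol, laxU, Matrix.mul_apply, Fin.sum_univ_two]
    ring

theorem IsFundamental.muCol_hasDerivWithinAt_t (hψ : IsFundamental lam L T q qx ψ) (x₀ t₀ : ℝ)
    {x t : ℝ} (hx : x ∈ Set.Icc 0 L) (ht : t ∈ Set.Icc 0 T) (k : ℂ) :
    HasDerivWithinAt (fun s => muCol ψ x₀ t₀ x s 0 k)
      ((-(4 * Complex.I * k ^ 2) - Complex.I * lam * (q x t * conj (q x t)))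
          * muCol ψ x₀ t₀ x t 0 k
        + (2 * k * q x t + Complex.I * qx x t) * muCol ψ x₀ t₀ x t 1 k) (Set.Icc 0 T) t ∧
    HasDerivWithinAt (fun s => muCol ψ x₀ t₀ x s 1 k)
      (lam * (2 * k * conj (q x t) - Complex.I * conj (qx x t)) * muCol ψ x₀ t₀ x t 0 k
        + Complex.I * lam * (q x t * conj (q x t)) * muCol ψ x₀ t₀ x t 1 k) (Set.Icc 0 T) t := by
  have h := hasDerivWithinAt_mat.1 ((hψ.lax k).lax_t x hx t ht)
  have hθ : HasDerivWithinAt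
      (fun s : ℝ => Complex.exp (-(Complex.I * (theta x s k - theta x₀ t₀ k))))
      (Complex.exp (-(Complex.I * (theta x t k - theta x₀ t₀ k))) * (-(Complex.I * (2 * k ^ 2))))
      (Set.Icc 0 T) t :=
    (((theta_hasDerivWithinAt_t x t k _).sub_const _).const_mul Complex.I).neg.cexp
  have hi := fun i => ((((h i 1).mul_const (ψ k x₀ t₀ 0 0)).fun_sub
    ((h i 0).mul_const (ψ k x₀ t₀ 0 1))).fun_mul hθ)
  constructor
  · refine (hi 0).congr_deriv ?_
    simp [muCol, laxV, Matrix.mul_apply, Fin.sum_univ_two]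
    ring
  · refine (hi 1).congr_deriv ?_
    simp [muCol, laxV, Matrix.mul_apply, Fin.sum_univ_two]
    ring

/-- The gauge transformed second column. -/
noncomputable def nuCol (lam : ℝ) (q qx : ℝ → ℝ → ℂ) (ψ : ℂ → ℝ → ℝ → Mat) (k : ℂ)
    (x₀ t₀ x t : ℝ) : ℂ × ℂ :=
  (muCol ψ x₀ t₀ x t 0 k - gaugeN (q x t) (qx x t) k * muCol ψ x₀ t₀ x t 1 k,
    muCol ψ x₀ t₀ x t 1 k - gaugeP lam (q x t) (qx x t) k * muCol ψ x₀ t₀ x t 0 k)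

/-- The leading term of -2ik n cancels the coupling q, and that of 2ik p cancels lam q̄, where n and
p are the entries of the gauge. What is left is O(1/k), so the pair is weakly coupled. -/
theorem IsFundamental.nuCol_x (hlam : |lam| = 1) (hM : 0 ≤ M)
    (h : IsJet lam L T M q qx qxx qt qxt) (hψ : IsFundamental lam L T q qx ψ) (x₀ t₀ : ℝ)
    {t : ℝ} (ht : t ∈ Set.Icc 0 T) {k : ℂ} (hk : 1 ≤ ‖k‖) (hkM : M * ‖k‖⁻¹ ≤ 1 / 2) :
    ∃ f₀ f₁ : ℝ → ℂ, (∀ x ∈ Set.Icc 0 L,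
      HasDerivWithinAt (fun y => (nuCol lam q qx ψ k x₀ t₀ y t).1)
        (-(2 * Complex.I * k) * (nuCol lam q qx ψ k x₀ t₀ x t).1 + f₀ x) (Set.Icc 0 L) x) ∧
      (∀ x ∈ Set.Icc 0 L,
      HasDerivWithinAt (fun y => (nuCol lam q qx ψ k x₀ t₀ y t).2) (f₁ x) (Set.Icc 0 L) x) ∧
      ∀ x ∈ Set.Icc 0 L,
        ‖f₀ x‖ ≤ gaugeBound M * ‖k‖⁻¹ * (‖(nuCol lam q qx ψ k x₀ t₀ x t).1‖
          + ‖(nuCol lam q qx ψ k x₀ t₀ x t).2‖) ∧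
        ‖f₁ x‖ ≤ gaugeBound M * ‖k‖⁻¹ * (‖(nuCol lam q qx ψ k x₀ t₀ x t).1‖
          + ‖(nuCol lam q qx ψ k x₀ t₀ x t).2‖) := by
  have hk0 : k ≠ 0 := by rintro rfl; simp at hk; linarith
  refine ⟨fun x => (-(gaugeN (q x t) (qx x t) k * (lam * conj (q x t)))) * muCol ψ x₀ t₀ x t 0 k
      + (-(Complex.I * qx x t / (2 * k)) - gaugeN (qx x t) (qxx x t) k) * muCol ψ x₀ t₀ x t 1 k,
    fun x => (lam * (Complex.I * conj (qx x t) / (2 * k)) - gaugeP lam (qx x t) (qxx x t) k)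
        * muCol ψ x₀ t₀ x t 0 k
      + (-(gaugeP lam (q x t) (qx x t) k * q x t)) * muCol ψ x₀ t₀ x t 1 k,
    fun x hx => ?_, fun x hx => ?_, fun x hx => ?_⟩
  · obtain ⟨h0, h1⟩ := hψ.muCol_hasDerivWithinAt_x x₀ t₀ hx ht k
    have hn := gaugeN_hasDerivWithinAt k (h.hasDerivAt_x x t ht).hasDerivWithinAt
      (h.hasDerivAt_xx x t ht).hasDerivWithinAt (S := Set.Icc 0 L)
    refine (h0.fun_sub (hn.fun_mul h1)).congr_deriv ?_
    simp only [nuCol, gaugeN]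
    field_simp
    ring_nf
  · obtain ⟨h0, h1⟩ := hψ.muCol_hasDerivWithinAt_x x₀ t₀ hx ht k
    have hn := gaugeP_hasDerivWithinAt lam k (h.hasDerivAt_x x t ht).hasDerivWithinAt
      (h.hasDerivAt_xx x t ht).hasDerivWithinAt (S := Set.Icc 0 L)
    refine (h1.fun_sub (hn.fun_mul h0)).congr_deriv ?_
    simp only [gaugeP_eq]
    field_simp
    ring
  · obtain ⟨b0, b1, b2, b3, b4⟩ := h.bound x hx t ht
    have hδ0 : 0 ≤ ‖k‖⁻¹ := by positivity
    have n1 := norm_gaugeN_le b0 b1 hk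
    have n2 := norm_gaugeN_le b1 b2 hk
    have p1 := norm_gaugeP_le hlam b0 b1 hk
    have p2 := norm_gaugeP_le hlam b1 b2 hk
    have hs := sum_norm_le_of_gauge (u := muCol ψ x₀ t₀ x t 0 k) (v := muCol ψ x₀ t₀ x t 1 k)
      (n1.trans hkM) (p1.trans hkM)
    set δ := ‖k‖⁻¹ with hδ
    have hlq : ‖(lam : ℂ) * conj (q x t)‖ ≤ M := by
      rw [norm_mul, Complex.norm_real, Real.norm_eq_abs, hlam, one_mul, RCLike.norm_conj]; exact b0
    have hI : ‖Complex.I * qx x t / (2 * k)‖ ≤ M * δ := by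
      rw [norm_div, norm_mul, norm_mul, Complex.norm_I, one_mul, div_eq_mul_inv, mul_inv, ← hδ]
      norm_num
      nlinarith [mul_le_mul_of_nonneg_right b1 hδ0, mul_nonneg hM hδ0]
    have hI' : ‖(lam : ℂ) * (Complex.I * conj (qx x t) / (2 * k))‖ ≤ M * δ := by
      rw [norm_mul, Complex.norm_real, Real.norm_eq_abs, hlam, one_mul,
        norm_div, norm_mul, norm_mul, Complex.norm_I, one_mul, div_eq_mul_inv, mul_inv, ← hδ,
        RCLike.norm_conj]
      norm_num
      nlinarith [mul_le_mul_of_nonneg_right b1 hδ0, mul_nonneg hM hδ0]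
    have hMδ := mul_nonneg hM hδ0
    have c1 : M * δ * M ≤ gaugeBound M / 2 * δ := by
      unfold gaugeBound
      nlinarith [mul_nonneg hMδ hM, mul_nonneg (mul_nonneg hMδ hM) hM]
    have c2 : M * δ + M * δ ≤ gaugeBound M / 2 * δ := by
      unfold gaugeBound
      nlinarith [mul_nonneg hMδ hM, mul_nonneg (mul_nonneg hMδ hM) hM]
    have hC := mul_nonneg (gaugeBound_nonneg hM) hδ0
    constructor
    · refine (norm_lin_comb_le (K := gaugeBound M / 2 * δ) ?_ ?_).trans ?_
      · rw [norm_neg, norm_mul]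
        exact (mul_le_mul n1 hlq (norm_nonneg _) (by positivity)).trans c1
      · refine (norm_sub_le _ _).trans ?_
        rw [norm_neg]
        linarith
      · simp only [nuCol]
        nlinarith [mul_le_mul_of_nonneg_left hs hC]
    · refine (norm_lin_comb_le (K := gaugeBound M / 2 * δ) ?_ ?_).trans ?_
      · refine (norm_sub_le _ _).trans ?_
        linarith
      · rw [norm_neg, norm_mul]
        exact (mul_le_mul p1 b0 (norm_nonneg _) (by positivity)).trans c1
      · simp only [nuCol]
        nlinarith [mul_le_mul_of_nonneg_left hs hC]

/-- This equation dictates both terms of `gaugeN`: -4ik² n cancels 2kq + iq_x exactly, and the order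
zero part of -2k lam q̄ n cancels -i lam |q|². The lower row works the same way, and an O(1/k)
coupling remains. -/
theorem IsFundamental.nuCol_t (hlam : |lam| = 1) (hM : 0 ≤ M)
    (h : IsJet lam L T M q qx qxx qt qxt) (hψ : IsFundamental lam L T q qx ψ) (x₀ t₀ : ℝ)
    {x : ℝ} (hx : x ∈ Set.Icc 0 L) {k : ℂ} (hk : 1 ≤ ‖k‖) (hkM : M * ‖k‖⁻¹ ≤ 1 / 2) :
    ∃ f₀ f₁ : ℝ → ℂ, (∀ t ∈ Set.Icc 0 T,
      HasDerivWithinAt (fun s => (nuCol lam q qx ψ k x₀ t₀ x s).1)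
        (-(4 * Complex.I * k ^ 2) * (nuCol lam q qx ψ k x₀ t₀ x t).1 + f₀ t) (Set.Icc 0 T) t) ∧
      (∀ t ∈ Set.Icc 0 T,
      HasDerivWithinAt (fun s => (nuCol lam q qx ψ k x₀ t₀ x s).2) (f₁ t) (Set.Icc 0 T) t) ∧
      ∀ t ∈ Set.Icc 0 T,
        ‖f₀ t‖ ≤ gaugeBound M * ‖k‖⁻¹ * (‖(nuCol lam q qx ψ k x₀ t₀ x t).1‖
          + ‖(nuCol lam q qx ψ k x₀ t₀ x t).2‖) ∧
        ‖f₁ t‖ ≤ gaugeBound M * ‖k‖⁻¹ * (‖(nuCol lam q qx ψ k x₀ t₀ x t).1‖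
          + ‖(nuCol lam q qx ψ k x₀ t₀ x t).2‖) := by
  have hk0 : k ≠ 0 := by rintro rfl; simp at hk; linarith
  have hI2 := Complex.I_sq
  refine ⟨fun t => (lam * (q x t * conj (qx x t) / (2 * k) - qx x t * conj (q x t) / (2 * k)
        + Complex.I * (qx x t * conj (qx x t)) / (4 * k ^ 2))) * muCol ψ x₀ t₀ x t 0 k
      + (-gaugeN (qt x t) (qxt x t) k - Complex.I * lam * (q x t * conj (q x t))
        * gaugeN (q x t) (qx x t) k) * muCol ψ x₀ t₀ x t 1 k,
    fun t => (Complex.I * lam * (q x t * conj (q x t)) * gaugeP lam (q x t) (qx x t) k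
        - gaugeP lam (qt x t) (qxt x t) k) * muCol ψ x₀ t₀ x t 0 k
      + (-(lam * (q x t * conj (qx x t) / (2 * k) - qx x t * conj (q x t) / (2 * k)
        + Complex.I * (qx x t * conj (qx x t)) / (4 * k ^ 2)))) * muCol ψ x₀ t₀ x t 1 k,
    fun t ht => ?_, fun t ht => ?_, fun t ht => ?_⟩
  · obtain ⟨h0, h1⟩ := hψ.muCol_hasDerivWithinAt_t x₀ t₀ hx ht k
    have hn := gaugeN_hasDerivWithinAt k (h.hasDerivWithinAt_t x t ht)
      (h.hasDerivWithinAt_xt x t ht)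
    refine (h0.fun_sub (hn.fun_mul h1)).congr_deriv ?_
    simp only [nuCol, gaugeN]
    field_simp
    ring_nf
    simp only [hI2]
    ring
  · obtain ⟨h0, h1⟩ := hψ.muCol_hasDerivWithinAt_t x₀ t₀ hx ht k
    have hn := gaugeP_hasDerivWithinAt lam k (h.hasDerivWithinAt_t x t ht)
      (h.hasDerivWithinAt_xt x t ht)
    refine (h1.fun_sub (hn.fun_mul h0)).congr_deriv ?_
    simp only [gaugeP_eq]
    field_simp
    ring_nf
    simp only [hI2]
    ring
  · obtain ⟨b0, b1, b2, b3, b4⟩ := h.bound x hx t ht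
    have hδ0 : 0 ≤ ‖k‖⁻¹ := by positivity
    have hδ1 : ‖k‖⁻¹ ≤ 1 := inv_le_one_of_one_le₀ hk
    have n1 := norm_gaugeN_le b0 b1 hk
    have n2 := norm_gaugeN_le b3 b4 hk
    have p1 := norm_gaugeP_le hlam b0 b1 hk
    have p2 := norm_gaugeP_le hlam b3 b4 hk
    have hs := sum_norm_le_of_gauge (u := muCol ψ x₀ t₀ x t 0 k) (v := muCol ψ x₀ t₀ x t 1 k)
      (n1.trans hkM) (p1.trans hkM)
    set δ := ‖k‖⁻¹ with hδ
    have hMδ := mul_nonneg hM hδ0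
    have hqq : ‖Complex.I * lam * (q x t * conj (q x t))‖ ≤ M * M := by
      rw [norm_mul, norm_mul, norm_mul, Complex.norm_real, Real.norm_eq_abs, hlam, Complex.norm_I,
        RCLike.norm_conj, one_mul, one_mul]
      exact mul_le_mul b0 b0 (norm_nonneg _) hM
    have hprod : ∀ α β : ℂ, ‖α‖ ≤ M → ‖β‖ ≤ M → ‖α * conj β / (2 * k)‖ ≤ M * M / 2 * δ := by
      intro α β hα hβ
      rw [norm_div, norm_mul, norm_mul, RCLike.norm_conj, div_eq_mul_inv, mul_inv, ← hδ]
      have := mul_le_mul hα hβ (norm_nonneg _) hM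
      norm_num
      nlinarith [mul_le_mul_of_nonneg_right this hδ0]
    have hlast : ‖Complex.I * (qx x t * conj (qx x t)) / (4 * k ^ 2)‖ ≤ M * M / 4 * δ := by
      rw [norm_div, norm_mul, norm_mul, norm_mul, norm_pow, RCLike.norm_conj, Complex.norm_I,
        one_mul, div_eq_mul_inv, mul_inv, ← inv_pow, ← hδ]
      have h1 := mul_le_mul b1 b1 (norm_nonneg _) hM
      have h2 : δ ^ 2 ≤ δ := by rw [pow_two]; exact mul_le_of_le_one_left hδ0 hδ1
      have h3 := mul_le_mul h1 h2 (by positivity) (by positivity)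
      norm_num
      nlinarith
    have c0 : ‖(lam : ℂ) * (q x t * conj (qx x t) / (2 * k) - qx x t * conj (q x t) / (2 * k)
        + Complex.I * (qx x t * conj (qx x t)) / (4 * k ^ 2))‖ ≤ gaugeBound M / 2 * δ := by
      rw [norm_mul, Complex.norm_real, Real.norm_eq_abs, hlam, one_mul]
      refine (norm_add_le _ _).trans ((add_le_add (norm_sub_le _ _) hlast).trans ?_)
      have := hprod _ _ b0 b1
      have := hprod _ _ b1 b0
      unfold gaugeBound
      nlinarith [mul_nonneg hMδ hM, mul_nonneg (mul_nonneg hMδ hM) hM]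
    have c2 : M * δ + M * M * (M * δ) ≤ gaugeBound M / 2 * δ := by
      unfold gaugeBound
      nlinarith [mul_nonneg hMδ hM, mul_nonneg (mul_nonneg hMδ hM) hM]
    have hC := mul_nonneg (gaugeBound_nonneg hM) hδ0
    constructor
    · refine (norm_lin_comb_le (K := gaugeBound M / 2 * δ) c0 ?_).trans ?_
      · refine (norm_sub_le _ _).trans ?_
        rw [norm_neg, norm_mul]
        have := mul_le_mul hqq n1 (norm_nonneg _) (by positivity)
        linarith
      · simp only [nuCol]
        nlinarith [mul_le_mul_of_nonneg_left hs hC]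
    · refine (norm_lin_comb_le (K := gaugeBound M / 2 * δ) ?_ (by rwa [norm_neg])).trans ?_
      · refine (norm_sub_le _ _).trans ?_
        rw [norm_mul]
        have := mul_le_mul hqq p1 (norm_nonneg _) (by positivity)
        linarith
      · simp only [nuCol]
        nlinarith [mul_le_mul_of_nonneg_left hs hC]

end

end

/-! ### Expansion of the columns by transport in x and then in t -/

section

variable {lam L T M : ℝ} {q qx qxx qt qxt : ℝ → ℝ → ℂ} {ψ : ℂ → ℝ → ℝ → Mat}

theorem IsFundamental.muCol_self (hT : 0 ≤ T) (hψ : IsFundamental lam L T q qx ψ) {x t : ℝ}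
    (hx : x ∈ Set.Icc 0 L) (ht : t ∈ Set.Icc 0 T) (k : ℂ) :
    muCol ψ x t x t 0 k = 0 ∧ muCol ψ x t x t 1 k = 1 := by
  have hd := hψ.det hT hx ht k
  simp only [muCol, sub_self, mul_zero, neg_zero, Complex.exp_zero, mul_one]
  constructor
  · ring
  · linear_combination hd

theorem norm_exp_neg_le {z : ℂ} (hz : 0 ≤ z.re) : ‖Complex.exp (-z)‖ ≤ 1 := by
  rw [Complex.norm_exp, Complex.neg_re]
  exact Real.exp_le_one_iff.2 (by linarith)

theorem norm_exp_neg_le_inv {z : ℂ} {ρ : ℝ} (hρ : 0 < ρ) (hz : ρ ≤ z.re) :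
    ‖Complex.exp (-z)‖ ≤ ρ⁻¹ := by
  rw [Complex.norm_exp, Complex.neg_re, Real.exp_neg]
  have := Real.add_one_le_exp z.re
  exact inv_anti₀ hρ (by linarith)

/-- Transport along (x₀,t₀) → (x,t₀) → (x,t). The initial value is (-n, 1) with n = O(1/k), and each
leg adds O(1/k). If the exponents are at least ρ, the last nontrivial leg damps its initial value by
e^{-ρ} ≤ 1/ρ, and its Duhamel term is also smaller by 1/ρ. This needs at least one nontrivial leg,
hence (x,t) ≠ (x₀,t₀). -/
theorem IsFundamental.nuCol_asymptotics (hlam : |lam| = 1) (hL : 0 ≤ L) (hT : 0 ≤ T) (hM : 0 ≤ M)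
    (h : IsJet lam L T M q qx qxx qt qxt) (hψ : IsFundamental lam L T q qx ψ) :
    ∃ C : ℝ, 1 ≤ C ∧ 2 * M ≤ C ∧ ∀ x₀ ∈ Set.Icc 0 L, ∀ t₀ ∈ Set.Icc 0 T, ∀ x ∈ Set.Icc 0 L,
      ∀ t ∈ Set.Icc 0 T, ∀ k : ℂ, C ≤ ‖k‖ →
      0 ≤ (2 * Complex.I * k * (x - x₀ : ℝ)).re → 0 ≤ (4 * Complex.I * k ^ 2 * (t - t₀ : ℝ)).re →
      ‖(nuCol lam q qx ψ k x₀ t₀ x t).1‖ ≤ C * ‖k‖⁻¹ ∧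
      ‖(nuCol lam q qx ψ k x₀ t₀ x t).2 - 1‖ ≤ C * ‖k‖⁻¹ ∧
      ∀ ρ : ℝ, 0 < ρ → (x, t) ≠ (x₀, t₀) →
        (x ≠ x₀ → ρ ≤ (2 * Complex.I * k * (x - x₀ : ℝ)).re) →
        (t ≠ t₀ → ρ ≤ (4 * Complex.I * k ^ 2 * (t - t₀ : ℝ)).re) →
        ‖(nuCol lam q qx ψ k x₀ t₀ x t).1‖ ≤ C * ρ⁻¹ * ‖k‖⁻¹ := by
  set ℓ := L + T with hℓ
  have hℓ0 : 0 ≤ ℓ := by positivity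
  have hG := gaugeBound_nonneg hM
  set D := 12 * (gaugeBound M * ℓ) with hD
  have hD0 : 0 ≤ D := by positivity
  refine ⟨1 + 2 * M + 4 * D, by linarith, by linarith, ?_⟩
  intro x₀ hx₀ t₀ ht₀ x hx t ht k hCk hκ₁ hκ₂
  have hk : 1 ≤ ‖k‖ := by linarith
  have hk0 : 0 < ‖k‖ := by linarith
  set δ := ‖k‖⁻¹ with hδ
  have hδ0 : 0 ≤ δ := by positivity
  have hCδ : (1 + 2 * M + 4 * D) * δ ≤ 1 := by
    rw [hδ, ← div_eq_mul_inv]; exact (div_le_one hk0).2 hCk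
  have hkM : M * δ ≤ 1 / 2 := by nlinarith [mul_nonneg hD0 hδ0]
  have hDδ : 4 * D * δ + M * δ ≤ 1 := by nlinarith [mul_nonneg hM hδ0]
  have hε0 : 0 ≤ gaugeBound M * δ := by positivity
  have hεL : gaugeBound M * δ * L ≤ 1 := by
    have : gaugeBound M * δ * L ≤ D * δ := by
      rw [hD, hℓ]; nlinarith [mul_nonneg hε0 hL, mul_nonneg hε0 hT]
    nlinarith [mul_nonneg hM hδ0, mul_nonneg hD0 hδ0]
  have hεT : gaugeBound M * δ * T ≤ 1 := by
    have : gaugeBound M * δ * T ≤ D * δ := by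
      rw [hD, hℓ]; nlinarith [mul_nonneg hε0 hL, mul_nonneg hε0 hT]
    nlinarith [mul_nonneg hM hδ0, mul_nonneg hD0 hδ0]
  have hL' : 12 * (gaugeBound M * δ * L) ≤ D * δ := by
    rw [hD, hℓ]; nlinarith [mul_nonneg hε0 hL, mul_nonneg hε0 hT]
  have hT' : 12 * (gaugeBound M * δ * T) ≤ D * δ := by
    rw [hD, hℓ]; nlinarith [mul_nonneg hε0 hL, mul_nonneg hε0 hT]
  obtain ⟨f₀, f₁, hf₀, hf₁, hf⟩ := hψ.nuCol_x hlam hM h x₀ t₀ ht₀ hk hkM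
  obtain ⟨g₀, g₁, hg₀, hg₁, hg⟩ := hψ.nuCol_t hlam hM h x₀ t₀ hx hk hkM
  obtain ⟨a1, a2, a3⟩ := weaklyCoupled_transport hx₀ hx hκ₁ hε0 hεL hf₀ hf₁ hf
  obtain ⟨b1, b2, b3⟩ := weaklyCoupled_transport ht₀ ht hκ₂ hε0 hεT hg₀ hg₁ hg
  obtain ⟨m0, m1⟩ := hψ.muCol_self hT hx₀ ht₀ k
  have e0 : ‖(nuCol lam q qx ψ k x₀ t₀ x₀ t₀).1‖ ≤ M * δ := by
    simp only [nuCol, m0, m1, mul_one, zero_sub, norm_neg]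
    exact norm_gaugeN_le (h.bound x₀ hx₀ t₀ ht₀).1 (h.bound x₀ hx₀ t₀ ht₀).2.1 hk
  have e1 : (nuCol lam q qx ψ k x₀ t₀ x₀ t₀).2 = 1 := by simp [nuCol, m0, m1]
  have e1n : ‖(nuCol lam q qx ψ k x₀ t₀ x₀ t₀).2‖ = 1 := by rw [e1, norm_one]
  rw [e1] at a3
  set α := (nuCol lam q qx ψ k x₀ t₀ x₀ t₀).1
  set β := nuCol lam q qx ψ k x₀ t₀ x t₀
  set γ := nuCol lam q qx ψ k x₀ t₀ x t
  set κ₁ := 2 * Complex.I * k * (x - x₀ : ℝ)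
  set κ₂ := 4 * Complex.I * k ^ 2 * (t - t₀ : ℝ)
  have hN1 : 12 * (gaugeBound M * δ * L) *
      (‖α‖ + ‖(nuCol lam q qx ψ k x₀ t₀ x₀ t₀).2‖) ≤ 2 * D * δ := by
    rw [e1n]
    have : ‖α‖ + 1 ≤ 2 := by linarith
    have := mul_le_mul hL' this (by positivity) (by positivity)
    linarith
  have a1' := a1.trans hN1
  have a2' := a2.trans hN1
  have a3' := a3.trans (by simpa [norm_one, e1n] using hN1)
  have hE₁ := norm_exp_neg_le hκ₁
  have hE₂ := norm_exp_neg_le hκ₂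
  have tri : ∀ z w e : ℂ, ‖z‖ ≤ ‖z - e * w‖ + ‖e‖ * ‖w‖ := fun z w e => by
    rw [← norm_mul]; exact norm_le_norm_sub_add z (e * w)
  have hβ0 : ‖β.1‖ ≤ (M + 2 * D) * δ := by
    have := tri β.1 α (Complex.exp (-κ₁))
    have := mul_le_of_le_one_left (norm_nonneg α) hE₁
    linarith
  have hβ1 : ‖β.2‖ ≤ 1 + 2 * D * δ := by
    have := norm_le_norm_sub_add β.2 1
    rw [norm_one] at this
    linarith
  have hN2 : 12 * (gaugeBound M * δ * T) * (‖β.1‖ + ‖β.2‖) ≤ 2 * D * δ := by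
    have : ‖β.1‖ + ‖β.2‖ ≤ 2 := by linarith
    have := mul_le_mul hT' this (by positivity) (by positivity)
    linarith
  have b1' := b1.trans hN2
  have b2' := b2.trans hN2
  have b3' := b3.trans hN2
  have hMδ := mul_nonneg hM hδ0
  have hDδ0 := mul_nonneg hD0 hδ0
  refine ⟨?_, ?_, fun ρ hρ hne hρ₁ hρ₂ => ?_⟩
  · have := tri γ.1 β.1 (Complex.exp (-κ₂))
    have := mul_le_of_le_one_left (norm_nonneg β.1) hE₂
    linarith
  · have := norm_sub_le_norm_sub_add_norm_sub γ.2 β.2 1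
    linarith
  · have key : ∀ (z w κ : ℂ) (c : ℝ), ρ ≤ κ.re → 0 ≤ c → ‖w‖ ≤ c →
        κ.re * ‖z - Complex.exp (-κ) * w‖ ≤ 2 * D * δ → ‖z‖ ≤ (c + 2 * D * δ) * ρ⁻¹ := by
      intro z w κ c hκ hc hw hz
      have h1 := tri z w (Complex.exp (-κ))
      have h2 := norm_exp_neg_le_inv hρ hκ
      have h3 : ‖Complex.exp (-κ)‖ * ‖w‖ ≤ ρ⁻¹ * c :=
        mul_le_mul h2 hw (norm_nonneg _) (by positivity)
      have h4 : ‖z - Complex.exp (-κ) * w‖ ≤ 2 * D * δ * ρ⁻¹ := by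
        rw [← div_eq_mul_inv, le_div_iff₀ hρ, mul_comm]
        exact le_trans (mul_le_mul_of_nonneg_right hκ (norm_nonneg _)) hz
      linarith
    have hρ0 : 0 ≤ ρ⁻¹ := by positivity
    -- The damped leg is the one in t if it is nontrivial, and the one in x otherwise.
    by_cases htt : t = t₀
    · have hxx : x ≠ x₀ := fun hxx => hne (by rw [hxx, htt])
      have hγ : γ = β := by simp only [γ, β, htt]
      rw [hγ]
      refine (key _ _ _ _ (hρ₁ hxx) hMδ e0 a2').trans ?_
      linarith [mul_nonneg hMδ hρ0, mul_nonneg hDδ0 hρ0, mul_nonneg hδ0 hρ0]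
    · refine (key _ _ _ _ (hρ₂ htt) (by positivity) hβ0 b2').trans ?_
      linarith [mul_nonneg hMδ hρ0, mul_nonneg hDδ0 hρ0, mul_nonneg hδ0 hρ0]

/-- Large `k` behaviour of the second column of an eigenfunction. -/
theorem IsFundamental.muCol_asymptotics (hlam : |lam| = 1) (hL : 0 ≤ L) (hT : 0 ≤ T) (hM : 0 ≤ M)
    (h : IsJet lam L T M q qx qxx qt qxt) (hψ : IsFundamental lam L T q qx ψ) :
    ∃ C : ℝ, 1 ≤ C ∧ ∀ x₀ ∈ Set.Icc 0 L, ∀ t₀ ∈ Set.Icc 0 T, ∀ x ∈ Set.Icc 0 L,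
      ∀ t ∈ Set.Icc 0 T, ∀ k : ℂ, C ≤ ‖k‖ →
      0 ≤ (2 * Complex.I * k * (x - x₀ : ℝ)).re → 0 ≤ (4 * Complex.I * k ^ 2 * (t - t₀ : ℝ)).re →
      ‖muCol ψ x₀ t₀ x t 0 k‖ ≤ C * ‖k‖⁻¹ ∧
      ‖muCol ψ x₀ t₀ x t 1 k - 1‖ ≤ C * ‖k‖⁻¹ ∧
      ∀ ρ : ℝ, 0 < ρ → (x, t) ≠ (x₀, t₀) →
        (x ≠ x₀ → ρ ≤ (2 * Complex.I * k * (x - x₀ : ℝ)).re) →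
        (t ≠ t₀ → ρ ≤ (4 * Complex.I * k ^ 2 * (t - t₀ : ℝ)).re) →
        ‖2 * Complex.I * (k * muCol ψ x₀ t₀ x t 0 k) - q x t‖ ≤ C * ρ⁻¹ + C * ‖k‖⁻¹ := by
  obtain ⟨C, hC1, hCM, hC⟩ := hψ.nuCol_asymptotics hlam hL hT hM h
  have hC0 : 0 ≤ C := by linarith
  refine ⟨10 * (1 + M) * C + 10 * M * (1 + M), by nlinarith, ?_⟩
  intro x₀ hx₀ t₀ ht₀ x hx t ht k hCk hκ₁ hκ₂
  have hCk' : C ≤ ‖k‖ := by nlinarith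
  obtain ⟨c1, c2, c3⟩ := hC x₀ hx₀ t₀ ht₀ x hx t ht k hCk' hκ₁ hκ₂
  have hk : 1 ≤ ‖k‖ := hC1.trans hCk'
  have hk0 : 0 < ‖k‖ := by linarith
  have hkne : k ≠ 0 := norm_pos_iff.1 hk0
  obtain ⟨q1, q2, -⟩ := h.bound x hx t ht
  have n1 := norm_gaugeN_le q1 q2 hk
  have p1 := norm_gaugeP_le hlam q1 q2 hk
  set δ := ‖k‖⁻¹ with hδ
  have hδ0 : 0 ≤ δ := by positivity
  have hCδ : C * δ ≤ 1 := by
    rw [hδ, ← div_eq_mul_inv]; exact (div_le_one hk0).2 hCk'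
  have hMδ : M * δ ≤ 1 / 2 := by nlinarith
  have hs := sum_norm_le_of_gauge (u := muCol ψ x₀ t₀ x t 0 k) (v := muCol ψ x₀ t₀ x t 1 k)
    (n1.trans hMδ) (p1.trans hMδ)
  simp only [nuCol] at c1 c2 c3
  set u := muCol ψ x₀ t₀ x t 0 k
  set v := muCol ψ x₀ t₀ x t 1 k
  set n := gaugeN (q x t) (qx x t) k with hn
  set p := gaugeP lam (q x t) (qx x t) k
  have hν1 : ‖v - p * u‖ ≤ 2 := by
    have := norm_le_norm_sub_add (v - p * u) 1
    rw [norm_one] at this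
    linarith
  have huv : ‖u‖ + ‖v‖ ≤ 6 := by linarith
  have hu6 : ‖u‖ ≤ 6 := by linarith [norm_nonneg v]
  have hv6 : ‖v‖ ≤ 6 := by linarith [norm_nonneg u]
  have hMδ0 := mul_nonneg hM hδ0
  have hCδ0 := mul_nonneg hC0 hδ0
  have hu : ‖u‖ ≤ (C + 6 * M) * δ := by
    have h1 := norm_le_norm_sub_add u (n * v)
    rw [norm_mul] at h1
    have := mul_le_mul n1 hv6 (norm_nonneg _) hMδ0
    linarith
  have hv : ‖v - 1‖ ≤ (C + 6 * M) * δ := by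
    have h1 : v - 1 = (v - p * u - 1) + p * u := by ring
    rw [h1]
    refine (norm_add_le _ _).trans ?_
    rw [norm_mul]
    have := mul_le_mul p1 hu6 (norm_nonneg _) hMδ0
    linarith
  refine ⟨hu.trans ?_, hv.trans ?_, fun ρ hρ hne hρ₁ hρ₂ => ?_⟩
  · nlinarith [mul_nonneg hMδ0 hC0, mul_nonneg hMδ0 hM]
  · nlinarith [mul_nonneg hMδ0 hC0, mul_nonneg hMδ0 hM]
  · have d := c3 ρ hρ hne hρ₁ hρ₂
    -- Since 2ik n = q + i q_x/(2k), the gauge term n v carries the limit q; what remains is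
    -- controlled by the damped component u - n v, by v - 1 and by 1/k.
    have e : 2 * Complex.I * (k * u) - q x t = 2 * Complex.I * k * (u - n * v)
        + q x t * (v - 1) + (Complex.I * qx x t * k⁻¹ / 2) * v := by
      rw [hn, gaugeN]
      field_simp
      ring_nf
    rw [e]
    have t1 : ‖2 * Complex.I * k * (u - n * v)‖ ≤ 2 * C * ρ⁻¹ := by
      rw [norm_mul, norm_mul, norm_mul, Complex.norm_I]
      norm_num
      have := mul_le_mul_of_nonneg_left d hk0.le
      have h2 : ‖k‖ * (C * ρ⁻¹ * δ) = C * ρ⁻¹ := by rw [hδ]; field_simp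
      rw [h2] at this
      linarith
    have t2 : ‖q x t * (v - 1)‖ ≤ M * ((C + 6 * M) * δ) := by
      rw [norm_mul]
      exact mul_le_mul q1 hv (norm_nonneg _) hM
    have t3 : ‖(Complex.I * qx x t * k⁻¹ / 2) * v‖ ≤ 3 * M * δ := by
      rw [norm_mul, norm_div, norm_mul, norm_mul, Complex.norm_I, norm_inv, ← hδ]
      norm_num
      have h1 := mul_le_mul_of_nonneg_right q2 hδ0
      have := mul_le_mul h1 hv6 (norm_nonneg _) hMδ0
      linarith
    refine (norm_add₃_le).trans ?_
    have hρ0 : 0 ≤ ρ⁻¹ := by positivity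
    nlinarith [mul_nonneg hMδ0 hC0, mul_nonneg hMδ0 hM, mul_nonneg hC0 hρ0,
      mul_nonneg (mul_nonneg hM hC0) hρ0, mul_nonneg hM hρ0, mul_nonneg (mul_nonneg hM hM) hρ0]

end

/-! ### From eigenfunctions to the data of the Riemann-Hilbert problem -/

/-- The data of the Riemann-Hilbert problem: entire functions with the scattering relations and
their asymptotics at infinity in the four quadrants. -/
structure IsRHPData (lam L T x t : ℝ) (q₀ : ℂ) (a b A B : ℂ → ℂ) (c : Fin 4 → Fin 2 → ℂ → ℂ) :
    Prop extends IsScattering lam L x t a b A B (c 0) (c 1) (c 2) (c 3) where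
  sign : lam = 1 ∨ lam = -1
  diff_a : Differentiable ℂ a
  diff_b : Differentiable ℂ b
  diff_A : Differentiable ℂ A
  diff_B : Differentiable ℂ B
  diff_c : ∀ n i, Differentiable ℂ (c n i)
  asymp_A : (fun k => A k - 1) =O[Bornology.cobounded ℂ ⊓ 𝓟 (quadrant 0)] fun k => k⁻¹
  asymp_F : (fun k => specF lam L a b A B k - 1)
    =O[Bornology.cobounded ℂ ⊓ 𝓟 (quadrant 0)] fun k => k⁻¹
  asymp_H : (fun k => specH lam a b A B k - 1)
    =O[Bornology.cobounded ℂ ⊓ 𝓟 (quadrant 1)] fun k => k⁻¹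
  asymp_c : ∀ n i, (fun k => c n i k - (![0, 1] : Fin 2 → ℂ) i)
    =O[Bornology.cobounded ℂ ⊓ 𝓟 (quadrant n)] fun k => k⁻¹
  recovery : ∀ n, (x, t) ≠ corner L T n → ∀ ε : ℝ, 0 < ε →
    Tendsto (fun k => 2 * Complex.I * (k * c n 0 k))
      (Bornology.cobounded ℂ ⊓ 𝓟 (sector ε n)) (𝓝 q₀)

/-- This matches quadrants with corners: the sign of Im k selects x₀ = L or 0 and the sign of Re k ·
Im k selects t₀ = T or 0, so that both exponents have nonnegative real part on the whole rectangle.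
-/
theorem re_exponents {L T x t : ℝ} (hx : x ∈ Set.Icc 0 L) (ht : t ∈ Set.Icc 0 T) {n : Fin 4}
    {k : ℂ} (hk : k ∈ quadrant n) :
    (2 * Complex.I * k * (x - (corner L T n).1 : ℝ)).re = 2 * |k.im| * |x - (corner L T n).1| ∧
    (4 * Complex.I * k ^ 2 * (t - (corner L T n).2 : ℝ)).re
      = 8 * (|k.re| * |k.im|) * |t - (corner L T n).2| := by
  obtain ⟨h1, h2⟩ := hx
  obtain ⟨h3, h4⟩ := ht
  have e1 : ∀ s : ℝ, (2 * Complex.I * k * (s : ℂ)).re = -2 * k.im * s := fun s => by simp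
  have e2 : ∀ s : ℝ, (4 * Complex.I * k ^ 2 * (s : ℂ)).re = -8 * k.re * k.im * s := fun s => by
    simp [pow_two, -mul_eq_mul_right_iff]; ring
  rw [e1, e2]
  fin_cases n <;> simp [quadrant, corner] at hk ⊢ <;> obtain ⟨k1, k2⟩ := hk
  · rw [abs_of_pos k1, abs_of_pos k2, abs_of_nonpos (sub_nonpos.2 h2),
      abs_of_nonpos (sub_nonpos.2 h4)]
    constructor <;> ring
  · rw [abs_of_neg k1, abs_of_pos k2, abs_of_nonpos (sub_nonpos.2 h2), abs_of_nonneg h3]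
    constructor <;> ring
  · rw [abs_of_neg k1, abs_of_neg k2, abs_of_nonneg h1, abs_of_nonpos (sub_nonpos.2 h4)]
    constructor <;> ring
  · rw [abs_of_pos k1, abs_of_neg k2, abs_of_nonneg h1, abs_of_nonneg h3]
    constructor <;> ring

theorem tendsto_schwarz_cobounded {m n : Fin 4} (h : ∀ k ∈ quadrant m, conj k ∈ quadrant n) :
    Tendsto (fun k : ℂ => conj k) (Bornology.cobounded ℂ ⊓ 𝓟 (quadrant m))
      (Bornology.cobounded ℂ ⊓ 𝓟 (quadrant n)) := by
  refine tendsto_inf.2 ⟨?_, tendsto_principal.2 ?_⟩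
  · refine (tendsto_norm_atTop_iff_cobounded.1 ?_).mono_left inf_le_left
    simpa using tendsto_norm_cobounded_atTop (E := ℂ)
  · exact eventually_inf_principal.2 (Eventually.of_forall h)

theorem isBigO_schwarz {m n : Fin 4} (h : ∀ k ∈ quadrant m, conj k ∈ quadrant n) {f : ℂ → ℂ}
    {w : ℂ} (hf : (fun k => f k - w) =O[Bornology.cobounded ℂ ⊓ 𝓟 (quadrant n)] fun k => k⁻¹) :
    (fun k => schwarz f k - conj w) =O[Bornology.cobounded ℂ ⊓ 𝓟 (quadrant m)] fun k => k⁻¹ := by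
  refine ((hf.comp_tendsto (tendsto_schwarz_cobounded h)).norm_left.congr_left fun k => ?_).of_norm_left.trans
    (IsBigO.of_bound 1 (Eventually.of_forall fun k => by simp))
  rw [← Complex.norm_conj]
  simp [schwarz]

section

variable {l : Filter ℂ} {f g : ℂ → ℂ} {w : ℂ}

theorem isBigO_inv_one (hl : l ≤ Bornology.cobounded ℂ) :
    (fun k : ℂ => k⁻¹) =O[l] fun _ => (1 : ℂ) :=
  (tendsto_inv₀_cobounded.mono_left hl).isBigO_one ℂ

theorem isBigO_one_of_sub (hl : l ≤ Bornology.cobounded ℂ)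
    (hf : (fun k => f k - w) =O[l] fun k => k⁻¹) : f =O[l] fun _ => (1 : ℂ) :=
  ((hf.trans (isBigO_inv_one hl)).add (isBigO_const_const w one_ne_zero l)).congr_left
    fun _ => sub_add_cancel _ _

theorem tendsto_of_isBigO_inv (hl : l ≤ Bornology.cobounded ℂ)
    (hf : (fun k => f k - w) =O[l] fun k => k⁻¹) : Tendsto f l (𝓝 w) :=
  tendsto_sub_nhds_zero_iff.1 (hf.trans_tendsto (tendsto_inv₀_cobounded.mono_left hl))

theorem isBigO_mul_sub {w' : ℂ} (hl : l ≤ Bornology.cobounded ℂ)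
    (hf : (fun k => f k - w) =O[l] fun k => k⁻¹) (hg : (fun k => g k - w') =O[l] fun k => k⁻¹) :
    (fun k => f k * g k - w * w') =O[l] fun k => k⁻¹ := by
  have h1 := (isBigO_one_of_sub hl hf).mul hg
  have h2 := hf.const_mul_left w'
  refine ((h1.congr_right fun k => one_mul _).add h2).congr_left fun _ => by ring

theorem isBigO_inv_sub (hl : l ≤ Bornology.cobounded ℂ)
    (hf : (fun k => f k - 1) =O[l] fun k => k⁻¹) :
    (fun k => (f k)⁻¹ - 1) =O[l] fun k => k⁻¹ := by
  have h0 := tendsto_of_isBigO_inv hl hf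
  have h1 := (h0.inv₀ one_ne_zero).isBigO_one ℂ
  refine ((h1.mul hf).congr_right fun k => one_mul _).neg_left.congr' ?_ EventuallyEq.rfl
  filter_upwards [h0.eventually_ne one_ne_zero] with _ hk
  field_simp
  ring

end

/-- A and F are columns evaluated at the origin, so their behaviour in D₁ is an instance of
`IsFundamental.muCol_asymptotics`. For H in D₂ one uses a, b in D₂ and A, B in D₃, the reflection of
D₂. -/
theorem IsFundamental.isRHPData {lam L T M : ℝ} {q qx qxx qt qxt : ℝ → ℝ → ℂ}
    {ψ : ℂ → ℝ → ℝ → Mat} (hlam : lam = 1 ∨ lam = -1) (hL : 0 ≤ L) (hT : 0 ≤ T) (hM : 0 ≤ M)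
    (h : IsJet lam L T M q qx qxx qt qxt) (hψ : IsFundamental lam L T q qx ψ) {x t : ℝ}
    (hx : x ∈ Set.Icc 0 L) (ht : t ∈ Set.Icc 0 T) :
    IsRHPData lam L T x t (q x t) (muCol ψ L 0 0 0 1) (muCol ψ L 0 0 0 0) (muCol ψ 0 T 0 0 1)
      (muCol ψ 0 T 0 0 0)
      (fun n => muCol ψ (corner L T n).1 (corner L T n).2 x t) := by
  have h0L : (0 : ℝ) ∈ Set.Icc 0 L := ⟨le_rfl, hL⟩
  have h0T : (0 : ℝ) ∈ Set.Icc 0 T := ⟨le_rfl, hT⟩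
  have hLL : L ∈ Set.Icc 0 L := ⟨hL, le_rfl⟩
  have hTT : T ∈ Set.Icc 0 T := ⟨hT, le_rfl⟩
  have habs : |lam| = 1 := by rcases hlam with rfl | rfl <;> simp
  have hc1 : ∀ n, (corner L T n).1 ∈ Set.Icc 0 L := fun n => by
    fin_cases n <;> simp [corner, hL]
  have hc2 : ∀ n, (corner L T n).2 ∈ Set.Icc 0 T := fun n => by
    fin_cases n <;> simp [corner, hT]
  obtain ⟨hsc, hF⟩ := hψ.isScattering hlam hL hT h hx ht
  obtain ⟨C, hC1, hC⟩ := hψ.muCol_asymptotics habs hL hT hM h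
  have key : ∀ {S : Set ℂ} {x₀ t₀ x t : ℝ}, x₀ ∈ Set.Icc 0 L → t₀ ∈ Set.Icc 0 T →
      x ∈ Set.Icc 0 L → t ∈ Set.Icc 0 T →
      (∀ k ∈ S, 0 ≤ (2 * Complex.I * k * (x - x₀ : ℝ)).re) →
      (∀ k ∈ S, 0 ≤ (4 * Complex.I * k ^ 2 * (t - t₀ : ℝ)).re) →
      ∀ i, (fun k => muCol ψ x₀ t₀ x t i k - (![0, 1] : Fin 2 → ℂ) i)
        =O[Bornology.cobounded ℂ ⊓ 𝓟 S] fun k => k⁻¹ := by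
    intro S x₀ t₀ x t hx₀ ht₀ hx ht h1 h2 i
    refine IsBigO.of_bound C (eventually_inf_principal.2 ?_)
    filter_upwards [eventually_cobounded_le_norm C] with k hk hkS
    obtain ⟨c0, c1, -⟩ := hC x₀ hx₀ t₀ ht₀ x hx t ht k hk (h1 k hkS) (h2 k hkS)
    rw [norm_inv]
    fin_cases i
    · simpa using c0
    · simpa using c1
  have re1 : ∀ (k : ℂ) (s : ℝ), (2 * Complex.I * k * (s : ℂ)).re = -2 * k.im * s := fun k s => by
    simp
  have re2 : ∀ (k : ℂ) (s : ℝ), (4 * Complex.I * k ^ 2 * (s : ℂ)).re = -8 * (k.re * k.im) * s :=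
    fun k s => by simp [pow_two, -mul_eq_mul_right_iff]; ring
  have q0 : ∀ k ∈ quadrant 0, 0 < k.re ∧ 0 < k.im := fun k hk => by simpa [quadrant] using hk
  have q1 : ∀ k ∈ quadrant 1, k.re < 0 ∧ 0 < k.im := fun k hk => by simpa [quadrant] using hk
  have q2 : ∀ k ∈ quadrant 2, k.re < 0 ∧ k.im < 0 := fun k hk => by simpa [quadrant] using hk
  have hA0 := key (S := quadrant 0) h0L hTT h0L h0T (by simp) fun k hk => by
    obtain ⟨k1, k2⟩ := q0 k hk
    rw [re2]; nlinarith [mul_nonneg (mul_pos k1 k2).le hT]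
  have hA2 := key (S := quadrant 2) h0L hTT h0L h0T (by simp) fun k hk => by
    obtain ⟨k1, k2⟩ := q2 k hk
    rw [re2]; nlinarith [mul_nonneg (mul_pos_of_neg_of_neg k1 k2).le hT]
  have ha1 := key (S := quadrant 1) hLL h0T h0L h0T (fun k hk => by
    obtain ⟨k1, k2⟩ := q1 k hk
    rw [re1]; nlinarith [mul_nonneg k2.le hL]) (by simp)
  have hF0 := key (S := quadrant 0) hLL hTT h0L h0T (fun k hk => by
    obtain ⟨k1, k2⟩ := q0 k hk
    rw [re1]; nlinarith [mul_nonneg k2.le hL]) fun k hk => by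
    obtain ⟨k1, k2⟩ := q0 k hk
    rw [re2]; nlinarith [mul_nonneg (mul_pos k1 k2).le hT]
  refine { hsc with
    sign := hlam
    diff_a := hψ.differentiable_muCol hLL h0T h0L h0T 1
    diff_b := hψ.differentiable_muCol hLL h0T h0L h0T 0
    diff_A := hψ.differentiable_muCol h0L hTT h0L h0T 1
    diff_B := hψ.differentiable_muCol h0L hTT h0L h0T 0
    diff_c := fun n i => hψ.differentiable_muCol (hc1 n) (hc2 n) hx ht i
    asymp_A := by simpa using hA0 1
    asymp_F := by simpa [hF] using hF0 1
    asymp_H := ?_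
    asymp_c := fun n i => key (hc1 n) (hc2 n) hx ht
      (fun k hk => by rw [(re_exponents hx ht hk).1]; positivity)
      (fun k hk => by rw [(re_exponents hx ht hk).2]; positivity) i
    recovery := ?_ }
  · have hconj : ∀ k ∈ quadrant 1, conj k ∈ quadrant 2 := fun k hk => by
      simpa [quadrant] using q1 k hk
    have e1 := ha1 1
    have e0 := ha1 0
    have s1 := isBigO_schwarz hconj (hA2 1)
    have s0 := isBigO_schwarz hconj (hA2 0)
    simp only [Matrix.cons_val_zero, Matrix.cons_val_one, map_zero, map_one] at e1 e0 s1 s0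
    have hl : Bornology.cobounded ℂ ⊓ 𝓟 (quadrant 1) ≤ Bornology.cobounded ℂ := inf_le_left
    refine ((isBigO_mul_sub hl e1 s1).sub ((isBigO_mul_sub hl e0 s0).const_mul_left lam)).congr_left
      fun k => ?_
    simp only [specH]
    ring
  · intro n hn ε hε
    set x₀ := (corner L T n).1
    set t₀ := (corner L T n).2
    -- In the sector |Re k| and |Im k| are at least ε|k|, so the exponent of each coordinate that
    -- differs from the corner is at least r|k|; this is the ρ used below. If a coordinate agrees
    -- with the corner the value 1 is a dummy.
    obtain ⟨r₁, hr₁, hr₁'⟩ : ∃ r : ℝ, 0 < r ∧ (x ≠ x₀ → r ≤ 2 * ε * |x - x₀|) := by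
      by_cases hxx : x = x₀
      · exact ⟨1, one_pos, fun h => absurd hxx h⟩
      · exact ⟨_, by have := abs_pos.2 (sub_ne_zero.2 hxx); positivity, fun _ => le_rfl⟩
    obtain ⟨r₂, hr₂, hr₂'⟩ : ∃ r : ℝ, 0 < r ∧ (t ≠ t₀ → r ≤ 8 * ε ^ 2 * |t - t₀|) := by
      by_cases htt : t = t₀
      · exact ⟨1, one_pos, fun h => absurd htt h⟩
      · exact ⟨_, by have := abs_pos.2 (sub_ne_zero.2 htt); positivity, fun _ => le_rfl⟩
    set r := min r₁ r₂
    have hr : 0 < r := lt_min hr₁ hr₂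
    rw [tendsto_iff_norm_sub_tendsto_zero]
    have hlim : Tendsto (fun k : ℂ => C * (r * ‖k‖)⁻¹ + C * ‖k‖⁻¹)
        (Bornology.cobounded ℂ ⊓ 𝓟 (sector ε n)) (𝓝 0) := by
      have h1 : Tendsto (fun k : ℂ => ‖k‖⁻¹) (Bornology.cobounded ℂ ⊓ 𝓟 (sector ε n)) (𝓝 0) :=
        (tendsto_inv_atTop_zero.comp tendsto_norm_cobounded_atTop).mono_left inf_le_left
      simpa [mul_inv, mul_assoc, mul_comm r⁻¹] using ((h1.const_mul r⁻¹).const_mul C).add (h1.const_mul C)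
    refine squeeze_zero' (Eventually.of_forall fun k => norm_nonneg _) ?_ hlim
    refine eventually_inf_principal.2 ?_
    filter_upwards [eventually_cobounded_le_norm C] with k hk hkS
    obtain ⟨hkq, hkr, hki⟩ := hkS
    have hk1 : 1 ≤ ‖k‖ := hC1.trans hk
    obtain ⟨g1, g2⟩ := re_exponents hx ht hkq
    refine (hC x₀ (hc1 n) t₀ (hc2 n) x hx t ht k hk (by rw [g1]; positivity)
      (by rw [g2]; positivity)).2.2 (r * ‖k‖) (by positivity) hn (fun hxx => ?_) (fun htt => ?_)
    · rw [g1]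
      calc r * ‖k‖ ≤ 2 * ε * |x - x₀| * ‖k‖ := by
            gcongr; exact (min_le_left _ _).trans (hr₁' hxx)
        _ = 2 * (ε * ‖k‖) * |x - x₀| := by ring
        _ ≤ _ := by gcongr
    · rw [g2]
      calc r * ‖k‖ ≤ 8 * ε ^ 2 * |t - t₀| * ‖k‖ := by
            gcongr; exact (min_le_right _ _).trans (hr₂' htt)
        _ ≤ 8 * ε ^ 2 * |t - t₀| * (‖k‖ * ‖k‖) := by
            gcongr; nlinarith
        _ = 8 * ((ε * ‖k‖) * (ε * ‖k‖)) * |t - t₀| := by ring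
        _ ≤ _ := by gcongr

/-! ### Poles of quotients of analytic functions -/

theorem differentiable_schwarz {f : ℂ → ℂ} (hf : Differentiable ℂ f) :
    Differentiable ℂ (schwarz f) := fun k => by
  have := (hf (conj k)).hasDerivAt.conj_conj
  rw [Complex.conj_conj] at this
  exact this.differentiableAt

section

variable {f g φ : ℂ → ℂ} {z : ℂ}

theorem not_hasPole_div (hf : AnalyticAt ℂ f z) (hg : AnalyticAt ℂ g z) (hz : g z ≠ 0)
    (hφ : φ =ᶠ[𝓝[≠] z] fun k => f k / g k) : ¬ HasPole φ z := fun h => by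
  have := h.2
  rw [meromorphicOrderAt_congr hφ] at this
  exact not_le.2 this (hf.div hg hz).meromorphicOrderAt_nonneg

theorem meromorphicOrderAt_div_eq_neg (hf : AnalyticAt ℂ f z) (hg : AnalyticAt ℂ g z)
    (hfz : f z ≠ 0) (hφ : φ =ᶠ[𝓝[≠] z] fun k => f k / g k) :
    meromorphicOrderAt φ z = -meromorphicOrderAt g z := by
  have h0 : meromorphicOrderAt f z = 0 := by
    rw [hf.meromorphicOrderAt_eq, hf.analyticOrderAt_eq_zero.2 hfz]
    rfl
  rw [meromorphicOrderAt_congr hφ,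
    show (fun k => f k / g k) = f * g⁻¹ from funext fun k => div_eq_mul_inv _ _,
    meromorphicOrderAt_mul hf.meromorphicAt hg.meromorphicAt.inv, h0, zero_add,
    meromorphicOrderAt_inv]

/-- The hypothesis `hg0` excludes g ≡ 0 near z, where the quotient would be 0 by convention and have
no pole. -/
theorem hasPole_div (hf : AnalyticAt ℂ f z) (hg : AnalyticAt ℂ g z) (hfz : f z ≠ 0)
    (hz : g z = 0) (hg0 : ∀ᶠ k in 𝓝[≠] z, g k ≠ 0) (hφ : φ =ᶠ[𝓝[≠] z] fun k => f k / g k) :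
    HasPole φ z := by
  refine ⟨(hf.meromorphicAt.div hg.meromorphicAt).congr hφ.symm, ?_⟩
  rw [meromorphicOrderAt_div_eq_neg hf hg hfz hφ]
  have h1 : 0 < meromorphicOrderAt g z := by
    refine (tendsto_zero_iff_meromorphicOrderAt_pos hg.meromorphicAt).1 ?_
    simpa [hz] using hg.continuousAt.tendsto.mono_left nhdsWithin_le_nhds
  have h2 : meromorphicOrderAt g z ≠ ⊤ :=
    (meromorphicOrderAt_ne_top_iff_eventually_ne_zero hg.meromorphicAt).2 hg0
  lift meromorphicOrderAt g z to ℤ using h2 with n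
  have : 0 < n := by exact_mod_cast h1
  exact_mod_cast neg_neg_of_pos this

/-- As f(z) ≠ 0, the pole order of φ is the order of the zero of g, so g has a simple zero. The
limit r is kept as a number because the same 1/g multiplies other analytic functions in the columns
of m. -/
theorem exists_tendsto_div_of_hasSimplePole (h : HasSimplePole φ z) (hf : AnalyticAt ℂ f z)
    (hg : AnalyticAt ℂ g z) (hfz : f z ≠ 0) (hφ : φ =ᶠ[𝓝[≠] z] fun k => f k / g k) :
    ∃ r : ℂ, Tendsto (fun k => (k - z) / g k) (𝓝[≠] z) (𝓝 r) ∧ residue φ z = f z * r := by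
  have h1 : meromorphicOrderAt g z = (1 : ℤ) := by
    have := h.2
    rw [meromorphicOrderAt_div_eq_neg hf hg hfz hφ] at this
    have h2 : meromorphicOrderAt g z ≠ ⊤ := fun ht => by
      simp only [ht, LinearOrderedAddCommGroupWithTop.neg_top] at this
      exact WithTop.top_ne_coe (a := (-1 : ℤ)) this
    lift meromorphicOrderAt g z to ℤ using h2 with n
    have : -n = -1 := WithTop.coe_inj.1 this
    have : n = 1 := by omega
    exact_mod_cast this
  obtain ⟨w, hw, hw0, hgw⟩ := (meromorphicOrderAt_eq_int_iff hg.meromorphicAt).1 h1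
  have hlim : Tendsto (fun k => (k - z) / g k) (𝓝[≠] z) (𝓝 (w z)⁻¹) := by
    refine ((hw.continuousAt.inv₀ hw0).tendsto.mono_left nhdsWithin_le_nhds).congr' ?_
    filter_upwards [hgw, self_mem_nhdsWithin] with k hk hkz
    have : k - z ≠ 0 := sub_ne_zero.2 hkz
    rw [hk, zpow_one, smul_eq_mul]
    simp only [Pi.inv_apply]
    rw [div_mul_eq_div_div, div_self this, one_div]
  refine ⟨_, hlim, Tendsto.limUnder_eq ?_⟩
  refine ((hf.continuousAt.tendsto.mono_left nhdsWithin_le_nhds).mul hlim).congr' ?_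
  filter_upwards [hφ] with k hk
  rw [hk]
  ring

end

theorem mem_quadrant_zero {k : ℂ} : k ∈ quadrant 0 ↔ 0 < k.re ∧ 0 < k.im := Iff.rfl
theorem mem_quadrant_one {k : ℂ} : k ∈ quadrant 1 ↔ k.re < 0 ∧ 0 < k.im := Iff.rfl
theorem mem_quadrant_two {k : ℂ} : k ∈ quadrant 2 ↔ k.re < 0 ∧ k.im < 0 := Iff.rfl
theorem mem_quadrant_three {k : ℂ} : k ∈ quadrant 3 ↔ 0 < k.re ∧ k.im < 0 := Iff.rfl

theorem cobounded_inf_quadrant_neBot (n : Fin 4) :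
    (Bornology.cobounded ℂ ⊓ 𝓟 (quadrant n)).NeBot := by
  obtain ⟨w, hw⟩ : ∃ w : ℂ, ∀ s : ℝ, 0 < s → s * w ∈ quadrant n := by
    fin_cases n
    · exact ⟨1 + Complex.I, fun s hs => by simp [mem_quadrant_zero, hs]⟩
    · exact ⟨-1 + Complex.I, fun s hs => by simp [mem_quadrant_one, hs]⟩
    · exact ⟨-1 - Complex.I, fun s hs => by simp [mem_quadrant_two, hs]⟩
    · exact ⟨1 - Complex.I, fun s hs => by simp [mem_quadrant_three, hs]⟩
  have hw0 : w ≠ 0 := by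
    rintro rfl
    have := hw 1 one_pos
    fin_cases n <;> simp [quadrant] at this
  have ht : Tendsto (fun s : ℝ => (s : ℂ) * w) atTop
      (Bornology.cobounded ℂ ⊓ 𝓟 (quadrant n)) := by
    refine tendsto_inf.2 ⟨?_, tendsto_principal.2 ?_⟩
    · refine tendsto_norm_atTop_iff_cobounded.1 ?_
      simp only [norm_mul, Complex.norm_real]
      exact tendsto_norm_atTop_atTop.atTop_mul_const (norm_pos_iff.2 hw0)
    · filter_upwards [eventually_gt_atTop 0] with s hs using hw s hs
  exact ht.neBot

/-- Accumulating zeros would force f ≡ 0 by the identity theorem, against the limit 1 at infinity in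
an unbounded quadrant. -/
theorem eventually_ne_zero_of_asymptotics {f : ℂ → ℂ} (hf : Differentiable ℂ f) {n : Fin 4}
    (h : (fun k => f k - 1) =O[Bornology.cobounded ℂ ⊓ 𝓟 (quadrant n)] fun k => k⁻¹) (z : ℂ) :
    ∀ᶠ k in 𝓝[≠] z, f k ≠ 0 := by
  have han : AnalyticOnNhd ℂ f Set.univ := hf.differentiableOn.analyticOnNhd isOpen_univ
  refine (han z trivial).eventually_eq_zero_or_eventually_ne_zero.resolve_left fun h0 => ?_
  have h1 : f = 0 := han.eq_of_eventuallyEq analyticOnNhd_const h0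
  have := cobounded_inf_quadrant_neBot n
  have h2 := tendsto_of_isBigO_inv inf_le_left h
  rw [h1] at h2
  exact zero_ne_one (tendsto_nhds_unique tendsto_const_nhds h2)

theorem conj_mem_contour {k : ℂ} : conj k ∈ contour ↔ k ∈ contour := by
  simp [contour]

theorem conj_mem_poleSet {lam L : ℝ} {a b Γ : ℂ → ℂ} {k : ℂ} :
    conj k ∈ poleSet lam L a b Γ ↔ k ∈ poleSet lam L a b Γ := by
  simp [poleSet, or_comm]

/-! ### Zeros of the denominators -/

namespace IsRHPData

variable {lam L T x t : ℝ} {q₀ : ℂ} {a b A B : ℂ → ℂ} {c : Fin 4 → Fin 2 → ℂ → ℂ}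

theorem lam_mul_self (h : IsRHPData lam L T x t q₀ a b A B c) : (lam : ℂ) * lam = 1 := by
  rcases h.sign with h | h <;> simp [h]

theorem lam_ne_zero (h : IsRHPData lam L T x t q₀ a b A B c) : (lam : ℂ) ≠ 0 := fun h0 => by
  simpa [h0] using h.lam_mul_self

theorem differentiable_specF (h : IsRHPData lam L T x t q₀ a b A B c) :
    Differentiable ℂ (specF lam L a b A B) := by
  have h1 := h.diff_a
  have h2 := differentiable_schwarz h.diff_b
  have h3 := h.diff_A
  have h4 := h.diff_B
  unfold specF
  fun_prop

theorem differentiable_specH (h : IsRHPData lam L T x t q₀ a b A B c) :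
    Differentiable ℂ (specH lam a b A B) := by
  have h1 := h.diff_a
  have h2 := h.diff_b
  have h3 := differentiable_schwarz h.diff_A
  have h4 := differentiable_schwarz h.diff_B
  unfold specH
  fun_prop

/-- `G = b̄ Ā + a B̄ e^{-2ikL}`. -/
noncomputable def specG (L : ℝ) (a b A B : ℂ → ℂ) (k : ℂ) : ℂ :=
  schwarz b k * schwarz A k + a k * schwarz B k * Complex.exp (-(2 * Complex.I * k * L))

/-- `K = ā B̄ - b̄ Ā`. -/
noncomputable def specK (a b A B : ℂ → ℂ) (k : ℂ) : ℂ :=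
  schwarz a k * schwarz B k - schwarz b k * schwarz A k

theorem differentiable_specG (h : IsRHPData lam L T x t q₀ a b A B c) :
    Differentiable ℂ (specG L a b A B) := by
  have h1 := h.diff_a
  have h2 := differentiable_schwarz h.diff_b
  have h3 := differentiable_schwarz h.diff_A
  have h4 := differentiable_schwarz h.diff_B
  unfold specG
  fun_prop

theorem differentiable_specK (h : IsRHPData lam L T x t q₀ a b A B c) :
    Differentiable ℂ (specK a b A B) := by
  have h1 := differentiable_schwarz h.diff_a
  have h2 := differentiable_schwarz h.diff_b
  have h3 := differentiable_schwarz h.diff_A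
  have h4 := differentiable_schwarz h.diff_B
  unfold specK
  fun_prop

theorem schwarz_exp (L : ℝ) (k : ℂ) :
    conj (Complex.exp (2 * Complex.I * conj k * L)) = Complex.exp (-(2 * Complex.I * k * L)) := by
  rw [← Complex.exp_conj]
  simp [show conj (2 : ℂ) = 2 from Complex.conj_ofNat 2]

theorem schwarz_exp_neg (L : ℝ) (k : ℂ) :
    conj (Complex.exp (-(2 * Complex.I * conj k * L))) = Complex.exp (2 * Complex.I * k * L) := by
  rw [← Complex.exp_conj]
  simp [show conj (2 : ℂ) = 2 from Complex.conj_ofNat 2]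

theorem schwarz_specF (k : ℂ) : schwarz (specF lam L a b A B) k
    = schwarz a k * schwarz A k
      + lam * b k * schwarz B k * Complex.exp (-(2 * Complex.I * k * L)) := by
  simp only [schwarz, specF, map_add, map_mul, schwarz_exp, Complex.conj_ofReal,
    Complex.conj_conj]

theorem schwarz_specG (k : ℂ) : schwarz (specG L a b A B) k
    = b k * A k + schwarz a k * B k * Complex.exp (2 * Complex.I * k * L) := by
  simp only [schwarz, specG, map_add, map_mul, schwarz_exp_neg, Complex.conj_conj]

theorem schwarz_specH (k : ℂ) : schwarz (specH lam a b A B) k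
    = schwarz a k * A k - lam * schwarz b k * B k := by
  simp only [schwarz, specH, map_sub, map_mul, Complex.conj_ofReal, Complex.conj_conj]

theorem schwarz_specK (k : ℂ) : schwarz (specK a b A B) k = a k * B k - b k * A k := by
  simp only [schwarz, specK, map_sub, map_mul, Complex.conj_conj]

theorem exp_mul_exp_neg (w : ℂ) : Complex.exp w * Complex.exp (-w) = 1 := by
  rw [← Complex.exp_add, add_neg_cancel, Complex.exp_zero]

/-- F and G are, up to conjugation, the entries of a product of the two unimodular matrices with
entries a, b and A, B, one of them conjugated by a diagonal exponential. In particular F and G have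
no common zero; `det_HK` plays this role for H and K. -/
theorem det_FG (h : IsRHPData lam L T x t q₀ a b A B c) (k : ℂ) :
    specF lam L a b A B k * schwarz (specF lam L a b A B) k
      - lam * specG L a b A B k * schwarz (specG L a b A B) k = 1 := by
  rw [schwarz_specF, schwarz_specG, specF, specG]
  linear_combination (A k * schwarz A k - lam * B k * schwarz B k) * h.det_s k + h.det_S k
    + lam * B k * schwarz B k * (lam * b k * schwarz b k - a k * schwarz a k)
      * exp_mul_exp_neg (2 * Complex.I * k * L)

theorem det_HK (h : IsRHPData lam L T x t q₀ a b A B c) (k : ℂ) :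
    specH lam a b A B k * schwarz (specH lam a b A B) k
      - lam * specK a b A B k * schwarz (specK a b A B) k = 1 := by
  rw [schwarz_specH, schwarz_specK, specH, specK]
  linear_combination (A k * schwarz A k - lam * B k * schwarz B k) * h.det_s k + h.det_S k

theorem specG_ne_zero (h : IsRHPData lam L T x t q₀ a b A B c) {k : ℂ}
    (hk : specF lam L a b A B k = 0) : specG L a b A B k ≠ 0 := fun h0 => by
  simpa [hk, h0] using h.det_FG k

theorem specK_ne_zero (h : IsRHPData lam L T x t q₀ a b A B c) {k : ℂ}
    (hk : specH lam a b A B k = 0) : specK a b A B k ≠ 0 := fun h0 => by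
  simpa [hk, h0] using h.det_HK k

theorem B_ne_zero (h : IsRHPData lam L T x t q₀ a b A B c) {k : ℂ} (hk : A k = 0) : B k ≠ 0 :=
  fun h0 => by simpa [hk, h0] using h.det_S k

theorem eventually_A_ne_zero (h : IsRHPData lam L T x t q₀ a b A B c) (z : ℂ) :
    ∀ᶠ k in 𝓝[≠] z, A k ≠ 0 :=
  eventually_ne_zero_of_asymptotics h.diff_A h.asymp_A z

theorem eventually_schwarz_A_ne_zero (h : IsRHPData lam L T x t q₀ a b A B c) (z : ℂ) :
    ∀ᶠ k in 𝓝[≠] z, schwarz A k ≠ 0 :=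
  eventually_ne_zero_of_asymptotics (n := 3) (differentiable_schwarz h.diff_A)
    (by
      simpa using isBigO_schwarz (m := 3)
        (fun k hk => by simpa [mem_quadrant_three, mem_quadrant_zero] using hk) h.asymp_A) z

theorem eventually_specF_ne_zero (h : IsRHPData lam L T x t q₀ a b A B c) (z : ℂ) :
    ∀ᶠ k in 𝓝[≠] z, specF lam L a b A B k ≠ 0 :=
  eventually_ne_zero_of_asymptotics h.differentiable_specF h.asymp_F z

theorem eventually_specH_ne_zero (h : IsRHPData lam L T x t q₀ a b A B c) (z : ℂ) :
    ∀ᶠ k in 𝓝[≠] z, specH lam a b A B k ≠ 0 :=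
  eventually_ne_zero_of_asymptotics h.differentiable_specH h.asymp_H z

/-- By `det_S`, lam Γ Γ̄ - 1 = -1/(A Ā), and a + lam b̄ Γ e^{2ikL} = F/A; so η is an entire function
over F. The equality is claimed on a punctured neighbourhood only, since division by zero spoils the
values at zeros of A, Ā and F. -/
theorem eta_eventuallyEq (h : IsRHPData lam L T x t q₀ a b A B c) (z : ℂ) :
    eta lam L a b (fun k => B k / A k) =ᶠ[𝓝[≠] z]
      fun k => (-(lam * specG L a b A B k * A k ^ 2)) / specF lam L a b A B k := by
  filter_upwards [h.eventually_A_ne_zero z, h.eventually_schwarz_A_ne_zero z,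
    h.eventually_specF_ne_zero z] with k h1 h2 h3
  have hΓ : schwarz (fun k => B k / A k) k = schwarz B k / schwarz A k := by simp [schwarz]
  have e1 : lam * (B k / A k) * (schwarz B k / schwarz A k) - 1
      = -(1 / (A k * schwarz A k)) := by
    field_simp
    linear_combination -h.det_S k
  have e2 : a k + lam * schwarz b k * (B k / A k) * Complex.exp (2 * Complex.I * k * L)
      = specF lam L a b A B k / A k := by
    rw [specF]; field_simp
  rw [eta, hΓ, e1, e2, specG]
  field_simp

theorem xi_eventuallyEq (h : IsRHPData lam L T x t q₀ a b A B c) (z : ℂ) :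
    xi lam a b (fun k => B k / A k) =ᶠ[𝓝[≠] z]
      fun k => (lam * specK a b A B k) / specH lam a b A B k := by
  filter_upwards [h.eventually_schwarz_A_ne_zero z, h.eventually_specH_ne_zero z] with k h2 h3
  have hΓ : schwarz (fun k => B k / A k) k = schwarz B k / schwarz A k := by simp [schwarz]
  have e2 : a k - lam * b k * (schwarz B k / schwarz A k)
      = specH lam a b A B k / schwarz A k := by
    rw [specH]; field_simp
  rw [xi, hΓ, e2, specK]
  field_simp

variable {Γ : ℂ → ℂ}

theorem hasPole_gamma_iff (h : IsRHPData lam L T x t q₀ a b A B c) {z : ℂ} :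
    HasPole (fun k => B k / A k) z ↔ A z = 0 :=
  ⟨fun hp => by_contra fun h0 => not_hasPole_div (h.diff_B.analyticAt z) (h.diff_A.analyticAt z)
    h0 EventuallyEq.rfl hp, fun h0 => hasPole_div (h.diff_B.analyticAt z) (h.diff_A.analyticAt z)
    (h.B_ne_zero h0) h0 (h.eventually_A_ne_zero z) EventuallyEq.rfl⟩

theorem analyticAt_eta_num (h : IsRHPData lam L T x t q₀ a b A B c) (z : ℂ) :
    AnalyticAt ℂ (fun k => -(lam * specG L a b A B k * A k ^ 2)) z := by
  have h1 := h.differentiable_specG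
  have h2 := h.diff_A
  exact Differentiable.analyticAt (by fun_prop) z

theorem analyticAt_xi_num (h : IsRHPData lam L T x t q₀ a b A B c) (z : ℂ) :
    AnalyticAt ℂ (fun k => lam * specK a b A B k) z :=
  (h.differentiable_specK.const_mul _).analyticAt z

theorem eta_num_ne_zero (h : IsRHPData lam L T x t q₀ a b A B c) {z : ℂ}
    (hF : specF lam L a b A B z = 0) (hA : A z ≠ 0) :
    -(lam * specG L a b A B z * A z ^ 2) ≠ 0 :=
  neg_ne_zero.2 (mul_ne_zero (mul_ne_zero h.lam_ne_zero (h.specG_ne_zero hF)) (pow_ne_zero _ hA))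

theorem xi_num_ne_zero (h : IsRHPData lam L T x t q₀ a b A B c) {z : ℂ}
    (hH : specH lam a b A B z = 0) : lam * specK a b A B z ≠ 0 :=
  mul_ne_zero h.lam_ne_zero (h.specK_ne_zero hH)

theorem specF_eq_zero_of_hasPole (h : IsRHPData lam L T x t q₀ a b A B c) {z : ℂ}
    (hp : HasPole (eta lam L a b fun k => B k / A k) z) : specF lam L a b A B z = 0 :=
  by_contra fun h0 => not_hasPole_div (h.analyticAt_eta_num z)
    (h.differentiable_specF.analyticAt z) h0 (h.eta_eventuallyEq z) hp

theorem hasPole_eta (h : IsRHPData lam L T x t q₀ a b A B c) {z : ℂ}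
    (hF : specF lam L a b A B z = 0) (hA : A z ≠ 0) :
    HasPole (eta lam L a b fun k => B k / A k) z :=
  hasPole_div (h.analyticAt_eta_num z) (h.differentiable_specF.analyticAt z)
    (h.eta_num_ne_zero hF hA) hF (h.eventually_specF_ne_zero z) (h.eta_eventuallyEq z)

theorem hasPole_xi_iff (h : IsRHPData lam L T x t q₀ a b A B c) {z : ℂ} :
    HasPole (xi lam a b fun k => B k / A k) z ↔ specH lam a b A B z = 0 :=
  ⟨fun hp => by_contra fun h0 => not_hasPole_div (h.analyticAt_xi_num z)
    (h.differentiable_specH.analyticAt z) h0 (h.xi_eventuallyEq z) hp,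
    fun h0 => hasPole_div (h.analyticAt_xi_num z) (h.differentiable_specH.analyticAt z)
    (h.xi_num_ne_zero h0) h0 (h.eventually_specH_ne_zero z) (h.xi_eventuallyEq z)⟩

theorem mem_gammaPoles_iff (h : IsRHPData lam L T x t q₀ a b A B c)
    (hΓ : Γ = fun k => B k / A k) {z : ℂ} :
    z ∈ gammaPoles Γ ↔ z ∈ quadrant 0 ∧ A z = 0 := by
  subst hΓ
  exact and_congr_right fun _ => h.hasPole_gamma_iff

theorem mem_xiPoles_iff (h : IsRHPData lam L T x t q₀ a b A B c)
    (hΓ : Γ = fun k => B k / A k) {z : ℂ} :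
    z ∈ xiPoles lam a b Γ ↔ z ∈ quadrant 1 ∧ specH lam a b A B z = 0 := by
  subst hΓ
  exact and_congr_right fun _ => h.hasPole_xi_iff

/-- At a zero of A, F reduces to lam b̄ B e^{2ikL}. Here B ≠ 0 by `det_S`, and b̄ ≠ 0 because conj z
lies in P, which contains no zero of b. Without this, the factor A² in the numerator of η could hide
a common zero of A and F. -/
theorem specF_ne_zero_of_A_eq_zero (h : IsRHPData lam L T x t q₀ a b A B c)
    (hΓ : Γ = fun k => B k / A k)
    (hP : PoleAssumption lam L a b Γ) {z : ℂ} (hz : z ∈ quadrant 0) (hA : A z = 0) :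
    specF lam L a b A B z ≠ 0 := by
  have h1 : z ∈ gammaPoles Γ := (h.mem_gammaPoles_iff hΓ).2 ⟨hz, hA⟩
  have h2 : b (conj z) ≠ 0 :=
    (hP.zeros_disjoint _ (conj_mem_poleSet.2 (Or.inl (Or.inl (Or.inl h1))))).2
  have h3 : schwarz b z ≠ 0 := (map_ne_zero _).2 h2
  rw [specF, hA, mul_zero, zero_add]
  exact mul_ne_zero (mul_ne_zero (mul_ne_zero h.lam_ne_zero h3) (h.B_ne_zero hA))
    (Complex.exp_ne_zero _)

theorem mem_etaPoles_iff (h : IsRHPData lam L T x t q₀ a b A B c)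
    (hΓ : Γ = fun k => B k / A k)
    (hP : PoleAssumption lam L a b Γ) {z : ℂ} :
    z ∈ etaPoles lam L a b Γ ↔ z ∈ quadrant 0 ∧ specF lam L a b A B z = 0 := by
  refine and_congr_right fun hz => ⟨fun hp => ?_, fun hF => ?_⟩
  · subst hΓ
    exact h.specF_eq_zero_of_hasPole hp
  · have := fun hA => h.specF_ne_zero_of_A_eq_zero hΓ hP hz hA hF
    subst hΓ
    exact h.hasPole_eta hF this

/-- A ≠ 0 has to come first: only then is the numerator of η nonzero at a zero of F, so that such a
zero is a pole. -/
theorem ne_zero_of_mem_contour (h : IsRHPData lam L T x t q₀ a b A B c)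
    (hΓ : Γ = fun k => B k / A k)
    (hP : PoleAssumption lam L a b Γ) {z : ℂ} (hz : z ∈ contour) :
    A z ≠ 0 ∧ specF lam L a b A B z ≠ 0 ∧ specH lam a b A B z ≠ 0 := by
  obtain ⟨h1, h2, h3⟩ := hP.no_pole_on_contour z hz
  subst hΓ
  have hA : A z ≠ 0 := fun h0 => h1 (h.hasPole_gamma_iff.2 h0)
  exact ⟨hA, fun h0 => h2 (h.hasPole_eta h0 hA), fun h0 => h3 (h.hasPole_xi_iff.2 h0)⟩

theorem exists_residue_eta (h : IsRHPData lam L T x t q₀ a b A B c)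
    (hΓ : Γ = fun k => B k / A k)
    (hP : PoleAssumption lam L a b Γ) {z : ℂ} (hz : z ∈ etaPoles lam L a b Γ) :
    ∃ r : ℂ, Tendsto (fun k => (k - z) / specF lam L a b A B k) (𝓝[≠] z) (𝓝 r) ∧
      residue (eta lam L a b Γ) z = -(lam * specG L a b A B z * A z ^ 2) * r := by
  obtain ⟨h1, hF⟩ := (h.mem_etaPoles_iff hΓ hP).1 hz
  have hA := fun hA => h.specF_ne_zero_of_A_eq_zero hΓ hP h1 hA hF
  have hs := hP.eta_simple z hz
  subst hΓ
  exact exists_tendsto_div_of_hasSimplePole hs (h.analyticAt_eta_num z)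
    (h.differentiable_specF.analyticAt z) (h.eta_num_ne_zero hF hA) (h.eta_eventuallyEq z)

theorem exists_residue_xi (h : IsRHPData lam L T x t q₀ a b A B c)
    (hΓ : Γ = fun k => B k / A k)
    (hP : PoleAssumption lam L a b Γ) {z : ℂ} (hz : z ∈ xiPoles lam a b Γ) :
    ∃ r : ℂ, Tendsto (fun k => (k - z) / specH lam a b A B k) (𝓝[≠] z) (𝓝 r) ∧
      residue (xi lam a b Γ) z = lam * specK a b A B z * r := by
  obtain ⟨h1, hH⟩ := (h.mem_xiPoles_iff hΓ).1 hz
  have hs := hP.xi_simple z hz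
  subst hΓ
  exact exists_tendsto_div_of_hasSimplePole hs (h.analyticAt_xi_num z)
    (h.differentiable_specH.analyticAt z) (h.xi_num_ne_zero hH) (h.xi_eventuallyEq z)

theorem exists_residue_gamma (h : IsRHPData lam L T x t q₀ a b A B c)
    (hΓ : Γ = fun k => B k / A k)
    (hP : PoleAssumption lam L a b Γ) {z : ℂ} (hz : z ∈ gammaPoles Γ) :
    ∃ r : ℂ, Tendsto (fun k => (k - z) / A k) (𝓝[≠] z) (𝓝 r) := by
  obtain ⟨h1, hA⟩ := (h.mem_gammaPoles_iff hΓ).1 hz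
  have hs := hP.gamma_simple z hz
  subst hΓ
  obtain ⟨r, hr, -⟩ := exists_tendsto_div_of_hasSimplePole hs (h.diff_B.analyticAt z) (h.diff_A.analyticAt z)
    (h.B_ne_zero hA) EventuallyEq.rfl
  exact ⟨r, hr⟩

end IsRHPData

/-! ### The jump relations -/

section

variable {l a b ac bc A B Ac Bc E E' e e' Z z : ℂ}

/-- Here Z and z are the entries, in one row, of the two columns normalized at (0,0). All other
columns are combinations of these with coefficients independent of the row, so each jump relation is
a rational identity, linear in Z and z, modulo the determinant relations and e e' = 1. The next
three lemmas are the other rays. -/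
theorem jump_row_zero (hs : a * ac - l * b * bc = 1) (he : e * e' = 1) (hA : A ≠ 0) (hAc : Ac ≠ 0)
    (hF : a * A + l * bc * B * E ≠ 0) (hH : a * Ac - l * b * Bc ≠ 0) :
    Z * A / (a * A + l * bc * B * E) * ((a - l * b * (Bc / Ac) - l * (B / A) *
        (ac * (Bc / Ac) - bc) * E) / (a - l * b * (Bc / Ac)))
      + (e' * (ac * B * E + b * A) * Z + (a * A + l * bc * B * E) * z) / A
        * (l * (Bc / Ac) * e / ((a - l * b * (Bc / Ac)) * (a + l * bc * (B / A) * E)))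
      = (Ac * Z + e * (l * Bc) * z) / (a * Ac - l * b * Bc) ∧
    Z * A / (a * A + l * bc * B * E) * -(B / A * E * e')
      + (e' * (ac * B * E + b * A) * Z + (a * A + l * bc * B * E) * z) / A
        * (a / (a + l * bc * (B / A) * E))
      = e' * b * Z + a * z := by
  set F := a * A + l * bc * B * E with hFd
  set H := a * Ac - l * b * Bc with hHd
  have e1 : a - l * b * (Bc / Ac) = H / Ac := by rw [hHd]; field_simp
  have e2 : a + l * bc * (B / A) * E = F / A := by rw [hFd]; field_simp
  rw [e1, e2]
  constructor
  · field_simp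
    grind
  · field_simp
    grind

theorem jump_row_one (hs : a * ac - l * b * bc = 1)
    (he : e * e' = 1) (hE : E * E' = 1) (hA : A ≠ 0) (hAc : Ac ≠ 0)
    (hF : a * A + l * bc * B * E ≠ 0) (hFc : ac * Ac + l * b * Bc * E' ≠ 0) :
    Z * A / (a * A + l * bc * B * E) * (1 - l * (B / A) * (Bc / Ac))
      + (e' * (ac * B * E + b * A) * Z + (a * A + l * bc * B * E) * z) / A
        * (l * (a * (Bc / Ac) * E' + bc) * e / (a + l * bc * (B / A) * E))
      = ((ac * Ac + l * b * Bc * E') * Z + e * (l * (a * Bc * E' + bc * Ac)) * z) / Ac ∧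
    Z * A / (a * A + l * bc * B * E)
        * -((ac * (B / A) * E + b) * e' / (ac + l * b * (Bc / Ac) * E'))
      + (e' * (ac * B * E + b * A) * Z + (a * A + l * bc * B * E) * z) / A
        * (1 / ((a + l * bc * (B / A) * E) * (ac + l * b * (Bc / Ac) * E')))
      = z * Ac / (ac * Ac + l * b * Bc * E') := by
  set F := a * A + l * bc * B * E with hFd
  set Fc := ac * Ac + l * b * Bc * E' with hFcd
  have e1 : ac + l * b * (Bc / Ac) * E' = Fc / Ac := by rw [hFcd]; field_simp
  have e2 : a + l * bc * (B / A) * E = F / A := by rw [hFd]; field_simp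
  rw [e1, e2]
  constructor
  · field_simp
    linear_combination l * Z * (ac * B * E + b * A) * (a * Bc * E' + bc * Ac) * he
      - Z * (A * Ac - l * B * Bc) * hs - Z * l * B * Bc * (l * b * bc - a * ac) * hE
  · field_simp
    grind

theorem jump_row_two (hs : a * ac - l * b * bc = 1)
    (he : e * e' = 1) (hA : A ≠ 0) (hAc : Ac ≠ 0)
    (hHc : ac * A - l * bc * B ≠ 0) (hFc : ac * Ac + l * b * Bc * E' ≠ 0) :
    (ac * Z + e * (l * bc) * z) * ((ac - l * bc * (B / A) - l * (Bc / Ac) *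
        (a * (B / A) - b) * E') / (ac - l * bc * (B / A)))
      + (e' * B * Z + A * z) / (ac * A - l * bc * B) * (l * (Bc / Ac) * E' * e)
      = ((ac * Ac + l * b * Bc * E') * Z + e * (l * (a * Bc * E' + bc * Ac)) * z) / Ac ∧
    (ac * Z + e * (l * bc) * z)
        * -(B / A * e' / ((ac - l * bc * (B / A)) * (ac + l * b * (Bc / Ac) * E')))
      + (e' * B * Z + A * z) / (ac * A - l * bc * B) * (ac / (ac + l * b * (Bc / Ac) * E'))
      = z * Ac / (ac * Ac + l * b * Bc * E') := by
  set Hc := ac * A - l * bc * B with hHcd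
  set Fc := ac * Ac + l * b * Bc * E' with hFcd
  have e1 : ac + l * b * (Bc / Ac) * E' = Fc / Ac := by rw [hFcd]; field_simp
  have e2 : ac - l * bc * (B / A) = Hc / A := by rw [hHcd]; field_simp
  rw [e1, e2]
  constructor
  · field_simp
    linear_combination l * B * Bc * E' * Z * he
      - (l * B * Bc * E' * Z + e * l * A * Bc * E' * z) * hs
  · field_simp
    grind

theorem jump_row_three (hs : a * ac - l * b * bc = 1) (hS : A * Ac - l * B * Bc = 1)
    (he : e * e' = 1) (hA : A ≠ 0) (hAc : Ac ≠ 0)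
    (hHc : ac * A - l * bc * B ≠ 0) (hH : a * Ac - l * b * Bc ≠ 0) :
    (ac * Z + e * (l * bc) * z) * ((1 - l * (B / A) * (Bc / Ac)) /
        ((a - l * b * (Bc / Ac)) * (ac - l * bc * (B / A))))
      + (e' * B * Z + A * z) / (ac * A - l * bc * B)
        * (l * (ac * (Bc / Ac) - bc) * e / (a - l * b * (Bc / Ac)))
      = (Ac * Z + e * (l * Bc) * z) / (a * Ac - l * b * Bc) ∧
    (ac * Z + e * (l * bc) * z) * -((a * (B / A) - b) * e' / (ac - l * bc * (B / A)))
      + (e' * B * Z + A * z) / (ac * A - l * bc * B) * 1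
      = e' * b * Z + a * z := by
  set Hc := ac * A - l * bc * B with hHcd
  set H := a * Ac - l * b * Bc with hHd
  have e1 : a - l * b * (Bc / Ac) = H / Ac := by rw [hHd]; field_simp
  have e2 : ac - l * bc * (B / A) = Hc / A := by rw [hHcd]; field_simp
  rw [e1, e2]
  constructor
  · field_simp
    grind
  · field_simp
    grind

end

/-! ### The solution of the Riemann-Hilbert problem -/

/-- The first column that corresponds to the second column `f` by symmetry. -/
noncomputable def symCol (lam : ℝ) (f : Fin 2 → ℂ → ℂ) (i : Fin 2) (k : ℂ) : ℂ :=
  (![schwarz (f 1) k, lam * schwarz (f 0) k] : Fin 2 → ℂ) i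

/-- Conjugation exchanges the two basis columns and turns e^{-2iθ} into e^{2iθ}. It expresses the
first columns U, V, Y in terms of Z and z. -/
theorem symCol_eq {lam : ℝ} {x t : ℝ} {f g : Fin 2 → ℂ → ℂ}
    {p s : ℂ → ℂ}
    (h : ∀ k, ∀ i, f i k = Complex.exp (-(2 * Complex.I * theta x t k)) * p k * symCol lam g i k
      + s k * g i k) (k : ℂ) (i : Fin 2) :
    symCol lam f i k = schwarz s k * symCol lam g i k
      + Complex.exp (2 * Complex.I * theta x t k) * (lam * schwarz p k) * g i k := by
  have e : conj (Complex.exp (-(2 * Complex.I * theta x t (conj k))))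
      = Complex.exp (2 * Complex.I * theta x t k) := by
    rw [← Complex.exp_conj]
    simp [theta, show conj (2 : ℂ) = 2 from Complex.conj_ofNat 2]
  fin_cases i
  · simp only [symCol, schwarz, Fin.zero_eta, Matrix.cons_val_zero]
    rw [h (conj k) 1]
    simp only [symCol, schwarz, Matrix.cons_val_one, Matrix.cons_val_fin_one, map_add, map_mul,
      Complex.conj_conj, Complex.conj_ofReal, e]
    ring
  · simp only [symCol, schwarz, Fin.mk_one, Matrix.cons_val_one]
    rw [h (conj k) 0]
    simp only [symCol, schwarz, Matrix.cons_val_zero, map_add, map_mul, Complex.conj_conj, e]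
    ring

/-- The solution in the quadrants. -/
noncomputable def quadSol (lam L : ℝ) (a b A B : ℂ → ℂ) (c : Fin 4 → Fin 2 → ℂ → ℂ) (n : Fin 4)
    (k : ℂ) : Mat :=
  (![Matrix.of fun i => ![symCol lam (c 3) i k * A k / specF lam L a b A B k, c 0 i k / A k],
     Matrix.of fun i => ![symCol lam (c 2) i k / specH lam a b A B k, c 1 i k],
     Matrix.of fun i => ![symCol lam (c 1) i k, c 2 i k / schwarz (specH lam a b A B) k],
     Matrix.of fun i => ![symCol lam (c 0) i k / schwarz A k,
       c 3 i k * schwarz A k / schwarz (specF lam L a b A B) k]] : Fin 4 → Mat) n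

/-- The denominators in `quadSol`. -/
noncomputable def quadDen (lam L : ℝ) (a b A B : ℂ → ℂ) (n : Fin 4) (k : ℂ) : ℂ :=
  (![A k * specF lam L a b A B k, specH lam a b A B k, schwarz (specH lam a b A B) k,
    schwarz A k * schwarz (specF lam L a b A B) k] : Fin 4 → ℂ) n

/-- The solution of the Riemann-Hilbert problem. -/
noncomputable def rhpSol (lam L : ℝ) (a b A B : ℂ → ℂ) (c : Fin 4 → Fin 2 → ℂ → ℂ) (k : ℂ) : Mat :=
  if 0 < k.im then if 0 < k.re then quadSol lam L a b A B c 0 k else quadSol lam L a b A B c 1 k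
  else if 0 < k.re then quadSol lam L a b A B c 3 k else quadSol lam L a b A B c 2 k

theorem conj_mem_quadrant {n : Fin 4} {k : ℂ} : conj k ∈ quadrant n ↔ k ∈ quadrant n.rev := by
  fin_cases n
  · simp [mem_quadrant_zero, show Fin.rev (0 : Fin 4) = 3 from rfl, mem_quadrant_three]
  · simp [mem_quadrant_one, show Fin.rev (1 : Fin 4) = 2 from rfl, mem_quadrant_two]
  · simp [mem_quadrant_two, show Fin.rev (2 : Fin 4) = 1 from rfl, mem_quadrant_one]
  · simp [mem_quadrant_three, show Fin.rev (3 : Fin 4) = 0 from rfl, mem_quadrant_zero]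

theorem isOpen_quadrant (n : Fin 4) : IsOpen (quadrant n) := by
  have h1 : IsOpen {k : ℂ | 0 < k.re} := isOpen_lt continuous_const Complex.continuous_re
  have h2 : IsOpen {k : ℂ | k.re < 0} := isOpen_lt Complex.continuous_re continuous_const
  have h3 : IsOpen {k : ℂ | 0 < k.im} := isOpen_lt continuous_const Complex.continuous_im
  have h4 : IsOpen {k : ℂ | k.im < 0} := isOpen_lt Complex.continuous_im continuous_const
  fin_cases n
  exacts [h1.inter h3, h2.inter h3, h2.inter h4, h1.inter h4]

theorem exists_mem_quadrant {k : ℂ} (hk : k ∉ contour) : ∃ n, k ∈ quadrant n := by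
  simp only [contour, Set.mem_ofPred_eq, not_or] at hk
  rcases lt_or_gt_of_ne hk.1 with h1 | h1 <;> rcases lt_or_gt_of_ne hk.2 with h2 | h2
  exacts [⟨2, h2, h1⟩, ⟨3, h2, h1⟩, ⟨1, h2, h1⟩, ⟨0, h2, h1⟩]

theorem notMem_contour_of_mem_quadrant {n : Fin 4} {k : ℂ} (hk : k ∈ quadrant n) :
    k ∉ contour := by
  fin_cases n <;> rintro (h | h) <;> simp [quadrant, h] at hk

section

variable {lam L : ℝ} {a b A B : ℂ → ℂ} {c : Fin 4 → Fin 2 → ℂ → ℂ}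

theorem rhpSol_eq {n : Fin 4} {k : ℂ} (hk : k ∈ quadrant n) :
    rhpSol lam L a b A B c k = quadSol lam L a b A B c n k := by
  fin_cases n
  · obtain ⟨h1, h2⟩ := mem_quadrant_zero.1 hk
    simp [rhpSol, h1, h2]
  · obtain ⟨h1, h2⟩ := mem_quadrant_one.1 hk
    simp [rhpSol, h1.le, h2]
  · obtain ⟨h1, h2⟩ := mem_quadrant_two.1 hk
    rw [rhpSol, if_neg h2.not_gt, if_neg h1.not_gt]
    rfl
  · obtain ⟨h1, h2⟩ := mem_quadrant_three.1 hk
    simp [rhpSol, h1, h2.le]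

theorem rhpSol_eventuallyEq {n : Fin 4} {k : ℂ} (hk : k ∈ quadrant n) :
    rhpSol lam L a b A B c =ᶠ[𝓝 k] quadSol lam L a b A B c n :=
  ((isOpen_quadrant n).eventually_mem hk).mono fun _ => rhpSol_eq

/-- `Fin.rev` exchanges D₁ with D₄ and D₂ with D₃, as complex conjugation does. Hence statements
about m need proof only in D₁ and D₂. -/
theorem symMat_quadSol (hl : (lam : ℂ) * lam = 1) (n : Fin 4) (k : ℂ) :
    symMat lam (quadSol lam L a b A B c n (conj k)) = quadSol lam L a b A B c n.rev k := by
  fin_cases n <;> ext i j <;> fin_cases i <;> fin_cases j <;>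
    simp [symMat, quadSol, symCol, schwarz, Fin.rev, ← mul_div_assoc, ← mul_assoc, hl]

theorem schwarz_quadDen (n : Fin 4) (k : ℂ) :
    quadDen lam L a b A B n (conj k) = conj (quadDen lam L a b A B n.rev k) := by
  fin_cases n <;> simp [quadDen, schwarz, Fin.rev]

theorem rhpSol_symm (hl : (lam : ℂ) * lam = 1) {k : ℂ} (hk : k ∉ contour) :
    rhpSol lam L a b A B c k = symMat lam (rhpSol lam L a b A B c (conj k)) := by
  obtain ⟨n, hn⟩ := exists_mem_quadrant hk
  have h2 : conj k ∈ quadrant n.rev := by rw [conj_mem_quadrant, Fin.rev_rev]; exact hn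
  rw [rhpSol_eq hn, rhpSol_eq h2, symMat_quadSol hl, Fin.rev_rev]

end

namespace IsRHPData

variable {lam L T x t : ℝ} {q₀ : ℂ} {a b A B Γ : ℂ → ℂ} {c : Fin 4 → Fin 2 → ℂ → ℂ}

theorem differentiable_symCol (h : IsRHPData lam L T x t q₀ a b A B c) (n : Fin 4) (i : Fin 2) :
    Differentiable ℂ (symCol lam (c n) i) := by
  fin_cases i
  · exact differentiable_schwarz (h.diff_c n 1)
  · exact (differentiable_schwarz (h.diff_c n 0)).const_mul _

theorem analyticAt_quadSol (h : IsRHPData lam L T x t q₀ a b A B c) {n : Fin 4} {k : ℂ}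
    (hk : quadDen lam L a b A B n k ≠ 0) (i j : Fin 2) :
    AnalyticAt ℂ (fun k => quadSol lam L a b A B c n k i j) k := by
  have hA := h.diff_A.analyticAt k
  have hF := h.differentiable_specF.analyticAt k
  have hH := h.differentiable_specH.analyticAt k
  have hA' := (differentiable_schwarz h.diff_A).analyticAt k
  have hF' := (differentiable_schwarz h.differentiable_specF).analyticAt k
  have hH' := (differentiable_schwarz h.differentiable_specH).analyticAt k
  have hc := fun n => (h.diff_c n i).analyticAt k
  have hs := fun n => (h.differentiable_symCol n i).analyticAt k
  fin_cases n
  · obtain ⟨h1, h2⟩ := mul_ne_zero_iff.1 hk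
    fin_cases j
    exacts [((hs 3).mul hA).div hF h2, (hc 0).div hA h1]
  · fin_cases j
    exacts [(hs 2).div hH hk, hc 1]
  · fin_cases j
    exacts [hs 1, (hc 2).div hH' hk]
  · obtain ⟨h1, h2⟩ := mul_ne_zero_iff.1 hk
    fin_cases j
    exacts [(hs 0).div hA' h1, ((hc 3).mul hA').div hF' h2]

theorem quadDen_ne_zero_of_mem_contour (h : IsRHPData lam L T x t q₀ a b A B c)
    (hΓ : Γ = fun k => B k / A k) (hP : PoleAssumption lam L a b Γ) {k : ℂ} (hk : k ∈ contour)
    (n : Fin 4) : quadDen lam L a b A B n k ≠ 0 := by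
  obtain ⟨h1, h2, h3⟩ := h.ne_zero_of_mem_contour hΓ hP hk
  obtain ⟨g1, g2, g3⟩ := h.ne_zero_of_mem_contour hΓ hP (conj_mem_contour.2 hk)
  fin_cases n
  · exact mul_ne_zero h1 h2
  · exact h3
  · exact (map_ne_zero _).2 g3
  · exact mul_ne_zero ((map_ne_zero _).2 g1) ((map_ne_zero _).2 g2)

theorem quadDen_ne_zero (h : IsRHPData lam L T x t q₀ a b A B c)
    (hΓ : Γ = fun k => B k / A k) (hP : PoleAssumption lam L a b Γ) {n : Fin 4} {k : ℂ}
    (hk : k ∈ quadrant n) (hkP : k ∉ poleSet lam L a b Γ) : quadDen lam L a b A B n k ≠ 0 := by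
  have key : ∀ w ∉ poleSet lam L a b Γ, (w ∈ quadrant 0 → quadDen lam L a b A B 0 w ≠ 0) ∧
      (w ∈ quadrant 1 → quadDen lam L a b A B 1 w ≠ 0) := fun w hw => by
    refine ⟨fun h0 => mul_ne_zero (fun hA => ?_) (fun hF => ?_), fun h1 hH => ?_⟩
    · exact hw (Or.inl (Or.inl (Or.inl ((h.mem_gammaPoles_iff hΓ).2 ⟨h0, hA⟩))))
    · exact hw (Or.inl (Or.inl (Or.inr ((h.mem_etaPoles_iff hΓ hP).2 ⟨h0, hF⟩))))
    · exact hw (Or.inl (Or.inr ((h.mem_xiPoles_iff hΓ).2 ⟨h1, hH⟩)))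
  have hconj : ∀ n : Fin 4, quadDen lam L a b A B n.rev (conj k) ≠ 0 →
      quadDen lam L a b A B n k ≠ 0 := fun n hn => by
    rw [schwarz_quadDen, Fin.rev_rev] at hn
    exact (map_ne_zero _).1 hn
  have hkP' : conj k ∉ poleSet lam L a b Γ := fun h' => hkP (conj_mem_poleSet.1 h')
  fin_cases n
  · exact (key k hkP).1 hk
  · exact (key k hkP).2 hk
  · exact hconj 2 ((key _ hkP').2 (conj_mem_quadrant.2 hk))
  · exact hconj 3 ((key _ hkP').1 (conj_mem_quadrant.2 hk))

/-- From det(Z,z) = 1 the scattering relations give det(Z,u) = F in D₁ and det(Y,v) = a Ā - lam b B̄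
= H in D₂; the scalar factors in the columns divide out exactly these. -/
theorem det_quadSol (h : IsRHPData lam L T x t q₀ a b A B c) {n : Fin 4} {k : ℂ}
    (hk : quadDen lam L a b A B n k ≠ 0) : (quadSol lam L a b A B c n k).det = 1 := by
  have key : ∀ w, (quadDen lam L a b A B 0 w ≠ 0 → (quadSol lam L a b A B c 0 w).det = 1) ∧
      (quadDen lam L a b A B 1 w ≠ 0 → (quadSol lam L a b A B c 1 w).det = 1) := fun w => by
    have hz : c 3 1 w * symCol lam (c 3) 0 w - c 3 0 w * symCol lam (c 3) 1 w = 1 := by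
      simp only [symCol, Matrix.cons_val_zero, Matrix.cons_val_one]
      linear_combination h.det_z w
    constructor
    · intro hw
      obtain ⟨h1, h2⟩ := mul_ne_zero_iff.1 hw
      have u0 : c 0 0 w = _ * symCol lam (c 3) 0 w + _ := h.u_eq w 0
      have u1 : c 0 1 w = _ * symCol lam (c 3) 1 w + _ := h.u_eq w 1
      rw [Matrix.det_fin_two]
      simp only [quadSol, Matrix.cons_val_zero, Matrix.of_apply, Matrix.cons_val_one]
      rw [u0, u1]
      field_simp
      linear_combination specF lam L a b A B w * hz
    · intro hw
      change specH lam a b A B w ≠ 0 at hw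
      have v0 : c 1 0 w = _ * symCol lam (c 3) 0 w + _ := h.v_eq w 0
      have v1 : c 1 1 w = _ * symCol lam (c 3) 1 w + _ := h.v_eq w 1
      have y := symCol_eq (p := B) (s := A) h.y_eq w
      rw [Matrix.det_fin_two]
      simp only [quadSol, Matrix.cons_val_zero, Matrix.of_apply, Matrix.cons_val_one]
      rw [v0, v1, y, y]
      field_simp
      rw [specH]
      linear_combination (a w * schwarz A w - lam * b w * schwarz B w) * hz
        + (symCol lam (c 3) 0 w * c 3 1 w - symCol lam (c 3) 1 w * c 3 0 w) * (-lam)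
          * schwarz B w * b w * exp_mul_exp_neg (2 * Complex.I * theta x t w)
  have hconj : ∀ n : Fin 4, quadDen lam L a b A B n k ≠ 0 →
      quadDen lam L a b A B n.rev (conj k) ≠ 0 := fun n hn => by
    rw [schwarz_quadDen, Fin.rev_rev]
    exact (map_ne_zero _).2 hn
  have hdet : ∀ n : Fin 4, (quadSol lam L a b A B c n.rev (conj k)).det = 1 →
      (quadSol lam L a b A B c n k).det = 1 := fun n hn => by
    have hs := symMat_quadSol (L := L) (a := a) (b := b) (A := A) (B := B) (c := c)
      h.lam_mul_self n.rev k
    rw [Fin.rev_rev] at hs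
    rw [← hs]
    rw [Matrix.det_fin_two] at hn ⊢
    have := congrArg conj hn
    simp only [map_sub, map_mul, map_one] at this
    simp only [symMat, Matrix.of_apply, Matrix.cons_val', Matrix.cons_val_zero,
      Matrix.cons_val_one, Matrix.cons_val_fin_one]
    linear_combination this - conj (quadSol lam L a b A B c n.rev (conj k) 1 0)
      * conj (quadSol lam L a b A B c n.rev (conj k) 0 1) * h.lam_mul_self
  fin_cases n
  · exact (key k).1 hk
  · exact (key k).2 hk
  · exact hdet 2 ((key _).2 (hconj 2 hk))
  · exact hdet 3 ((key _).1 (hconj 3 hk))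

/-- The four expressions are defined on the whole plane, so the jump relations are identities
wherever no denominator vanishes, not only on the rays. -/
theorem quadSol_jump (h : IsRHPData lam L T x t q₀ a b A B c)
    (hΓ : Γ = fun k => B k / A k) {k : ℂ}
    (hk : ∀ n, quadDen lam L a b A B n k ≠ 0) :
    quadSol lam L a b A B c 1 k = quadSol lam L a b A B c 0 k * jump lam L a b Γ x t 0 k ∧
    quadSol lam L a b A B c 3 k = quadSol lam L a b A B c 0 k * jump lam L a b Γ x t 1 k ∧
    quadSol lam L a b A B c 3 k = quadSol lam L a b A B c 2 k * jump lam L a b Γ x t 2 k ∧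
    quadSol lam L a b A B c 1 k = quadSol lam L a b A B c 2 k * jump lam L a b Γ x t 3 k := by
  obtain ⟨hA, hF⟩ := mul_ne_zero_iff.1 (hk 0)
  obtain ⟨hAc, hFc⟩ := mul_ne_zero_iff.1 (hk 3)
  have hH := hk 1
  have hHc := hk 2
  change specH lam a b A B k ≠ 0 at hH
  change schwarz (specH lam a b A B) k ≠ 0 at hHc
  have hG : Γ k = B k / A k := by rw [hΓ]
  have hGc : schwarz Γ k = schwarz B k / schwarz A k := by simp [hΓ, schwarz]
  have hs := h.det_s k
  have hS := h.det_S k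
  have he := exp_mul_exp_neg (2 * Complex.I * theta x t k)
  have hE := exp_mul_exp_neg (2 * Complex.I * k * L)
  have u : ∀ i, c 0 i k = _ * symCol lam (c 3) i k + _ := h.u_eq k
  have v : ∀ i, c 1 i k = _ * symCol lam (c 3) i k + _ := h.v_eq k
  have y : ∀ i, c 2 i k = _ * symCol lam (c 3) i k + _ := h.y_eq k
  have u' := symCol_eq h.u_eq k
  have v' := symCol_eq h.v_eq k
  have y' := symCol_eq h.y_eq k
  have hp : schwarz (fun k => schwarz a k * B k * Complex.exp (2 * Complex.I * k * L) + b k * A k) k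
      = a k * schwarz B k * Complex.exp (-(2 * Complex.I * k * L)) + schwarz b k * schwarz A k := by
    simp only [schwarz, map_add, map_mul, schwarz_exp, Complex.conj_conj]
  rw [schwarz_specF] at hFc
  rw [schwarz_specH] at hHc
  rw [specF] at hF
  rw [specH] at hH
  rw [hp] at u'
  refine ⟨?_, ?_, ?_, ?_⟩ <;> ext i j
  · obtain ⟨r0, r1⟩ := jump_row_zero (Z := symCol lam (c 3) i k) (z := c 3 i k) hs he hA hAc hF hH
    fin_cases j <;>
      simp only [Matrix.mul_apply, Fin.sum_univ_two, quadSol, jump, hG, hGc, Matrix.cons_val_zero,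
        Matrix.cons_val_one, Matrix.of_apply, Matrix.cons_val', Matrix.cons_val_fin_one,
        Fin.zero_eta, Fin.mk_one, u, v, y', specF, specH]
    exacts [r0.symm, r1.symm]
  · obtain ⟨r0, r1⟩ := jump_row_one (Z := symCol lam (c 3) i k) (z := c 3 i k) hs he hE hA hAc hF hFc
    fin_cases j <;>
      simp only [Matrix.mul_apply, Fin.sum_univ_two, quadSol, jump, hG, hGc, Matrix.cons_val_zero,
        Matrix.cons_val_one, Matrix.cons_val, Matrix.of_apply, Matrix.cons_val',
        Matrix.cons_val_fin_one, Fin.zero_eta, Fin.mk_one, u, u', schwarz_specF, specF]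
    exacts [r0.symm, r1.symm]
  · obtain ⟨r0, r1⟩ := jump_row_two (Z := symCol lam (c 3) i k) (z := c 3 i k) hs he hA hAc hHc hFc
    fin_cases j <;>
      simp only [Matrix.mul_apply, Fin.sum_univ_two, quadSol, jump, hG, hGc, Matrix.cons_val_zero,
        Matrix.cons_val_one, Matrix.cons_val, Matrix.of_apply, Matrix.cons_val',
        Matrix.cons_val_fin_one, Fin.zero_eta, Fin.mk_one, u', v', y, schwarz_specF, schwarz_specH]
    exacts [r0.symm, r1.symm]
  · obtain ⟨r0, r1⟩ := jump_row_three (Z := symCol lam (c 3) i k) (z := c 3 i k) hs hS he hA hAc hHc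
      hH
    fin_cases j <;>
      simp only [Matrix.mul_apply, Fin.sum_univ_two, quadSol, jump, hG, hGc, Matrix.cons_val_zero,
        Matrix.cons_val_one, Matrix.cons_val, Matrix.of_apply, Matrix.cons_val',
        Matrix.cons_val_fin_one, Fin.zero_eta, Fin.mk_one, v, v', y, y', schwarz_specH, specH]
    exacts [r0.symm, r1.symm]

end IsRHPData

/-! ### Verification of the conditions at infinity, at zero, at the poles and on the contour -/

theorem principal_compl_contour :
    𝓟 contourᶜ = 𝓟 (quadrant 0) ⊔ 𝓟 (quadrant 1) ⊔ 𝓟 (quadrant 2) ⊔ 𝓟 (quadrant 3) := by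
  simp only [sup_principal]
  congr 1
  ext k
  constructor
  · intro hk
    obtain ⟨n, hn⟩ := exists_mem_quadrant hk
    fin_cases n
    exacts [Or.inl (Or.inl (Or.inl hn)), Or.inl (Or.inl (Or.inr hn)), Or.inl (Or.inr hn), Or.inr hn]
  · rintro (((h | h) | h) | h) <;> exact notMem_contour_of_mem_quadrant h

theorem isBigO_compl_contour {l : Filter ℂ} {f g : ℂ → ℂ}
    (h : ∀ n, f =O[l ⊓ 𝓟 (quadrant n)] g) : f =O[l ⊓ 𝓟 contourᶜ] g := by
  rw [principal_compl_contour, inf_sup_left, inf_sup_left, inf_sup_left]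
  exact (((h 0).sup (h 1)).sup (h 2)).sup (h 3)

theorem tendsto_conj_nhdsNE (z : ℂ) : Tendsto (fun k : ℂ => conj k) (𝓝[≠] (conj z)) (𝓝[≠] z) := by
  refine tendsto_nhdsWithin_iff.2 ⟨?_, ?_⟩
  · have : Tendsto (fun k : ℂ => conj k) (𝓝 (conj z)) (𝓝 (conj (conj z))) :=
      Complex.continuous_conj.continuousAt
    rw [Complex.conj_conj] at this
    exact this.mono_left nhdsWithin_le_nhds
  · filter_upwards [self_mem_nhdsWithin] with k hk hk'
    exact hk (Set.mem_singleton_iff.2 (by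
      rw [← Complex.conj_conj k, Set.mem_singleton_iff.1 hk']))

/-- Symmetry turns a residue condition at `z` into one at the conjugate point. -/
theorem ResidueCondition_conj {lam : ℝ} (hl : (lam : ℂ) * lam = 1) {m : ℂ → Mat} {z r : ℂ}
    (hm : ∀ᶠ k in 𝓝[≠] (conj z), m k = symMat lam (m (conj k)))
    (h : ResidueCondition m z 0 1 r) : ResidueCondition m (conj z) 1 0 (lam * conj r) := by
  obtain ⟨w, hw⟩ := h
  have hc := tendsto_conj_nhdsNE z
  have hconj : ∀ {f : ℂ → ℂ} {v : ℂ}, Tendsto f (𝓝[≠] z) (𝓝 v) →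
      Tendsto (fun k => conj (f (conj k))) (𝓝[≠] (conj z)) (𝓝 (conj v)) := fun hf =>
    (Complex.continuous_conj.tendsto _).comp (hf.comp hc)
  have d0 := hconj (hw 0).1
  have d1 := hconj (hw 1).1
  have e0 := hconj (hw 0).2
  have e1 := hconj (hw 1).2
  refine ⟨![conj (w 1), lam * conj (w 0)], fun i => ?_⟩
  fin_cases i
  · constructor
    · refine d1.congr' ?_
      filter_upwards [hm] with k hk
      rw [hk]; rfl
    · have := e1.const_mul (lam : ℂ)
      refine (this.congr' ?_).trans_eq ?_
      · filter_upwards [hm] with k hk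
        rw [hk]
        simp [symMat]
        ring
      · simp
        ring_nf
  · constructor
    · refine (d0.const_mul (lam : ℂ)).congr' ?_
      filter_upwards [hm] with k hk
      rw [hk]; rfl
    · refine (e0.congr' ?_).trans_eq ?_
      · filter_upwards [hm] with k hk
        rw [hk]
        simp [symMat]
      · congr 1
        simp
        linear_combination (-(conj (w 0) * conj r)) * hl

namespace IsRHPData

variable {lam L T x t : ℝ} {q₀ : ℂ} {a b A B Γ : ℂ → ℂ} {c : Fin 4 → Fin 2 → ℂ → ℂ}

/-- The reflected column of `c n` is controlled in the conjugate quadrant. This is why `quadSol`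
pairs `c n` with the reflection of `c n.rev`. -/
theorem asymp_symCol (h : IsRHPData lam L T x t q₀ a b A B c) (n : Fin 4) (i : Fin 2) :
    (fun k => symCol lam (c n) i k - (![1, 0] : Fin 2 → ℂ) i)
      =O[Bornology.cobounded ℂ ⊓ 𝓟 (quadrant n.rev)] fun k => k⁻¹ := by
  have hq : ∀ k ∈ quadrant n.rev, conj k ∈ quadrant n := fun k hk => conj_mem_quadrant.2 hk
  fin_cases i
  · simpa [symCol] using isBigO_schwarz hq (h.asymp_c n 1)
  · simpa [symCol] using (isBigO_schwarz hq (h.asymp_c n 0)).const_mul_left lam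

theorem asymp_quadSol (h : IsRHPData lam L T x t q₀ a b A B c) (n : Fin 4) (i j : Fin 2) :
    (fun k => quadSol lam L a b A B c n k i j - (1 : Mat) i j)
      =O[Bornology.cobounded ℂ ⊓ 𝓟 (quadrant n)] fun k => k⁻¹ := by
  have hl : ∀ n : Fin 4, Bornology.cobounded ℂ ⊓ 𝓟 (quadrant n) ≤ Bornology.cobounded ℂ :=
    fun n => inf_le_left
  have e0 : (1 : Mat) i 0 = (![1, 0] : Fin 2 → ℂ) i := by fin_cases i <;> rfl
  have e1 : (1 : Mat) i 1 = (![0, 1] : Fin 2 → ℂ) i := by fin_cases i <;> rfl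
  have q3 : ∀ k ∈ quadrant 3, conj k ∈ quadrant 0 := fun k hk => conj_mem_quadrant.2 hk
  have q2 : ∀ k ∈ quadrant 2, conj k ∈ quadrant 1 := fun k hk => conj_mem_quadrant.2 hk
  have hA' : (fun k => schwarz A k - 1) =O[Bornology.cobounded ℂ ⊓ 𝓟 (quadrant 3)] fun k => k⁻¹ := by
    simpa using isBigO_schwarz q3 h.asymp_A
  have hF' : (fun k => schwarz (specF lam L a b A B) k - 1)
      =O[Bornology.cobounded ℂ ⊓ 𝓟 (quadrant 3)] fun k => k⁻¹ := by
    simpa using isBigO_schwarz q3 h.asymp_F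
  have hH' : (fun k => schwarz (specH lam a b A B) k - 1)
      =O[Bornology.cobounded ℂ ⊓ 𝓟 (quadrant 2)] fun k => k⁻¹ := by
    simpa using isBigO_schwarz q2 h.asymp_H
  obtain rfl | rfl : j = 0 ∨ j = 1 := by fin_cases j <;> simp
  · simp only [e0]
    fin_cases n
    · simpa [quadSol, div_eq_mul_inv] using isBigO_mul_sub (hl 0)
        (isBigO_mul_sub (hl 0) (h.asymp_symCol 3 i) h.asymp_A) (isBigO_inv_sub (hl 0) h.asymp_F)
    · simpa [quadSol, div_eq_mul_inv] using isBigO_mul_sub (hl 1) (h.asymp_symCol 2 i)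
        (isBigO_inv_sub (hl 1) h.asymp_H)
    · simpa [quadSol] using h.asymp_symCol 1 i
    · simpa [quadSol, div_eq_mul_inv] using isBigO_mul_sub (hl 3) (h.asymp_symCol 0 i)
        (isBigO_inv_sub (hl 3) hA')
  · simp only [e1]
    fin_cases n
    · simpa [quadSol, div_eq_mul_inv] using isBigO_mul_sub (hl 0) (h.asymp_c 0 i)
        (isBigO_inv_sub (hl 0) h.asymp_A)
    · simpa [quadSol] using h.asymp_c 1 i
    · simpa [quadSol, div_eq_mul_inv] using isBigO_mul_sub (hl 2) (h.asymp_c 2 i)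
        (isBigO_inv_sub (hl 2) hH')
    · simpa [quadSol, div_eq_mul_inv] using isBigO_mul_sub (hl 3)
        (isBigO_mul_sub (hl 3) (h.asymp_c 3 i) hA') (isBigO_inv_sub (hl 3) hF')

/-- In each quadrant the (12) entry of m is that of the corner column times a factor tending to 1,
so the recovery formula is inherited. -/
theorem tendsto_rhpSol (h : IsRHPData lam L T x t q₀ a b A B c) (n : Fin 4)
    (hn : (x, t) ≠ corner L T n) {ε : ℝ} (hε : 0 < ε) :
    Tendsto (fun k => 2 * Complex.I * (k * rhpSol lam L a b A B c k 0 1))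
      (Bornology.cobounded ℂ ⊓ 𝓟 (sector ε n)) (𝓝 q₀) := by
  have hle : Bornology.cobounded ℂ ⊓ 𝓟 (sector ε n) ≤ Bornology.cobounded ℂ ⊓ 𝓟 (quadrant n) :=
    inf_le_inf_left _ (principal_mono.2 fun k hk => hk.1)
  have hl : Bornology.cobounded ℂ ⊓ 𝓟 (quadrant n) ≤ Bornology.cobounded ℂ := inf_le_left
  have hr := h.recovery n hn ε hε
  suffices hs : ∃ f : ℂ → ℂ, (∀ k, quadSol lam L a b A B c n k 0 1 = c n 0 k * f k) ∧
      Tendsto f (Bornology.cobounded ℂ ⊓ 𝓟 (quadrant n)) (𝓝 1) by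
    obtain ⟨f, hf, hf1⟩ := hs
    have := hr.mul (hf1.mono_left hle)
    rw [mul_one] at this
    refine this.congr' (eventually_inf_principal.2 (Eventually.of_forall fun k hk => ?_))
    simp only [rhpSol_eq hk.1, hf]
    ring
  have q3 : ∀ k ∈ quadrant 3, conj k ∈ quadrant 0 := fun k hk => conj_mem_quadrant.2 hk
  have q2 : ∀ k ∈ quadrant 2, conj k ∈ quadrant 1 := fun k hk => conj_mem_quadrant.2 hk
  fin_cases n
  · exact ⟨fun k => (A k)⁻¹, fun k => by simp [quadSol, div_eq_mul_inv],
      tendsto_of_isBigO_inv hl (isBigO_inv_sub hl h.asymp_A)⟩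
  · exact ⟨fun k => 1, fun k => by simp [quadSol], tendsto_const_nhds⟩
  · exact ⟨fun k => (schwarz (specH lam a b A B) k)⁻¹, fun k => by simp [quadSol, div_eq_mul_inv],
      tendsto_of_isBigO_inv hl (isBigO_inv_sub hl (by
        simpa using isBigO_schwarz q2 h.asymp_H))⟩
  · refine ⟨fun k => schwarz A k * (schwarz (specF lam L a b A B) k)⁻¹,
      fun k => by simp [quadSol, div_eq_mul_inv, mul_assoc], ?_⟩
    have h1 : Tendsto (schwarz A) (Bornology.cobounded ℂ ⊓ 𝓟 (quadrant 3)) (𝓝 (conj 1)) :=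
      tendsto_of_isBigO_inv hl (isBigO_schwarz q3 h.asymp_A)
    have h2 := tendsto_of_isBigO_inv hl (isBigO_inv_sub hl (f := schwarz (specF lam L a b A B)) (by
        simpa using isBigO_schwarz q3 h.asymp_F))
    simpa using h1.mul h2

theorem rhpSol_eventually_symm (h : IsRHPData lam L T x t q₀ a b A B c) {n : Fin 4} {z : ℂ}
    (hz : z ∈ quadrant n) : ∀ᶠ k in 𝓝[≠] (conj z), rhpSol lam L a b A B c k
      = symMat lam (rhpSol lam L a b A B c (conj k)) := by
  have h1 : conj z ∈ quadrant n.rev := by rw [conj_mem_quadrant, Fin.rev_rev]; exact hz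
  filter_upwards [nhdsWithin_le_nhds ((isOpen_quadrant n.rev).mem_nhds h1)] with k hk
  exact rhpSol_symm h.lam_mul_self (notMem_contour_of_mem_quadrant hk)

theorem residueCondition_eta (h : IsRHPData lam L T x t q₀ a b A B c)
    (hΓ : Γ = fun k => B k / A k) (hP : PoleAssumption lam L a b Γ) {z : ℂ}
    (hz : z ∈ etaPoles lam L a b Γ) : ResidueCondition (rhpSol lam L a b A B c) z 0 1
      (Complex.exp (2 * Complex.I * theta x t z) * residue (eta lam L a b Γ) z) := by
  obtain ⟨r, hr, hres⟩ := h.exists_residue_eta hΓ hP hz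
  obtain ⟨hq, hF⟩ := (h.mem_etaPoles_iff hΓ hP).1 hz
  have hA := fun hA => h.specF_ne_zero_of_A_eq_zero hΓ hP hq hA hF
  have hev : rhpSol lam L a b A B c =ᶠ[𝓝[≠] z] quadSol lam L a b A B c 0 :=
    (rhpSol_eventuallyEq hq).filter_mono nhdsWithin_le_nhds
  refine ⟨fun i => c 0 i z / A z, fun i => ⟨?_, ?_⟩⟩
  · have : Tendsto (fun k => c 0 i k / A k) (𝓝[≠] z) (𝓝 (c 0 i z / A z)) :=
      ((h.diff_c 0 i z).continuousAt.div (h.diff_A z).continuousAt hA).tendsto.mono_left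
        nhdsWithin_le_nhds
    refine this.congr' ?_
    filter_upwards [hev] with k hk
    rw [hk]
    simp [quadSol]
  · have h1 : Tendsto (fun k => symCol lam (c 3) i k * A k) (𝓝[≠] z)
        (𝓝 (symCol lam (c 3) i z * A z)) :=
      ((h.differentiable_symCol 3 i z).continuousAt.mul (h.diff_A z).continuousAt).tendsto.mono_left
        nhdsWithin_le_nhds
    refine ((h1.mul hr).congr' ?_).trans_eq ?_
    · filter_upwards [hev] with k hk
      rw [hk]
      simp [quadSol]
      ring
    -- At a zero of F, u = e^{-2iθ} Ḡ Z. The claim becomes Z A r = -lam G Ḡ A Z r, and `det_FG` with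
    -- F = 0 says -lam G Ḡ = 1.
    · congr 1
      have u : c 0 i z = _ * symCol lam (c 3) i z + _ := h.u_eq z i
      have hFG := h.det_FG z
      rw [schwarz_specG, hF] at hFG
      simp only [hres, u, hF]
      field_simp
      linear_combination r * symCol lam (c 3) i z * (-hFG + lam * specG L a b A B z
        * (b z * A z + schwarz a z * B z * Complex.exp (2 * Complex.I * z * L))
        * exp_mul_exp_neg (2 * Complex.I * theta x t z))

theorem residueCondition_xi (h : IsRHPData lam L T x t q₀ a b A B c)
    (hΓ : Γ = fun k => B k / A k) (hP : PoleAssumption lam L a b Γ) {z : ℂ}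
    (hz : z ∈ xiPoles lam a b Γ) : ResidueCondition (rhpSol lam L a b A B c) z 0 1
      (Complex.exp (2 * Complex.I * theta x t z) * residue (xi lam a b Γ) z) := by
  obtain ⟨r, hr, hres⟩ := h.exists_residue_xi hΓ hP hz
  obtain ⟨hq, hH⟩ := (h.mem_xiPoles_iff hΓ).1 hz
  have hev : rhpSol lam L a b A B c =ᶠ[𝓝[≠] z] quadSol lam L a b A B c 1 :=
    (rhpSol_eventuallyEq hq).filter_mono nhdsWithin_le_nhds
  refine ⟨fun i => c 1 i z, fun i => ⟨?_, ?_⟩⟩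
  · have : Tendsto (fun k => c 1 i k) (𝓝[≠] z) (𝓝 (c 1 i z)) :=
      (h.diff_c 1 i z).continuousAt.tendsto.mono_left nhdsWithin_le_nhds
    refine this.congr' ?_
    filter_upwards [hev] with k hk
    rw [hk]
    simp [quadSol]
  · have h1 : Tendsto (fun k => symCol lam (c 2) i k) (𝓝[≠] z)
        (𝓝 (symCol lam (c 2) i z)) :=
      (h.differentiable_symCol 2 i z).continuousAt.tendsto.mono_left nhdsWithin_le_nhds
    refine ((h1.mul hr).congr' ?_).trans_eq ?_
    · filter_upwards [hev] with k hk
      rw [hk]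
      simp [quadSol]
      ring
    -- At a zero of H the columns Y and v have determinant 0; the claim is Y = e^{2iθ} lam K v,
    -- which follows from H = 0 and `det_s`.
    · congr 1
      have v : c 1 i z = _ * symCol lam (c 3) i z + _ := h.v_eq z i
      have y := symCol_eq h.y_eq z i
      rw [specH] at hH
      simp only [hres, v, y, specK]
      linear_combination r * (symCol lam (c 3) i z * (-schwarz A z * h.det_s z + schwarz a z * hH)
        - lam * b z * (schwarz a z * schwarz B z - schwarz b z * schwarz A z)
          * symCol lam (c 3) i z * exp_mul_exp_neg (2 * Complex.I * theta x t z)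
        + Complex.exp (2 * Complex.I * theta x t z) * lam * c 3 i z
          * (-schwarz B z * h.det_s z + schwarz b z * hH))

/-- The first column carries the factor A over F ≠ 0, the second the factor 1/A, and A has a simple
zero. This compensation is the whole condition at the poles of Γ. -/
theorem isBigO_at_gamma (h : IsRHPData lam L T x t q₀ a b A B c)
    (hΓ : Γ = fun k => B k / A k) (hP : PoleAssumption lam L a b Γ) {z : ℂ}
    (hz : z ∈ gammaPoles Γ) (i : Fin 2) :
    ((fun k => rhpSol lam L a b A B c k i 0) =O[𝓝[≠] z] fun k => k - z) ∧
    ((fun k => rhpSol lam L a b A B c k i 1) =O[𝓝[≠] z] fun k => (k - z)⁻¹) := by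
  obtain ⟨r, hr⟩ := h.exists_residue_gamma hΓ hP hz
  obtain ⟨hq, hA⟩ := (h.mem_gammaPoles_iff hΓ).1 hz
  have hF := h.specF_ne_zero_of_A_eq_zero hΓ hP hq hA
  have hev : rhpSol lam L a b A B c =ᶠ[𝓝[≠] z] quadSol lam L a b A B c 0 :=
    (rhpSol_eventuallyEq hq).filter_mono nhdsWithin_le_nhds
  constructor
  · have h1 : (fun k => symCol lam (c 3) i k / specF lam L a b A B k) =O[𝓝[≠] z] fun _ => (1 : ℂ) :=
      (((h.differentiable_symCol 3 i z).continuousAt.div (h.differentiable_specF z).continuousAt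
        hF).tendsto.mono_left nhdsWithin_le_nhds).isBigO_one ℂ
    have h2 : (fun k => A k) =O[𝓝[≠] z] fun k => k - z := by
      simpa [hA] using (h.diff_A z).isBigO_sub.mono nhdsWithin_le_nhds
    refine ((h1.mul h2).congr_right fun k => one_mul _).congr' ?_ EventuallyEq.rfl
    filter_upwards [hev] with k hk
    rw [hk]
    simp [quadSol]
    ring
  · have h1 : (fun k => c 0 i k * ((k - z) / A k)) =O[𝓝[≠] z] fun _ => (1 : ℂ) :=
      (((h.diff_c 0 i z).continuousAt.tendsto.mono_left nhdsWithin_le_nhds).mul hr).isBigO_one ℂ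
    refine ((h1.mul (isBigO_refl (fun k => (k - z)⁻¹) _)).congr_right fun k =>
      one_mul _).congr' ?_ EventuallyEq.rfl
    filter_upwards [hev, self_mem_nhdsWithin] with k hk hkz
    have : k - z ≠ 0 := sub_ne_zero.2 hkz
    rw [hk]
    simp [quadSol]
    field_simp

theorem isBigO_at_gamma_conj (h : IsRHPData lam L T x t q₀ a b A B c)
    (hΓ : Γ = fun k => B k / A k) (hP : PoleAssumption lam L a b Γ) {z : ℂ}
    (hz : z ∈ gammaPoles Γ) (i : Fin 2) :
    ((fun k => rhpSol lam L a b A B c k i 0) =O[𝓝[≠] (conj z)] fun k => (k - conj z)⁻¹) ∧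
    ((fun k => rhpSol lam L a b A B c k i 1) =O[𝓝[≠] (conj z)] fun k => k - conj z) := by
  have hsym := h.rhpSol_eventually_symm hz.1
  have hc := tendsto_conj_nhdsNE z
  have hn : ∀ k : ℂ, ‖conj k - z‖ = ‖k - conj z‖ := fun k => by
    rw [← Complex.norm_conj, map_sub, Complex.conj_conj]
  have key : ∀ {f g : ℂ → ℂ}, f =O[𝓝[≠] z] (fun k => k - z) →
      (∀ᶠ k in 𝓝[≠] (conj z), ‖g k‖ = ‖f (conj k)‖) →
      g =O[𝓝[≠] (conj z)] fun k => k - conj z := fun hf hg =>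
    ((hf.comp_tendsto hc).norm_norm.congr' (hg.mono fun k hk => hk.symm)
      (Eventually.of_forall hn)).of_norm_norm
  have key' : ∀ {f g : ℂ → ℂ}, f =O[𝓝[≠] z] (fun k => (k - z)⁻¹) →
      (∀ᶠ k in 𝓝[≠] (conj z), ‖g k‖ = ‖f (conj k)‖) →
      g =O[𝓝[≠] (conj z)] fun k => (k - conj z)⁻¹ := fun hf hg =>
    ((hf.comp_tendsto hc).norm_norm.congr' (hg.mono fun k hk => hk.symm)
      (Eventually.of_forall fun k => by simp [hn])).of_norm_norm
  have hlam : |lam| = 1 := by rcases h.sign with h | h <;> simp [h]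
  have g := h.isBigO_at_gamma hΓ hP hz
  fin_cases i
  · refine ⟨key' (g 1).2 ?_, key (g 1).1 ?_⟩ <;> filter_upwards [hsym] with k hk <;> rw [hk] <;>
      simp [symMat, hlam]
  · refine ⟨key' (g 0).2 ?_, key (g 0).1 ?_⟩ <;> filter_upwards [hsym] with k hk <;> rw [hk] <;>
      simp [symMat, hlam]

theorem conj_exp_mul_residue (w : ℂ) : lam * conj (Complex.exp (2 * Complex.I * theta x t w) * q₀)
    = lam * Complex.exp (-(2 * Complex.I * theta x t (conj w))) * conj q₀ := by
  rw [map_mul, ← Complex.exp_conj]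
  simp [theta, show conj (2 : ℂ) = 2 from Complex.conj_ofNat 2]
  ring

theorem rhpSol_jump (h : IsRHPData lam L T x t q₀ a b A B c)
    (hΓ : Γ = fun k => B k / A k) (hP : PoleAssumption lam L a b Γ) :
    ∃ mp mm : ℂ → Mat,
    (∀ i j : Fin 2, ContinuousOn (fun k => mp k i j) (contour \ {0})) ∧
    (∀ i j : Fin 2, ContinuousOn (fun k => mm k i j) (contour \ {0})) ∧
    ∀ n : Fin 4, ∀ z ∈ ray n,
      (∀ i j : Fin 2, Tendsto (fun k => rhpSol lam L a b A B c k i j) (𝓝[leftQuadrant n] z)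
        (𝓝 (mp z i j))) ∧
      (∀ i j : Fin 2, Tendsto (fun k => rhpSol lam L a b A B c k i j) (𝓝[rightQuadrant n] z)
        (𝓝 (mm z i j))) ∧
      mm z = mp z * jump lam L a b Γ x t n z := by
  have hcont : ∀ n : Fin 4, ∀ z ∈ contour, ∀ i j,
      ContinuousAt (fun k => quadSol lam L a b A B c n k i j) z := fun n z hz i j =>
    (h.analyticAt_quadSol (h.quadDen_ne_zero_of_mem_contour hΓ hP hz n) i j).continuousAt
  have hglue : ∀ (p : ℂ → ℝ), Continuous p → (∀ z ∈ contour \ {0}, p z ≠ 0) → ∀ m n : Fin 4,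
      ∀ i j, ContinuousOn (fun k => (if 0 < p k then quadSol lam L a b A B c m k
        else quadSol lam L a b A B c n k) i j) (contour \ {0}) := by
    intro p hp hp0 m n i j z hz
    refine ContinuousAt.continuousWithinAt ?_
    rcases lt_or_gt_of_ne (hp0 z hz) with hneg | hpos
    · refine (hcont n z hz.1 i j).congr ?_
      filter_upwards [hp.continuousAt.eventually_lt continuousAt_const hneg] with k hk
      rw [if_neg hk.not_gt]
    · refine (hcont m z hz.1 i j).congr ?_
      filter_upwards [continuousAt_const.eventually_lt hp.continuousAt hpos] with k hk
      rw [if_pos hk]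
  have hlim : ∀ n : Fin 4, ∀ z ∈ contour, ∀ i j,
      Tendsto (fun k => rhpSol lam L a b A B c k i j) (𝓝[quadrant n] z)
        (𝓝 (quadSol lam L a b A B c n z i j)) := fun n z hz i j => by
    refine ((hcont n z hz i j).tendsto.mono_left nhdsWithin_le_nhds).congr' ?_
    filter_upwards [self_mem_nhdsWithin] with k hk
    rw [rhpSol_eq hk]
  have hsub : ∀ z : ℂ, z ∈ contour \ {0} → z.re + z.im ≠ 0 ∧ z.im - z.re ≠ 0 := by
    rintro z ⟨h1 | h1, h2⟩ <;> simp only [h1, add_zero, zero_add, zero_sub, sub_zero, neg_ne_zero,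
      and_self] <;> exact fun h0 => h2 (Complex.ext (by simp [h0, h1]) (by simp [h0, h1]))
  -- On Σ ∖ {0} the sign of Re k + Im k tells whether the left quadrant is D₁ or D₃, and the sign of
  -- Im k - Re k whether the right one is D₂ or D₄. Neither sum vanishes there, so the glued
  -- functions are continuous.
  refine ⟨fun k => if 0 < k.re + k.im then quadSol lam L a b A B c 0 k
      else quadSol lam L a b A B c 2 k,
    fun k => if 0 < k.im - k.re then quadSol lam L a b A B c 1 k
      else quadSol lam L a b A B c 3 k,
    hglue _ (by fun_prop) (fun z hz => (hsub z hz).1) 0 2,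
    hglue _ (by fun_prop) (fun z hz => (hsub z hz).2) 1 3, fun n z hz => ?_⟩
  have hzc : z ∈ contour := by
    fin_cases n
    exacts [Or.inr hz.1, Or.inl hz.2, Or.inr hz.1, Or.inl hz.2]
  obtain ⟨j0, j1, j2, j3⟩ := h.quadSol_jump hΓ fun n =>
    h.quadDen_ne_zero_of_mem_contour hΓ hP hzc n
  fin_cases n
  · have p1 : 0 < z.re + z.im := by have := hz.1; have := hz.2; linarith
    have p2 : 0 < z.im - z.re := by have := hz.1; have := hz.2; linarith
    simp only [if_pos p1, if_pos p2]
    exact ⟨hlim 0 z hzc, hlim 1 z hzc, j0⟩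
  · have p1 : 0 < z.re + z.im := by have := hz.1; have := hz.2; linarith
    have p2 : ¬ 0 < z.im - z.re := by have := hz.1; have := hz.2; linarith
    simp only [if_pos p1, if_neg p2]
    exact ⟨hlim 0 z hzc, hlim 3 z hzc, j1⟩
  · have p1 : ¬ 0 < z.re + z.im := by have := hz.1; have := hz.2; linarith
    have p2 : ¬ 0 < z.im - z.re := by have := hz.1; have := hz.2; linarith
    simp only [if_neg p1, if_neg p2]
    exact ⟨hlim 2 z hzc, hlim 3 z hzc, j2⟩
  · have p1 : ¬ 0 < z.re + z.im := by have := hz.1; have := hz.2; linarith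
    have p2 : 0 < z.im - z.re := by have := hz.1; have := hz.2; linarith
    simp only [if_neg p1, if_pos p2]
    exact ⟨hlim 2 z hzc, hlim 1 z hzc, j3⟩

theorem solvesRHP (h : IsRHPData lam L T x t q₀ a b A B c)
    (hΓ : Γ = fun k => B k / A k) (hP : PoleAssumption lam L a b Γ) :
    SolvesRHP lam L a b Γ x t (rhpSol lam L a b A B c) where
  analytic i j k hk := by
    obtain ⟨n, hn⟩ := exists_mem_quadrant fun h' => hk (Or.inl h')
    refine (h.analyticAt_quadSol
      (h.quadDen_ne_zero hΓ hP hn fun h' => hk (Or.inr h')) i j).congr ?_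
    filter_upwards [rhpSol_eventuallyEq hn] with k hk
    rw [hk]
  jump_relation := h.rhpSol_jump hΓ hP
  at_infinity i j := isBigO_compl_contour fun n => by
    refine (h.asymp_quadSol n i j).congr' ?_ EventuallyEq.rfl
    refine eventually_inf_principal.2 (Eventually.of_forall fun k hk => ?_)
    simp only [rhpSol_eq hk]
  at_zero i j := isBigO_compl_contour fun n => by
    have h0 : (0 : ℂ) ∈ contour := Or.inl rfl
    have := (h.analyticAt_quadSol (h.quadDen_ne_zero_of_mem_contour hΓ hP h0 n) i
      j).continuousAt.tendsto.isBigO_one ℂ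
    refine (this.mono (inf_le_left : 𝓝 (0 : ℂ) ⊓ 𝓟 (quadrant n) ≤ _)).congr' ?_ EventuallyEq.rfl
    refine eventually_inf_principal.2 (Eventually.of_forall fun k hk => ?_)
    simp only [rhpSol_eq hk]
  at_gamma z hz := h.isBigO_at_gamma hΓ hP hz
  at_gamma_conj z hz := h.isBigO_at_gamma_conj hΓ hP hz
  at_eta z hz := h.residueCondition_eta hΓ hP hz
  at_eta_conj z hz := by
    have := ResidueCondition_conj h.lam_mul_self (h.rhpSol_eventually_symm hz.1)
      (h.residueCondition_eta hΓ hP hz)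
    rwa [conj_exp_mul_residue] at this
  at_xi z hz := h.residueCondition_xi hΓ hP hz
  at_xi_conj z hz := by
    have := ResidueCondition_conj h.lam_mul_self (h.rhpSol_eventually_symm hz.1)
      (h.residueCondition_xi hΓ hP hz)
    rwa [conj_exp_mul_residue] at this

end IsRHPData

/-! ### Removable lines and points -/

theorem rect_subset {U : Set ℂ} {z w z' w' : ℂ} (h : Complex.Rectangle z w ⊆ U)
    (hz : z' ∈ Complex.Rectangle z w) (hw : w' ∈ Complex.Rectangle z w) :
    Complex.Rectangle z' w' ⊆ U := by
  refine Set.Subset.trans (Set.inter_subset_inter (Set.preimage_mono ?_) (Set.preimage_mono ?_)) h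
  · exact Set.uIcc_subset_uIcc hz.1 hw.1
  · exact Set.uIcc_subset_uIcc hz.2 hw.2

/-- A continuous function that is holomorphic off the real line is holomorphic. -/
theorem differentiableOn_of_off_real {U : Set ℂ} (hU : IsOpen U) {f : ℂ → ℂ}
    (hf : ContinuousOn f U) (hd : ∀ k ∈ U, k.im ≠ 0 → DifferentiableAt ℂ f k) :
    DifferentiableOn ℂ f U := by
  refine (Complex.isConservativeOn_and_continuousOn_iff_isDifferentiableOn hU).1 ⟨?_, hf⟩
  have key : ∀ z w : ℂ, Complex.Rectangle z w ⊆ U →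
      (0 : ℝ) ∉ Set.Ioo (min z.im w.im) (max z.im w.im) →
      (∫ x : ℝ in z.re..w.re, f (x + z.im * Complex.I))
        - (∫ x : ℝ in z.re..w.re, f (x + w.im * Complex.I))
        + Complex.I • (∫ y : ℝ in z.im..w.im, f (w.re + y * Complex.I))
        - Complex.I • (∫ y : ℝ in z.im..w.im, f (z.re + y * Complex.I)) = 0 := by
    intro z w hzw h0
    refine Complex.integral_boundary_rect_eq_zero_of_continuousOn_of_differentiableOn f z w
      (hf.mono hzw) fun k hk => (hd k ?_ fun h => h0 (h ▸ hk.2)).differentiableWithinAt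
    exact hzw ⟨Set.Ioo_subset_Icc_self hk.1, Set.Ioo_subset_Icc_self hk.2⟩
  intro z w hzw
  rw [eq_neg_iff_add_eq_zero, Complex.wedgeIntegral_add_wedgeIntegral_eq]
  -- Morera: a rectangle meeting the real line is cut along it. The open halves avoid the line and f
  -- is continuous up to the boundary, so Cauchy's theorem applies to each half.
  by_cases h0 : (0 : ℝ) ∈ Set.uIcc z.im w.im
  · have hz1 : (⟨z.re, 0⟩ : ℂ) ∈ Complex.Rectangle z w := ⟨Set.left_mem_uIcc, h0⟩
    have hw1 : (⟨w.re, 0⟩ : ℂ) ∈ Complex.Rectangle z w := ⟨Set.right_mem_uIcc, h0⟩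
    have hz : z ∈ Complex.Rectangle z w := ⟨Set.left_mem_uIcc, Set.left_mem_uIcc⟩
    have hw : w ∈ Complex.Rectangle z w := ⟨Set.right_mem_uIcc, Set.right_mem_uIcc⟩
    have k1 := key z ⟨w.re, 0⟩ (rect_subset hzw hz hw1) (by
      simpa using fun h : z.im < 0 => h.le)
    have k2 := key ⟨z.re, 0⟩ w (rect_subset hzw hz1 hw) (by
      simpa using fun h : w.im < 0 => h.le)
    have hint : ∀ x ∈ Set.uIcc z.re w.re, ∀ p ∈ Set.uIcc z.im w.im, ∀ q ∈ Set.uIcc z.im w.im,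
        IntervalIntegrable (fun y : ℝ => f (x + y * Complex.I)) MeasureTheory.volume p q := by
      intro x hx p hp q hq
      refine ContinuousOn.intervalIntegrable (hf.comp (by fun_prop) fun y hy => hzw ?_)
      have : y ∈ Set.uIcc z.im w.im := Set.uIcc_subset_uIcc hp hq hy
      exact ⟨by simpa using hx, by simpa using this⟩
    have s1 := intervalIntegral.integral_add_adjacent_intervals
      (hint w.re Set.right_mem_uIcc _ Set.left_mem_uIcc _ h0)
      (hint w.re Set.right_mem_uIcc _ h0 _ Set.right_mem_uIcc)
    have s2 := intervalIntegral.integral_add_adjacent_intervals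
      (hint z.re Set.left_mem_uIcc _ Set.left_mem_uIcc _ h0)
      (hint z.re Set.left_mem_uIcc _ h0 _ Set.right_mem_uIcc)
    rw [← s1, ← s2]
    simp only [smul_eq_mul] at k1 k2 ⊢
    linear_combination k1 + k2
  · exact key z w hzw fun h => h0 (Set.Ioo_subset_Icc_self h)

/-- Rotation: apply the real case to k ↦ f(ik). -/
theorem differentiableOn_of_off_imag {U : Set ℂ} (hU : IsOpen U) {f : ℂ → ℂ}
    (hf : ContinuousOn f U) (hd : ∀ k ∈ U, k.re ≠ 0 → DifferentiableAt ℂ f k) :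
    DifferentiableOn ℂ f U := by
  have hI : ∀ k : ℂ, Complex.I * (-Complex.I * k) = k := fun k => by
    rw [← mul_assoc]; simp
  have h := differentiableOn_of_off_real (U := (fun k => Complex.I * k) ⁻¹' U)
    (f := fun k => f (Complex.I * k)) (hU.preimage (by fun_prop))
    (hf.comp (by fun_prop) fun k hk => hk) fun k hk hk0 =>
      (hd (Complex.I * k) hk (by simpa using hk0)).comp k (by fun_prop)
  have h2 : DifferentiableOn ℂ (fun k => f (Complex.I * (-Complex.I * k))) U :=
    h.comp (g := fun k => f (Complex.I * k)) (f := fun k => -Complex.I * k) (by fun_prop)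
      fun k hk => by simpa only [Set.mem_preimage, hI] using hk
  simpa only [hI] using h2

/-- Removal of finitely many isolated singularities. -/
theorem exists_differentiable_of_finite {S : Set ℂ} (hS : S.Finite) {f : ℂ → ℂ}
    (hd : ∀ k ∉ S, DifferentiableAt ℂ f k)
    (h0 : ∀ z ∈ S, Tendsto (fun k => (k - z) * f k) (𝓝[≠] z) (𝓝 0)) :
    ∃ g : ℂ → ℂ, Differentiable ℂ g ∧ Set.EqOn g f Sᶜ := by
  classical
  refine ⟨fun k => if k ∈ S then limUnder (𝓝[≠] k) f else f k, fun z => ?_, fun k hk => if_neg hk⟩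
  have hU : IsOpen (S \ {z})ᶜ := (hS.sdiff).isClosed.isOpen_compl
  by_cases hz : z ∈ S
  · have hnhds : (S \ {z})ᶜ ∈ 𝓝 z := hU.mem_nhds fun h => h.2 rfl
    have hlo : (fun k => f k - f z) =o[𝓝[≠] z] fun k => (k - z)⁻¹ := by
      refine isLittleO_of_tendsto' ?_ ?_
      · filter_upwards [self_mem_nhdsWithin] with k hk hk0
        exact absurd (sub_eq_zero.1 (inv_eq_zero.1 hk0)) hk
      · have h2 : Tendsto (fun k => (k - z) * f z) (𝓝[≠] z) (𝓝 0) := by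
          have : Tendsto (fun k => (k - z) * f z) (𝓝 z) (𝓝 ((z - z) * f z)) :=
            Continuous.tendsto (by fun_prop) z
          rw [sub_self, zero_mul] at this
          exact this.mono_left nhdsWithin_le_nhds
        have := (h0 z hz).sub h2
        rw [sub_zero] at this
        refine this.congr fun k => ?_
        rw [div_inv_eq_mul]
        ring
    have := (Complex.differentiableOn_update_limUnder_of_isLittleO hnhds
      (fun k hk => (hd k fun hkS => hk.1 ⟨hkS, hk.2⟩).differentiableWithinAt)
      hlo).differentiableAt hnhds
    refine this.congr_of_eventuallyEq ?_
    filter_upwards [hnhds] with k hk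
    by_cases hkz : k = z
    · subst hkz
      simp [hz]
    · have : k ∉ S := fun h => hk ⟨h, hkz⟩
      simp [this, Function.update_of_ne hkz]
  · refine (hd z hz).congr_of_eventuallyEq ?_
    filter_upwards [hS.isClosed.isOpen_compl.mem_nhds hz] with k hk
    exact if_neg hk

/-- Moving in the direction 1 + i leaves both axes at once. Thus bounds known off the contour pass
to the contour by continuity. -/
theorem nhdsWithin_compl_contour_neBot (z : ℂ) : (𝓝[contourᶜ] z).NeBot := by
  have hne : ∀ r : ℝ, ∀ᶠ s in 𝓝[>] (0 : ℝ), r + s ≠ 0 := fun r => by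
    by_cases hr : r = 0
    · filter_upwards [self_mem_nhdsWithin] with s hs
      rw [hr, zero_add]
      exact (Set.mem_Ioi.1 hs).ne'
    · have : ContinuousAt (fun s : ℝ => r + s) 0 := by fun_prop
      exact nhdsWithin_le_nhds (this.eventually_ne (by simpa using hr))
  have ht : Tendsto (fun s : ℝ => z + s * (1 + Complex.I)) (𝓝[>] 0) (𝓝[contourᶜ] z) := by
    refine tendsto_nhdsWithin_iff.2 ⟨?_, ?_⟩
    · have : Tendsto (fun s : ℝ => z + s * (1 + Complex.I)) (𝓝 0)
          (𝓝 (z + (0 : ℝ) * (1 + Complex.I))) := Continuous.tendsto (by fun_prop) 0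
      rw [Complex.ofReal_zero, zero_mul, add_zero] at this
      exact this.mono_left nhdsWithin_le_nhds
    · filter_upwards [hne z.re, hne z.im] with s h1 h2
      rintro (h | h) <;> simp at h
      exacts [h2 h, h1 h]
  exact ht.neBot

theorem isClosed_contour : IsClosed contour :=
  (isClosed_eq Complex.continuous_im continuous_const).union
    (isClosed_eq Complex.continuous_re continuous_const)

theorem exists_mem_ray {k : ℂ} (hk : k ∈ contour \ {0}) : ∃ n, k ∈ ray n := by
  obtain ⟨h | h, h0⟩ := hk
  · have : k.re ≠ 0 := fun h' => h0 (Complex.ext h' h)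
    rcases lt_or_gt_of_ne this with h1 | h1
    exacts [⟨3, h1, h⟩, ⟨1, h1, h⟩]
  · have : k.im ≠ 0 := fun h' => h0 (Complex.ext h h')
    rcases lt_or_gt_of_ne this with h1 | h1
    exacts [⟨2, h, h1⟩, ⟨0, h, h1⟩]

/-- Splits continuity at a point of a ray into three limits: from the left, from the right and along
the contour. -/
theorem nhds_eq_of_mem_ray {n : Fin 4} {z : ℂ} (hz : z ∈ ray n) :
    𝓝 z = 𝓝[leftQuadrant n] z ⊔ 𝓝[rightQuadrant n] z ⊔ 𝓝[contour \ {0}] z := by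
  rw [← nhdsWithin_union, ← nhdsWithin_union]
  refine (nhdsWithin_eq_nhds.2 ?_).symm
  have hre : ∀ {k : ℂ}, k.re ≠ 0 → k ≠ 0 := fun h h0 => h (by simp [h0])
  have him : ∀ {k : ℂ}, k.im ≠ 0 → k ≠ 0 := fun h h0 => h (by simp [h0])
  fin_cases n
  · filter_upwards [Complex.continuous_im.continuousAt.eventually_const_lt hz.2] with k hk
    rcases lt_trichotomy k.re 0 with h | h | h
    exacts [Or.inl (Or.inr ⟨h, hk⟩), Or.inr ⟨Or.inr h, him hk.ne'⟩, Or.inl (Or.inl ⟨h, hk⟩)]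
  · filter_upwards [Complex.continuous_re.continuousAt.eventually_const_lt hz.1] with k hk
    rcases lt_trichotomy k.im 0 with h | h | h
    exacts [Or.inl (Or.inr ⟨hk, h⟩), Or.inr ⟨Or.inl h, hre hk.ne'⟩, Or.inl (Or.inl ⟨hk, h⟩)]
  · filter_upwards [Complex.continuous_im.continuousAt.eventually_lt_const hz.2] with k hk
    rcases lt_trichotomy k.re 0 with h | h | h
    exacts [Or.inl (Or.inl ⟨h, hk⟩), Or.inr ⟨Or.inr h, him hk.ne⟩, Or.inl (Or.inr ⟨h, hk⟩)]
  · filter_upwards [Complex.continuous_re.continuousAt.eventually_lt_const hz.1] with k hk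
    rcases lt_trichotomy k.im 0 with h | h | h
    exacts [Or.inl (Or.inl ⟨hk, h⟩), Or.inr ⟨Or.inl h, hre hk.ne⟩, Or.inl (Or.inr ⟨hk, h⟩)]

/-- A function that is continuous on the contour except at `0`, bounded near `0`, and holomorphic
off the contour up to finitely many removable singularities is constant if it tends to a limit at
infinity. -/
theorem eq_of_removable_contour {S : Set ℂ} (hS : S.Finite) (hSc : Disjoint S contour) {f : ℂ → ℂ}
    {w : ℂ} (hd : ∀ k ∉ contour ∪ S, DifferentiableAt ℂ f k)
    (hc : ∀ k ∈ contour \ {0}, ContinuousAt f k)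
    (hS0 : ∀ z ∈ S, Tendsto (fun k => (k - z) * f k) (𝓝[≠] z) (𝓝 0))
    (h0 : f =O[𝓝[contourᶜ] 0] fun _ => (1 : ℂ))
    (hinf : Tendsto f (Bornology.cobounded ℂ ⊓ 𝓟 contourᶜ) (𝓝 w)) :
    ∀ k ∉ contour ∪ S, f k = w := by
  have hcl : IsClosed S := hS.isClosed
  have hcont : ∀ k ∉ S ∪ {0}, ContinuousAt f k := fun k hk => by
    by_cases hkc : k ∈ contour
    · exact hc k ⟨hkc, fun h => hk (Or.inr h)⟩
    · exact (hd k fun h => h.elim hkc fun h => hk (Or.inl h)).continuousAt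
  have hdiff : ∀ k ∉ S ∪ {0}, DifferentiableAt ℂ f k := fun k hk => by
    -- A nonzero point is off one of the axes, so a neighbourhood of it meets at most the other one,
    -- across which f extends holomorphically.
    have hU : IsOpen (S ∪ {0})ᶜ := (hS.union (Set.finite_singleton 0)).isClosed.isOpen_compl
    by_cases hre : k.re = 0
    · have him : k.im ≠ 0 := fun h => hk (Or.inr (Complex.ext hre h))
      have hV : IsOpen ((S ∪ {0})ᶜ ∩ {k : ℂ | k.im ≠ 0}) :=
        hU.inter (isOpen_ne_fun Complex.continuous_im continuous_const)
      refine (differentiableOn_of_off_imag hV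
        (fun k hk => (hcont k hk.1).continuousWithinAt) fun k hk hk0 => hd k ?_).differentiableAt
          (hV.mem_nhds ⟨hk, him⟩)
      rintro ((h | h) | h)
      exacts [hk.2 h, hk0 h, hk.1 (Or.inl h)]
    · have hV : IsOpen ((S ∪ {0})ᶜ ∩ {k : ℂ | k.re ≠ 0}) :=
        hU.inter (isOpen_ne_fun Complex.continuous_re continuous_const)
      refine (differentiableOn_of_off_real hV
        (fun k hk => (hcont k hk.1).continuousWithinAt) fun k hk hk0 => hd k ?_).differentiableAt
          (hV.mem_nhds ⟨hk, hre⟩)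
      rintro ((h | h) | h)
      exacts [hk0 h, hk.2 h, hk.1 (Or.inl h)]
  have hlim0 : Tendsto (fun k => (k - 0) * f k) (𝓝[≠] 0) (𝓝 0) := by
    obtain ⟨C, hC⟩ := h0.bound
    rw [eventually_nhdsWithin_iff] at hC
    have hS0' : ∀ᶠ k in 𝓝 (0 : ℂ), k ∉ S := hcl.isOpen_compl.mem_nhds fun h =>
      hSc.le_bot ⟨h, Or.inl rfl⟩
    -- The bound is given off the contour; continuity of f extends it to the axes, so that 0 is
    -- removable.
    have hb : ∀ᶠ k in 𝓝[≠] (0 : ℂ), ‖f k‖ ≤ C := by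
      filter_upwards [nhdsWithin_le_nhds hC.eventually_nhds, nhdsWithin_le_nhds hS0',
        self_mem_nhdsWithin] with k hk hkS hk0
      have := nhdsWithin_compl_contour_neBot k
      have hk1 : Tendsto (fun k => ‖f k‖) (𝓝[contourᶜ] k) (𝓝 ‖f k‖) :=
        (hcont k fun h => h.elim hkS hk0).norm.mono_left nhdsWithin_le_nhds
      refine le_of_tendsto hk1 ?_
      filter_upwards [nhdsWithin_le_nhds hk, self_mem_nhdsWithin] with j hj hjc
      simpa using hj hjc
    have hO : f =O[𝓝[≠] 0] fun _ => (1 : ℂ) := IsBigO.of_bound C (by simpa using hb)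
    have hz : Tendsto (fun k : ℂ => k - 0) (𝓝[≠] 0) (𝓝 0) := by
      simpa using (continuous_id'.tendsto (0 : ℂ)).mono_left nhdsWithin_le_nhds
    exact (((isBigO_refl (fun k : ℂ => k - 0) _).mul hO).congr_right fun k =>
      mul_one _).trans_tendsto hz
  obtain ⟨g, hg, hgf⟩ := exists_differentiable_of_finite (hS.union (Set.finite_singleton 0)) hdiff
    fun z hz => by
      rcases hz with hz | rfl
      exacts [hS0 z hz, hlim0]
  have hg_inf : Tendsto g (Filter.cocompact ℂ) (𝓝 w) := by
    rw [← Metric.cobounded_eq_cocompact]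
    rw [Metric.tendsto_nhds]
    intro ε hε
    have h1 := Metric.tendsto_nhds.1 hinf (ε / 2) (half_pos hε)
    rw [eventually_inf_principal] at h1
    have h2 : ∀ᶠ k in Bornology.cobounded ℂ, k ∉ S ∪ {0} :=
      (hS.union (Set.finite_singleton 0)).isBounded
    obtain ⟨R, hR⟩ : ∃ R : ℝ, ∀ k : ℂ, R ≤ ‖k‖ → (k ∈ contourᶜ → dist (f k) w < ε / 2) ∧
        k ∉ S ∪ {0} := by
      have := (hasBasis_cobounded_norm (E := ℂ)).eventually_iff.1 (h1.and h2)
      obtain ⟨R, -, hR⟩ := this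
      exact ⟨R, fun k hk => hR hk⟩
    filter_upwards [eventually_cobounded_le_norm (R + 1)] with k hk
    have := nhdsWithin_compl_contour_neBot k
    -- The limit at infinity is known off the contour only. Every point is a limit of such points,
    -- which weakens < ε/2 to ≤ ε/2; the margin R + 1 keeps the approximating points in the range of
    -- the bound.
    have hd2 : dist (g k) w ≤ ε / 2 := by
      have hk1 : Tendsto (fun k => dist (g k) w) (𝓝[contourᶜ] k) (𝓝 (dist (g k) w)) :=
        ((hg k).continuousAt.tendsto.mono_left nhdsWithin_le_nhds).dist tendsto_const_nhds
      refine le_of_tendsto hk1 ?_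
      have hk' : ∀ᶠ j in 𝓝 k, R < ‖j‖ :=
        continuous_norm.continuousAt.eventually_const_lt (by linarith)
      filter_upwards [nhdsWithin_le_nhds hk', self_mem_nhdsWithin] with j hj hjc
      obtain ⟨g1, g2⟩ := hR j hj.le
      rw [hgf g2]
      exact (g1 hjc).le
    linarith
  intro k hk
  have hk' : k ∉ S ∪ {0} := by
    rintro (h | h)
    · exact hk (Or.inr h)
    · exact hk (Or.inl (Or.inl (by rw [Set.mem_singleton_iff.1 h]; rfl)))
  rw [← hgf hk']
  exact hg.apply_eq_of_tendsto_cocompact k hg_inf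

/-! ### Uniqueness -/

theorem mul_adjugate_apply_zero (M' M : Mat) (i : Fin 2) :
    (M' * M.adjugate) i 0 = M' i 0 * M 1 1 - M' i 1 * M 1 0 := by
  simp [Matrix.mul_apply, Matrix.adjugate_fin_two]
  ring

theorem mul_adjugate_apply_one (M' M : Mat) (i : Fin 2) :
    (M' * M.adjugate) i 1 = M' i 1 * M 0 0 - M' i 0 * M 0 1 := by
  simp [Matrix.mul_apply, Matrix.adjugate_fin_two]
  ring

theorem tendsto_mul_adjugate {l : Filter ℂ} {m' m : ℂ → Mat} {M' M : Mat}
    (h' : ∀ i j, Tendsto (fun k => m' k i j) l (𝓝 (M' i j)))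
    (h : ∀ i j, Tendsto (fun k => m k i j) l (𝓝 (M i j))) (i j : Fin 2) :
    Tendsto (fun k => (m' k * (m k).adjugate) i j) l (𝓝 ((M' * M.adjugate) i j)) := by
  obtain rfl | rfl : j = 0 ∨ j = 1 := by fin_cases j <;> simp
  · simp only [mul_adjugate_apply_zero]
    exact ((h' i 0).mul (h 1 1)).sub ((h' i 1).mul (h 1 0))
  · simp only [mul_adjugate_apply_one]
    exact ((h' i 1).mul (h 0 0)).sub ((h' i 0).mul (h 0 1))

/-- Every entry of m' adj(m) pairs an entry of the first column of one matrix with an entry of the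
second column of the other, so the growth φ is always multiplied by ψ. -/
theorem tendsto_mul_adjugate_of_isBigO {m' m : ℂ → Mat} {z : ℂ} {φ ψ : ℂ → ℂ}
    (hφψ : (fun k => φ k * ψ k) =O[𝓝[≠] z] fun _ => (1 : ℂ))
    (h' : ∀ i, (fun k => m' k i 0) =O[𝓝[≠] z] φ ∧ (fun k => m' k i 1) =O[𝓝[≠] z] ψ)
    (h : ∀ i, (fun k => m k i 0) =O[𝓝[≠] z] φ ∧ (fun k => m k i 1) =O[𝓝[≠] z] ψ) (i j : Fin 2) :
    Tendsto (fun k => (k - z) * (m' k * (m k).adjugate) i j) (𝓝[≠] z) (𝓝 0) := by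
  have hψφ : (fun k => ψ k * φ k) =O[𝓝[≠] z] fun _ => (1 : ℂ) :=
    hφψ.congr_left fun k => mul_comm _ _
  have hO : (fun k => (m' k * (m k).adjugate) i j) =O[𝓝[≠] z] fun _ => (1 : ℂ) := by
    obtain rfl | rfl : j = 0 ∨ j = 1 := by fin_cases j <;> simp
    · simp only [mul_adjugate_apply_zero]
      exact (((h' i).1.mul (h 1).2).trans hφψ).sub (((h' i).2.mul (h 1).1).trans hψφ)
    · simp only [mul_adjugate_apply_one]
      exact (((h' i).2.mul (h 0).1).trans hψφ).sub (((h' i).1.mul (h 0).2).trans hφψ)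
  have hz : Tendsto (fun k : ℂ => k - z) (𝓝[≠] z) (𝓝 0) := by
    have : Tendsto (fun k : ℂ => k - z) (𝓝 z) (𝓝 (z - z)) := Continuous.tendsto (by fun_prop) z
    rw [sub_self] at this
    exact this.mono_left nhdsWithin_le_nhds
  exact (((isBigO_refl (fun k : ℂ => k - z) _).mul hO).congr_right fun k =>
    mul_one _).trans_tendsto hz

theorem isBigO_sub_mul_inv (z : ℂ) :
    (fun k => (k - z) * (k - z)⁻¹) =O[𝓝[≠] z] fun _ => (1 : ℂ) := by
  refine IsBigO.of_bound 1 ?_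
  filter_upwards [self_mem_nhdsWithin] with k hk
  rw [mul_inv_cancel₀ (sub_ne_zero.2 hk)]
  simp

/-- The same pairing: the possible residue is w' r w - w' (w r), which cancels because both
solutions obey the condition with the same r. -/
theorem ResidueCondition_mul_adjugate {m' m : ℂ → Mat} {z r : ℂ} {c c' : Fin 2} (hcc : c ≠ c')
    (h' : ResidueCondition m' z c c' r) (h : ResidueCondition m z c c' r) (i j : Fin 2) :
    Tendsto (fun k => (k - z) * (m' k * (m k).adjugate) i j) (𝓝[≠] z) (𝓝 0) := by
  obtain ⟨w', hw'⟩ := h'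
  obtain ⟨w, hw⟩ := h
  have key : ∀ p, Tendsto (fun k => (k - z) * m' k i c * m k p c' - m' k i c' * ((k - z) * m k p c))
      (𝓝[≠] z) (𝓝 0) := fun p => by
    have := ((hw' i).2.mul (hw p).1).sub ((hw' i).1.mul (hw p).2)
    rwa [show w' i * r * w p - w' i * (w p * r) = 0 by ring] at this
  obtain ⟨rfl, rfl⟩ | ⟨rfl, rfl⟩ : c = 0 ∧ c' = 1 ∨ c = 1 ∧ c' = 0 := by
    fin_cases c <;> fin_cases c' <;> simp at hcc ⊢
  all_goals obtain rfl | rfl : j = 0 ∨ j = 1 := by fin_cases j <;> simp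
  · refine (key 1).congr fun k => ?_
    rw [mul_adjugate_apply_zero]; ring
  · have := (key 0).neg
    rw [neg_zero] at this
    refine this.congr fun k => ?_
    rw [mul_adjugate_apply_one]; ring
  · have := (key 1).neg
    rw [neg_zero] at this
    refine this.congr fun k => ?_
    rw [mul_adjugate_apply_zero]; ring
  · refine (key 0).congr fun k => ?_
    rw [mul_adjugate_apply_one]; ring

section

variable {lam L x t : ℝ} {a b Γ : ℂ → ℂ} {m m' : ℂ → Mat}

theorem exists_mem_quadrant_of_mem_poleSet {k : ℂ} (hk : k ∈ poleSet lam L a b Γ) :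
    ∃ n, k ∈ quadrant n := by
  have h : ∀ w ∈ gammaPoles Γ ∪ etaPoles lam L a b Γ ∪ xiPoles lam a b Γ, w ∉ contour := by
    rintro w ((hw | hw) | hw) <;> exact notMem_contour_of_mem_quadrant hw.1
  refine exists_mem_quadrant ?_
  rcases hk with hk | hk
  exacts [h k hk, fun hc => h _ hk (conj_mem_contour.2 hc)]

theorem PoleAssumption_finite_poleSet (hP : PoleAssumption lam L a b Γ) :
    (poleSet lam L a b Γ).Finite := by
  have h := (hP.gamma_finite.union hP.eta_finite).union hP.xi_finite
  exact h.union (h.preimage (starRingEnd ℂ).injective.injOn)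

theorem SolvesRHP_tendsto_pole (h' : SolvesRHP lam L a b Γ x t m')
    (h : SolvesRHP lam L a b Γ x t m) {z : ℂ} (hz : z ∈ poleSet lam L a b Γ) (i j : Fin 2) :
    Tendsto (fun k => (k - z) * (m' k * (m k).adjugate) i j) (𝓝[≠] z) (𝓝 0) := by
  rcases hz with ((hz | hz) | hz) | hz
  · exact tendsto_mul_adjugate_of_isBigO (isBigO_sub_mul_inv z) (h'.at_gamma z hz)
      (h.at_gamma z hz) i j
  · exact ResidueCondition_mul_adjugate (by decide) (h'.at_eta z hz) (h.at_eta z hz) i j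
  · exact ResidueCondition_mul_adjugate (by decide) (h'.at_xi z hz) (h.at_xi z hz) i j
  · obtain ⟨w, rfl⟩ : ∃ w, z = conj w := ⟨conj z, (Complex.conj_conj z).symm⟩
    rw [Complex.conj_conj] at hz
    rcases hz with (hz | hz) | hz
    · exact tendsto_mul_adjugate_of_isBigO
        ((isBigO_sub_mul_inv (conj w)).congr_left fun k => mul_comm _ _) (h'.at_gamma_conj w hz)
        (h.at_gamma_conj w hz) i j
    · exact ResidueCondition_mul_adjugate (by decide) (h'.at_eta_conj w hz) (h.at_eta_conj w hz) i j
    · exact ResidueCondition_mul_adjugate (by decide) (h'.at_xi_conj w hz) (h.at_xi_conj w hz) i j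

/-- The determinant of the jump matrix is read off from the boundary values of m, so it never has to
be computed from the formulas. -/
theorem mul_adjugate_jump {P P' N N' V : Mat} (hN : N = P * V) (hN' : N' = P' * V)
    (hP : P.det = 1) (hdN : N.det = 1) : N' * N.adjugate = P' * P.adjugate := by
  have hV : V.det = 1 := by
    rw [hN, Matrix.det_mul, hP, one_mul] at hdN
    exact hdN
  rw [hN, hN', Matrix.adjugate_mul_distrib, Matrix.mul_assoc, ← Matrix.mul_assoc V,
    Matrix.mul_adjugate, hV, one_smul, Matrix.one_mul]

theorem quadrant_neBot_of_mem_ray {n : Fin 4} {z : ℂ} (hz : z ∈ ray n) :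
    (𝓝[leftQuadrant n] z).NeBot ∧ (𝓝[rightQuadrant n] z).NeBot := by
  have key : ∀ (S : Set ℂ) (w : ℂ), (∀ s : ℝ, 0 < s → z + s * w ∈ S) → (𝓝[S] z).NeBot := by
    intro S w hS
    have ht : Tendsto (fun s : ℝ => z + s * w) (𝓝[>] 0) (𝓝[S] z) := by
      refine tendsto_nhdsWithin_iff.2 ⟨?_, ?_⟩
      · have : Tendsto (fun s : ℝ => z + s * w) (𝓝 0) (𝓝 (z + (0 : ℝ) * w)) :=
          Continuous.tendsto (by fun_prop) 0
        rw [Complex.ofReal_zero, zero_mul, add_zero] at this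
        exact this.mono_left nhdsWithin_le_nhds
      · filter_upwards [self_mem_nhdsWithin] with s hs using hS s hs
    exact ht.neBot
  fin_cases n
  · obtain ⟨h1, h2⟩ : z.re = 0 ∧ 0 < z.im := hz
    exact ⟨key _ 1 fun s hs => mem_quadrant_zero.2 (by simp [h1, h2, hs]),
      key _ (-1) fun s hs => mem_quadrant_one.2 (by simp [h1, h2, hs])⟩
  · obtain ⟨h1, h2⟩ : 0 < z.re ∧ z.im = 0 := hz
    exact ⟨key _ Complex.I fun s hs => mem_quadrant_zero.2 (by simp [h1, h2, hs]),
      key _ (-Complex.I) fun s hs => mem_quadrant_three.2 (by simp [h1, h2, hs])⟩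
  · obtain ⟨h1, h2⟩ : z.re = 0 ∧ z.im < 0 := hz
    exact ⟨key _ (-1) fun s hs => mem_quadrant_two.2 (by simp [h1, h2, hs]),
      key _ 1 fun s hs => mem_quadrant_three.2 (by simp [h1, h2, hs])⟩
  · obtain ⟨h1, h2⟩ : z.re < 0 ∧ z.im = 0 := hz
    exact ⟨key _ (-Complex.I) fun s hs => mem_quadrant_two.2 (by simp [h1, h2, hs]),
      key _ Complex.I fun s hs => mem_quadrant_one.2 (by simp [h1, h2, hs])⟩

theorem side_subset_compl_contour (n : Fin 4) :
    leftQuadrant n ⊆ contourᶜ ∧ rightQuadrant n ⊆ contourᶜ := by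
  have h : ∀ n, quadrant n ⊆ contourᶜ := fun n k hk => notMem_contour_of_mem_quadrant hk
  fin_cases n
  exacts [⟨h 0, h 1⟩, ⟨h 0, h 3⟩, ⟨h 2, h 3⟩, ⟨h 2, h 1⟩]

/-- Two solutions of the Riemann-Hilbert problem agree if one of them has determinant one. -/
theorem SolvesRHP_unique (hP : PoleAssumption lam L a b Γ) (h : SolvesRHP lam L a b Γ x t m)
    (hdet : ∀ k ∈ (contour ∪ poleSet lam L a b Γ)ᶜ, (m k).det = 1)
    (h' : SolvesRHP lam L a b Γ x t m') :
    Set.EqOn m' m (contour ∪ poleSet lam L a b Γ)ᶜ := by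
  classical
  have hfin := PoleAssumption_finite_poleSet hP
  have hdisj : Disjoint (poleSet lam L a b Γ) contour := Set.disjoint_left.2 fun k hk hc => by
    obtain ⟨n, hn⟩ := exists_mem_quadrant_of_mem_poleSet hk
    exact notMem_contour_of_mem_quadrant hn hc
  obtain ⟨mp, mm, hmp, -, hj⟩ := h.jump_relation
  obtain ⟨mp', mm', hmp', -, hj'⟩ := h'.jump_relation
  -- N is m' m⁻¹, with values on Σ filled in from the left side. The adjugate replaces the inverse,
  -- so only det m = 1 is needed and nothing about det m'.
  let N : ℂ → Mat := fun k => if k ∈ contour then mp' k * (mp k).adjugate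
    else m' k * (m k).adjugate
  have hNoff : ∀ k ∉ contour, N k = m' k * (m k).adjugate := fun k hk => if_neg hk
  have hNon : ∀ k ∈ contour, N k = mp' k * (mp k).adjugate := fun k hk => if_pos hk
  have hNev : ∀ k ∉ contour, ∀ i j,
      (fun k => N k i j) =ᶠ[𝓝 k] fun k => (m' k * (m k).adjugate) i j := fun k hk i j => by
    filter_upwards [isClosed_contour.isOpen_compl.mem_nhds hk] with w hw
    rw [hNoff w hw]
  have hN1 : ∀ k ∈ (contour ∪ poleSet lam L a b Γ)ᶜ, N k = 1 := by
    intro k hk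
    ext i j
    refine eq_of_removable_contour hfin hdisj (f := fun k => N k i j) ?_ ?_ ?_ ?_ ?_ k hk
    · intro k hk
      have hk' : k ∉ contour := fun hc => hk (Or.inl hc)
      refine DifferentiableAt.congr_of_eventuallyEq ?_ (hNev k hk' i j)
      have d' := fun i j => (h'.analytic i j k hk).differentiableAt
      have d := fun i j => (h.analytic i j k hk).differentiableAt
      obtain rfl | rfl : j = 0 ∨ j = 1 := by fin_cases j <;> simp
      · simp only [mul_adjugate_apply_zero]
        exact ((d' i 0).mul (d 1 1)).sub ((d' i 1).mul (d 1 0))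
      · simp only [mul_adjugate_apply_one]
        exact ((d' i 1).mul (d 0 0)).sub ((d' i 0).mul (d 0 1))
    · intro z hz
      obtain ⟨n, hn⟩ := exists_mem_ray hz
      obtain ⟨l1, r1, e1⟩ := hj n z hn
      obtain ⟨l2, r2, e2⟩ := hj' n z hn
      obtain ⟨ne1, ne2⟩ := quadrant_neBot_of_mem_ray hn
      obtain ⟨s1, s2⟩ := side_subset_compl_contour n
      have hzP : ∀ᶠ k in 𝓝 z, k ∉ poleSet lam L a b Γ :=
        hfin.isClosed.isOpen_compl.mem_nhds fun hzp => Set.disjoint_left.1 hdisj hzp hz.1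
      -- The determinant condition passes to the boundary values by continuity, from both sides of
      -- the ray.
      have hdet1 : ∀ {S : Set ℂ} {M : Mat}, S ⊆ contourᶜ → (𝓝[S] z).NeBot →
          (∀ i j, Tendsto (fun k => m k i j) (𝓝[S] z) (𝓝 (M i j))) → M.det = 1 := by
        intro S M hS hne hM
        have h1 : Tendsto (fun k => (m k).det) (𝓝[S] z) (𝓝 M.det) := by
          simp only [Matrix.det_fin_two]
          exact ((hM 0 0).mul (hM 1 1)).sub ((hM 0 1).mul (hM 1 0))
        refine tendsto_nhds_unique (h1.congr' ?_) tendsto_const_nhds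
        filter_upwards [nhdsWithin_le_nhds hzP, self_mem_nhdsWithin] with k hkP hkS
        exact hdet k fun hk => hk.elim (hS hkS) hkP
      have hjump := mul_adjugate_jump e1 e2 (hdet1 s1 ne1 l1) (hdet1 s2 ne2 r1)
      rw [ContinuousAt, nhds_eq_of_mem_ray hn]
      simp only [hNon z hz.1]
      refine (Tendsto.sup ?_ ?_).sup ?_
      · refine (tendsto_mul_adjugate l2 l1 i j).congr' ?_
        filter_upwards [self_mem_nhdsWithin] with k hk
        rw [hNoff k (s1 hk)]
      · rw [← hjump]
        refine (tendsto_mul_adjugate r2 r1 i j).congr' ?_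
        filter_upwards [self_mem_nhdsWithin] with k hk
        rw [hNoff k (s2 hk)]
      · refine (tendsto_mul_adjugate (fun i j => hmp' i j z hz) (fun i j => hmp i j z hz) i
          j).congr' ?_
        filter_upwards [self_mem_nhdsWithin] with k hk
        rw [hNon k hk.1]
    · intro z hz
      refine (SolvesRHP_tendsto_pole h' h hz i j).congr' ?_
      filter_upwards [nhdsWithin_le_nhds
        (hNev z (fun hc => Set.disjoint_left.1 hdisj hz hc) i j)] with k hk
      rw [hk]
    · have hO : (fun k => (m' k * (m k).adjugate) i j) =O[𝓝[contourᶜ] 0] fun _ => (1 : ℂ) := by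
        have e := h.at_zero
        have e' := h'.at_zero
        obtain rfl | rfl : j = 0 ∨ j = 1 := by fin_cases j <;> simp
        · simp only [mul_adjugate_apply_zero]
          simpa using ((e' i 0).mul (e 1 1)).sub ((e' i 1).mul (e 1 0))
        · simp only [mul_adjugate_apply_one]
          simpa using ((e' i 1).mul (e 0 0)).sub ((e' i 0).mul (e 0 1))
      refine hO.congr' ?_ EventuallyEq.rfl
      filter_upwards [self_mem_nhdsWithin] with k hk
      rw [hNoff k hk]
    · have hl : Bornology.cobounded ℂ ⊓ 𝓟 contourᶜ ≤ Bornology.cobounded ℂ := inf_le_left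
      have := tendsto_mul_adjugate (fun i j => tendsto_of_isBigO_inv hl (h'.at_infinity i j))
        (fun i j => tendsto_of_isBigO_inv hl (h.at_infinity i j)) i j
      rw [Matrix.adjugate_one, Matrix.mul_one] at this
      refine this.congr' ?_
      filter_upwards [mem_inf_of_right (mem_principal_self _)] with k hk
      rw [hNoff k hk]
  intro k hk
  have h1 := hN1 k hk
  rw [hNoff k fun hc => hk (Or.inl hc)] at h1
  calc m' k = m' k * ((m k).adjugate * m k) := by
        rw [Matrix.adjugate_mul, hdet k hk, one_smul, Matrix.mul_one]
    _ = m k := by rw [← Matrix.mul_assoc, h1, Matrix.one_mul]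

end

/-! ### The main theorem -/

theorem mainTheorem2 (lam L T : ℝ) (hlam : lam = 1 ∨ lam = -1) (hL : 0 < L) (hT : 0 < T)
    (q : ℝ → ℝ → ℂ) (hq : IsPeriodicSolution lam L T q)
    (a b Γ : ℂ → ℂ) (ha : a = speca lam L T q) (hb : b = specb lam L T q)
    (hΓ : Γ = specGamma lam L T q) (hP : PoleAssumption lam L a b Γ)
    (x t : ℝ) (hx : x ∈ Set.Icc 0 L) (ht : t ∈ Set.Icc 0 T) :
    ∃ m : ℂ → Mat,
      SolvesRHP lam L a b Γ x t m ∧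
      (∀ m' : ℂ → Mat, SolvesRHP lam L a b Γ x t m' →
        Set.EqOn m' m (contour ∪ poleSet lam L a b Γ)ᶜ) ∧
      (∀ j : Fin 4, (x, t) ≠ corner L T j → ∀ ε : ℝ, 0 < ε →
        Tendsto (fun k => 2 * Complex.I * (k * m k 0 1))
          (Bornology.cobounded ℂ ⊓ 𝓟 (sector ε j)) (𝓝 (q x t))) ∧
      (∀ k ∈ (contour ∪ poleSet lam L a b Γ)ᶜ,
        (m k).det = 1 ∧
        m k 0 0 = conj (m (conj k) 1 1) ∧
        m k 1 0 = (lam : ℂ) * conj (m (conj k) 0 1)) := by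
  obtain ⟨M, qx, qxx, qt, qxt, hM, hjet⟩ := exists_isJet hT hq
  obtain ⟨ψ, hψ₁, hψ₂, hψ₃⟩ := exists_fundamental hL.le hT.le hM hjet
  have hψ : IsFundamental lam L T q qx ψ := ⟨hψ₁, hψ₂, hψ₃⟩
  have h0L : (0 : ℝ) ∈ Set.Icc 0 L := ⟨le_rfl, hL.le⟩
  have h0T : (0 : ℝ) ∈ Set.Icc 0 T := ⟨le_rfl, hT.le⟩
  have hLL : L ∈ Set.Icc 0 L := ⟨hL.le, le_rfl⟩
  have hTT : T ∈ Set.Icc 0 T := ⟨hT.le, le_rfl⟩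
  have ha' : muCol ψ L 0 0 0 1 = a := by
    rw [ha]; ext k
    exact (hψ.eigenfunction_eq_muCol hT.le hjet hLL h0T h0L h0T 1 k).symm
  have hb' : muCol ψ L 0 0 0 0 = b := by
    rw [hb]; ext k
    exact (hψ.eigenfunction_eq_muCol hT.le hjet hLL h0T h0L h0T 0 k).symm
  have h := hψ.isRHPData hlam hL.le hT.le hM hjet hx ht
  rw [ha', hb'] at h
  have hΓ' : Γ = fun k => muCol ψ 0 T 0 0 0 k / muCol ψ 0 T 0 0 1 k := by
    rw [hΓ]; ext k
    rw [← hψ.eigenfunction_eq_muCol hT.le hjet h0L hTT h0L h0T 0 k,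
      ← hψ.eigenfunction_eq_muCol hT.le hjet h0L hTT h0L h0T 1 k]
    rfl
  have hsol := h.solvesRHP hΓ' hP
  have hdet : ∀ k ∈ (contour ∪ poleSet lam L a b Γ)ᶜ, (rhpSol lam L a b (muCol ψ 0 T 0 0 1)
      (muCol ψ 0 T 0 0 0) (fun n => muCol ψ (corner L T n).1 (corner L T n).2 x t) k).det = 1 := by
    intro k hk
    obtain ⟨n, hn⟩ := exists_mem_quadrant fun hc => hk (Or.inl hc)
    rw [rhpSol_eq hn]
    exact h.det_quadSol (h.quadDen_ne_zero hΓ' hP hn fun hp => hk (Or.inr hp))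
  refine ⟨_, hsol, fun m' hm' => SolvesRHP_unique hP hsol hdet hm',
    fun j hj ε hε => h.tendsto_rhpSol j hj hε, fun k hk => ⟨hdet k hk, ?_, ?_⟩⟩
  all_goals
    rw [rhpSol_symm h.lam_mul_self fun hc => hk (Or.inl hc)]
    rfl
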